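/- Let $k$ be a field of characteristic zero, let $d\ge 3$, let $R=k[x_1,\dots,x_d]$ and $\mathfrak m=(x_1,\dots,x_d)$. Let $I=(f_1,\dots,f_{d+1})\subset R$ be an ideal of height two such that * $f_1,\dots,f_{d+1}$ are homogeneous of the same degree $\nu$ and $d+1$ is the minimal number of generators of $I$; * $I$ is perfect, i.e. $\operatorname{projdim}_R(R/I)=\operatorname{grade} I$; * $I$ satisfies $G_d$, i.e. $\mu(I_{\mathfrak p})\le\dim R_{\mathfrak p}$ for every prime $\mathfrak p\supseteq I$ with $\mathfrak p\ne\mathfrak m$, where $\mu$ denotes the minimal number of generators. Then $I$ has a graded free resolution $$0\to\bigoplus_{j=1}^{d}R(-\nu-\nu_j)\xrightarrow{\ \varphi\ }R(-\nu)^{d+1}\xrightarrow{[f_1,\dots,f_{d+1}]}I\to 0$$ with a $(d+1)\times d$ matrix $\varphi$ whose $j$-th column consists of forms of degree $\nu_j$. Fix any such resolution. Let $S=R[T_1,\dots,T_{d+1}]$, bigraded by $\operatorname{bideg}T_i=(1,0)$ and $\operatorname{bideg}x_j=(0,1)$, and let $[g_1,\dots,g_d]=[T_1,\dots,T_{d+1}]\cdot\varphi$.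 The symmetric algebra $\operatorname{Sym}(I)$ is an $S$-algebra through $T_i\mapsto f_i\in I=\operatorname{Sym}_1(I)$, and its components are the images of those of $S$. Let $\mathcal K=\ker\big(\operatorname{Sym}(I)\to\mathcal R(I)\big)$ be the kernel of the canonical map onto the Rees algebra $\mathcal R(I)=\bigoplus_{n\ge0}I^nt^n$, with the induced bigrading. Let $\mathcal T=A_d(k)[T_1,\dots,T_{d+1}]$ be the polynomial ring over the Weyl algebra $A_d(k)=k\langle x_1,\dots,x_d,\partial_1,\dots,\partial_d\rangle$, which contains $S$. It acts on $S$ (written $\bullet$) with $x_i$ and $T_j$ acting by multiplication and $\partial_i$ as $\partial/\partial x_i$. Let $\mathcal F$ be the automorphism of $\mathcal T$ with $\mathcal F(x_i)=\partial_i$, $\mathcal F(\partial_i)=-x_i$, $\mathcal F(T_j)=T_j$. Put $L_j=\mathcal F(g_j)$ and $$\operatorname{Sol}(L_1,\dots,L_d;S)=\{h\in S\mid L_j\bullet h=0\text{ for }j=1,\dots,d\}.$$ Let $\operatorname{Sol}(L_1,\dots,L_d;S)_{\mathcal F}$ be this group with the $S$-module structure $f\diamond h=\mathcal F(f)\bullet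 h$ and with the bigrading in which a monomial $x^\alpha T^\beta$ has bidegree $(|\beta|,-|\alpha|)$. Then $\mathcal K$ and $\operatorname{Sol}(L_1,\dots,L_d;S)_{\mathcal F}$ are bigraded $S$-modules, and there is an isomorphism of bigraded $S$-modules $$\mathcal K\;\cong\;\operatorname{Sol}(L_1,\dots,L_d;S)_{\mathcal F}(-d,\,-\nu+d),$$ where $M(a)_b=M_{a+b}$ for $a,b\in\mathbb Z^2$. -/

import Mathlib

noncomputable section

namespace ReesDmod

open MvPolynomial

universe u

/-! ### The polynomial rings `R = k[x₁,…,x_d]` and `S = k[x₁,…,x_d,T₁,…,T_{d+1}]` -/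

/-- `R = k[x₁,…,x_d]`. -/
abbrev PolyR (k : Type u) [Field k] (d : ℕ) : Type u := MvPolynomial (Fin d) k

/-- `S = R[T₁,…,T_{d+1}]`; `Sum.inl i` indexes `x_i` and `Sum.inr j` indexes `T_j`. -/
abbrev PolyS (k : Type u) [Field k] (d : ℕ) : Type u := MvPolynomial (Fin d ⊕ Fin (d + 1)) k

/-- The inclusion `R ⊂ S`. -/
def inclRS (k : Type u) [Field k] (d : ℕ) : PolyR k d →ₐ[k] PolyS k d := rename Sum.inl

/-- `bideg x_i = (0, 1)` and `bideg T_j = (1, 0)`. -/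
def bidegWeight (d : ℕ) : Fin d ⊕ Fin (d + 1) → ℤ × ℤ :=
  Sum.elim (fun _ => (0, 1)) (fun _ => (1, 0))

/-- The bihomogeneous component `S_a`, `a ∈ ℤ²`. -/
def gradeS (k : Type u) [Field k] (d : ℕ) (a : ℤ × ℤ) : AddSubgroup (PolyS k d) :=
  (weightedHomogeneousSubmodule k (bidegWeight d) a).toAddSubgroup

/-! ### Bigraded `S`-modules -/

/-- The family `𝓜` of subgroups makes the `S`-module `M` a `ℤ²`-graded `S`-module. -/
structure IsBigraded {k : Type u} [Field k] {d : ℕ} {M : Type*} [AddCommGroup M]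
    [Module (PolyS k d) M] (𝓜 : ℤ × ℤ → AddSubgroup M) : Prop where
  isInternal : DirectSum.IsInternal 𝓜
  smul_mem : ∀ (a b : ℤ × ℤ) (s : PolyS k d) (m : M),
    s ∈ gradeS k d a → m ∈ 𝓜 b → s • m ∈ 𝓜 (a + b)

/-- The components of the twisted module `M(a)`, that is, `M(a)_b = M_{a + b}`. -/
def shift {M : Type*} [AddCommGroup M] (𝓜 : ℤ × ℤ → AddSubgroup M) (a : ℤ × ℤ) :
    ℤ × ℤ → AddSubgroup M :=
  fun b => 𝓜 (a + b)

/-- `M` and `N` are bigraded `S`-modules and isomorphic as such (by an isomorphism of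
bidegree `(0, 0)`). -/
def BigradedIsomorphic {k : Type u} [Field k] {d : ℕ} {M N : Type*} [AddCommGroup M]
    [Module (PolyS k d) M] [AddCommGroup N] [Module (PolyS k d) N]
    (𝓜 : ℤ × ℤ → AddSubgroup M) (𝓝 : ℤ × ℤ → AddSubgroup N) : Prop :=
  IsBigraded (k := k) (d := d) 𝓜 ∧ IsBigraded (k := k) (d := d) 𝓝 ∧
    ∃ e : M ≃ₗ[PolyS k d] N, ∀ (a : ℤ × ℤ) (m : M), m ∈ 𝓜 a ↔ e m ∈ 𝓝 a

/-! ### Perfect ideals and the condition `G_d` -/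

/-- The grade of `I`: the supremum of the lengths of the `A`-regular sequences in `I`. -/
def grade {A : Type*} [CommRing A] (I : Ideal A) : ℕ∞ :=
  ⨆ (rs : List A) (_ : RingTheory.Sequence.IsRegular A rs) (_ : ∀ r ∈ rs, r ∈ I),
    (rs.length : ℕ∞)

/-- `I` is perfect: `projdim_A (A/I) = grade I`. -/
def IsPerfectIdeal {A : Type u} [CommRing A] (I : Ideal A) : Prop :=
  CategoryTheory.projectiveDimension (ModuleCat.of A (A ⧸ I)) = ((grade I : ℕ∞) : WithBot ℕ∞)

/-- `G_d`: `μ(I_𝔭) ≤ dim R_𝔭` for every prime `𝔭 ⊇ I` other than `𝔪 = (x₁,…,x_d)`. -/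
def SatisfiesG {k : Type u} [Field k] {d : ℕ} (I : Ideal (PolyR k d)) : Prop :=
  ∀ (p : Ideal (PolyR k d)) [p.IsPrime], I ≤ p →
    p ≠ Ideal.span (Set.range (X : Fin d → PolyR k d)) →
    ((Submodule.spanFinrank
        (I.map (algebraMap (PolyR k d) (Localization.AtPrime p))) : ℕ) : WithBot ℕ∞) ≤
      ringKrullDim (Localization.AtPrime p)

/-! ### The symmetric algebra, the Rees algebra and the kernel `𝒦` -/

/-- The linear map `I → R(I) = ⨁ Iⁿ tⁿ`, `a ↦ a t`. -/
def degreeOne {A : Type*} [CommRing A] (I : Ideal A) : I →ₗ[A] reesAlgebra I where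
  toFun a := ⟨Polynomial.monomial 1 (a : A), reesAlgebra.monomial_mem.2 (by simp)⟩
  map_add' a b := Subtype.ext (by simp)
  map_smul' r a := Subtype.ext (by simp [Polynomial.smul_monomial])

/-- The canonical map `α : Sym(I) → R(I)`. -/
def symToRees {A : Type*} [CommRing A] (I : Ideal A) :
    SymmetricAlgebra A I →ₐ[A] reesAlgebra I :=
  SymmetricAlgebra.lift (degreeOne I)

section Sym

variable {k : Type u} [Field k] {d : ℕ}

/-- The ideal `I = (f₁,…,f_{d+1})`. -/
abbrev idealOf (f : Fin (d + 1) → PolyR k d) : Ideal (PolyR k d) := Ideal.span (Set.range f)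

/-- `Sym(I)` for `I = (f₁,…,f_{d+1})`, to be viewed as an `S`-algebra through the generators. -/
def SymI (f : Fin (d + 1) → PolyR k d) : Type u := SymmetricAlgebra (PolyR k d) (idealOf f)

instance (f : Fin (d + 1) → PolyR k d) : CommRing (SymI f) :=
  inferInstanceAs (CommRing (SymmetricAlgebra (PolyR k d) (idealOf f)))

/-- The ring homomorphism `β : S → Sym(I)`, the natural one on `R`, with `T_j` mapped to the
degree one element `f_j ∈ I = Sym₁(I)`. -/
def symPresentation (f : Fin (d + 1) → PolyR k d) : PolyS k d →+* SymI f :=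
  eval₂Hom
    ((algebraMap (PolyR k d) (SymmetricAlgebra (PolyR k d) (idealOf f))).comp C)
    (Sum.elim
      (fun i => algebraMap (PolyR k d) (SymmetricAlgebra (PolyR k d) (idealOf f)) (X i))
      (fun j => SymmetricAlgebra.ι (PolyR k d) (idealOf f)
        ⟨f j, Ideal.subset_span (Set.mem_range_self j)⟩))

instance (f : Fin (d + 1) → PolyR k d) : Algebra (PolyS k d) (SymI f) :=
  (symPresentation f).toAlgebra

/-- `α : Sym(I) → R(I)` as a ring homomorphism. -/
def alphaI (f : Fin (d + 1) → PolyR k d) : SymI f →+* reesAlgebra (idealOf f) :=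
  (symToRees (idealOf f)).toRingHom

/-- `𝒦 = ker (Sym(I) → R(I))`, as an `S`-module. -/
def kernelK (f : Fin (d + 1) → PolyR k d) : Submodule (PolyS k d) (SymI f) :=
  (RingHom.ker (alphaI f)).restrictScalars (PolyS k d)

/-- `𝒦_a = 𝒦 ∩ Sym(I)_a`, where `Sym(I)_a` is the image of `S_a`. -/
def gradeK (f : Fin (d + 1) → PolyR k d) (a : ℤ × ℤ) : AddSubgroup (kernelK f) :=
  ((gradeS k d a).map (symPresentation f).toAddMonoidHom).comap (kernelK f).subtype.toAddMonoidHom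

/-! ### The graded free resolution of `I` and the equations `g_j` -/

/-- `0 → ⨁ R(-ν-ν_j) --φ--> R(-ν)^{d+1} --[f₁,…,f_{d+1}]--> I → 0` is exact and the entries of the
`j`-th column of `φ` are homogeneous of degree `ν_j`. -/
structure IsResolutionMatrix (f : Fin (d + 1) → PolyR k d)
    (φ : Matrix (Fin (d + 1)) (Fin d) (PolyR k d)) (δ : Fin d → ℕ) : Prop where
  homogeneous : ∀ i j, (φ i j).IsHomogeneous (δ j)
  injective : Function.Injective φ.mulVec
  exact : ∀ v : Fin (d + 1) → PolyR k d, f ⬝ᵥ v = 0 ↔ ∃ w : Fin d → PolyR k d, φ.mulVec w = v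

/-- `[g₁,…,g_d] = [T₁,…,T_{d+1}] · φ`. -/
def symEq (φ : Matrix (Fin (d + 1)) (Fin d) (PolyR k d)) (j : Fin d) : PolyS k d :=
  ∑ i, inclRS k d (φ i j) * X (Sum.inr i)

end Sym

/-! ### The ring `𝒯 = A_d(k)[T₁,…,T_{d+1}]` over the Weyl algebra and the Fourier transform -/

/-- Generators of `𝒯`. -/
inductive WGen (d : ℕ) : Type
  | x (i : Fin d) : WGen d
  | del (i : Fin d) : WGen d
  | T (j : Fin (d + 1)) : WGen d

section Weyl

variable (k : Type u) [Field k] (d : ℕ)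

/-- Defining relations of `𝒯`: those of the Weyl algebra, and the `T_j` are central. -/
inductive WRel : FreeAlgebra k (WGen d) → FreeAlgebra k (WGen d) → Prop
  | x_x (i j : Fin d) :
      WRel (FreeAlgebra.ι k (.x i) * FreeAlgebra.ι k (.x j))
        (FreeAlgebra.ι k (.x j) * FreeAlgebra.ι k (.x i))
  | del_del (i j : Fin d) :
      WRel (FreeAlgebra.ι k (.del i) * FreeAlgebra.ι k (.del j))
        (FreeAlgebra.ι k (.del j) * FreeAlgebra.ι k (.del i))
  | del_x (i j : Fin d) :
      WRel (FreeAlgebra.ι k (.del i) * FreeAlgebra.ι k (.x j))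
        (FreeAlgebra.ι k (.x j) * FreeAlgebra.ι k (.del i) + if i = j then 1 else 0)
  | T_central (j : Fin (d + 1)) (a : WGen d) :
      WRel (FreeAlgebra.ι k (.T j) * FreeAlgebra.ι k a)
        (FreeAlgebra.ι k a * FreeAlgebra.ι k (.T j))

/-- `𝒯 = A_d(k)[T₁,…,T_{d+1}]`. -/
def WeylT : Type u := RingQuot (WRel k d)

instance : Ring (WeylT k d) := inferInstanceAs (Ring (RingQuot (WRel k d)))

instance : Algebra k (WeylT k d) := inferInstanceAs (Algebra k (RingQuot (WRel k d)))

variable {d}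

/-- The class in `𝒯` of a generator. -/
def gen (a : WGen d) : WeylT k d := RingQuot.mkAlgHom k (WRel k d) (FreeAlgebra.ι k a)

variable {k} in
theorem gen_rel {a b : FreeAlgebra k (WGen d)} (h : WRel k d a b) :
    (RingQuot.mkAlgHom k (WRel k d) a : WeylT k d) = RingQuot.mkAlgHom k (WRel k d) b :=
  RingQuot.mkAlgHom_rel k h

theorem gen_x_x (i j : Fin d) : gen k (.x i) * gen k (.x j) = gen k (.x j) * gen k (.x i) := by
  have h := gen_rel (WRel.x_x (k := k) i j)
  rw [map_mul, map_mul] at h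
  exact h

theorem gen_del_del (i j : Fin d) :
    gen k (.del i) * gen k (.del j) = gen k (.del j) * gen k (.del i) := by
  have h := gen_rel (WRel.del_del (k := k) i j)
  rw [map_mul, map_mul] at h
  exact h

theorem gen_del_x (i j : Fin d) :
    gen k (.del i) * gen k (.x j) = gen k (.x j) * gen k (.del i) + if i = j then 1 else 0 := by
  have h := gen_rel (WRel.del_x (k := k) i j)
  rw [map_add, map_mul, map_mul, apply_ite (RingQuot.mkAlgHom k (WRel k d)), map_one,
    map_zero] at h
  exact h

theorem gen_T (j : Fin (d + 1)) (a : WGen d) :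
    gen k (.T j) * gen k a = gen k a * gen k (.T j) := by
  have h := gen_rel (WRel.T_central (k := k) j a)
  rw [map_mul, map_mul] at h
  exact h

/-- The universal property of `𝒯`. -/
def liftT {B : Type*} [Ring B] [Algebra k B] (F : WGen d → B)
    (h : ∀ ⦃a b : FreeAlgebra k (WGen d)⦄, WRel k d a b →
      FreeAlgebra.lift k F a = FreeAlgebra.lift k F b) : WeylT k d →ₐ[k] B :=
  RingQuot.liftAlgHom k ⟨FreeAlgebra.lift k F, h⟩

theorem liftT_gen {B : Type*} [Ring B] [Algebra k B] (F : WGen d → B)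
    (h : ∀ ⦃a b : FreeAlgebra k (WGen d)⦄, WRel k d a b →
      FreeAlgebra.lift k F a = FreeAlgebra.lift k F b) (a : WGen d) :
    liftT k F h (gen k a) = F a := by
  refine (RingQuot.liftAlgHom_mkAlgHom_apply k _ h _).trans ?_
  simp

theorem algHomT_ext {B : Type*} [Ring B] [Algebra k B] {F G : WeylT k d →ₐ[k] B}
    (h : ∀ a, F (gen k a) = G (gen k a)) : F = G := by
  refine RingQuot.ringQuot_ext' (S := k) F G ?_
  ext a
  exact h a

/-- The natural action `•` of `𝒯` on `S`: `x_i` and `T_j` act by multiplication and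
`∂_i` acts as `∂/∂x_i`. -/
def actS : WeylT k d →ₐ[k] Module.End k (PolyS k d) :=
  liftT k (fun
    | .x i => LinearMap.mulLeft k (X (Sum.inl i))
    | .del i => (pderiv (Sum.inl i)).toLinearMap
    | .T j => LinearMap.mulLeft k (X (Sum.inr j))) (by
    intro a b h
    induction h with
    | x_x i j =>
      simp only [map_mul, FreeAlgebra.lift_ι_apply]
      refine LinearMap.ext fun p => ?_
      simp only [Module.End.mul_apply, LinearMap.mulLeft_apply]
      ring
    | del_del i j =>
      simp only [map_mul, FreeAlgebra.lift_ι_apply]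
      refine LinearMap.ext fun p => ?_
      simp only [Module.End.mul_apply]
      have h : ⁅(pderiv (Sum.inl i) : Derivation k (PolyS k d) (PolyS k d)),
          (pderiv (Sum.inl j) : Derivation k (PolyS k d) (PolyS k d))⁆ = 0 := by
        refine MvPolynomial.derivation_ext (R := k) fun l => ?_
        rw [Derivation.commutator_apply]
        simp only [pderiv_X, Derivation.coe_zero, Pi.zero_apply]
        rw [show (Pi.single (Sum.inl j) 1 : Fin d ⊕ Fin (d + 1) → PolyS k d) l
            = C (if l = Sum.inl j then 1 else 0) by
              by_cases hl : l = Sum.inl j <;> simp [hl],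
          show (Pi.single (Sum.inl i) 1 : Fin d ⊕ Fin (d + 1) → PolyS k d) l
            = C (if l = Sum.inl i then 1 else 0) by
              by_cases hl : l = Sum.inl i <;> simp [hl],
          pderiv_C, pderiv_C, sub_zero]
      have h2 := congrArg (fun D : Derivation k (PolyS k d) (PolyS k d) => D p) h
      simp only [Derivation.commutator_apply, Derivation.coe_zero, Pi.zero_apply] at h2
      exact sub_eq_zero.1 h2
    | del_x i j =>
      simp only [map_mul, map_add, FreeAlgebra.lift_ι_apply]
      refine LinearMap.ext fun p => ?_
      by_cases hij : i = j
      · subst hij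
        simp [Derivation.leibniz]
      · have hne : (Sum.inl j : Fin d ⊕ Fin (d + 1)) ≠ Sum.inl i := by
          simpa using fun h => hij h.symm
        simp [hij, Derivation.leibniz, pderiv_X_of_ne hne]
    | T_central j a =>
      simp only [map_mul, FreeAlgebra.lift_ι_apply]
      refine LinearMap.ext fun p => ?_
      cases a with
      | x i => simp only [Module.End.mul_apply, LinearMap.mulLeft_apply]; ring
      | T i => simp only [Module.End.mul_apply, LinearMap.mulLeft_apply]; ring
      | del i =>
        have hne : (Sum.inr j : Fin d ⊕ Fin (d + 1)) ≠ Sum.inl i := by simp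
        simp [Derivation.leibniz, pderiv_X_of_ne hne])

/-- `𝓕` on generators. -/
def fourierGen : WGen d → WeylT k d
  | .x i => gen k (.del i)
  | .del i => -gen k (.x i)
  | .T j => gen k (.T j)

/-- `𝓕⁻¹` on generators. -/
def fourierInvGen : WGen d → WeylT k d
  | .x i => -gen k (.del i)
  | .del i => gen k (.x i)
  | .T j => gen k (.T j)

theorem fourierGen_rel ⦃a b : FreeAlgebra k (WGen d)⦄ (h : WRel k d a b) :
    FreeAlgebra.lift k (fourierGen k) a = FreeAlgebra.lift k (fourierGen k) b := by
  induction h with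
  | x_x i j => simpa [fourierGen] using gen_del_del k i j
  | del_del i j => simpa [fourierGen] using gen_x_x k i j
  | del_x i j =>
    have h := gen_del_x k j i
    by_cases hij : i = j
    · subst hij
      simp [fourierGen] at h ⊢
      rw [h]; abel
    · simp [fourierGen, hij, Ne.symm hij] at h ⊢
      rw [h]
  | T_central j a =>
    have h := fun a => gen_T k j a
    cases a <;> simp [fourierGen, h]

theorem fourierInvGen_rel ⦃a b : FreeAlgebra k (WGen d)⦄ (h : WRel k d a b) :
    FreeAlgebra.lift k (fourierInvGen k) a = FreeAlgebra.lift k (fourierInvGen k) b := by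
  induction h with
  | x_x i j => simpa [fourierInvGen] using gen_del_del k i j
  | del_del i j => simpa [fourierInvGen] using gen_x_x k i j
  | del_x i j =>
    have h := gen_del_x k j i
    by_cases hij : i = j
    · subst hij
      simp [fourierInvGen] at h ⊢
      rw [h]; abel
    · simp [fourierInvGen, hij, Ne.symm hij] at h ⊢
      rw [h]
  | T_central j a =>
    have h := fun a => gen_T k j a
    cases a <;> simp [fourierInvGen, h]

/-- The Fourier transform, the automorphism `𝓕` of `𝒯` with `𝓕(x_i) = ∂_i`, `𝓕(∂_i) = -x_i`
and `𝓕(T_j) = T_j`. -/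
def fourier : WeylT k d ≃ₐ[k] WeylT k d :=
  AlgEquiv.ofAlgHom (liftT k (fourierGen k) (fourierGen_rel k))
    (liftT k (fourierInvGen k) (fourierInvGen_rel k))
    (algHomT_ext k fun a => by
      cases a <;> simp [liftT_gen, fourierGen, fourierInvGen])
    (algHomT_ext k fun a => by
      cases a <;> simp [liftT_gen, fourierGen, fourierInvGen])

/-- The variables of `S` as elements of `𝒯`. -/
def varT : Fin d ⊕ Fin (d + 1) → WeylT k d :=
  Sum.elim (fun i => gen k (.x i)) (fun j => gen k (.T j))

theorem varT_comm : ∀ a ∈ Set.range (varT k (d := d)), ∀ b ∈ Set.range (varT k (d := d)),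
    a * b = b * a := by
  rintro _ ⟨i | i, rfl⟩ _ ⟨j | j, rfl⟩
  · exact gen_x_x k i j
  · exact (gen_T k j _).symm
  · exact gen_T k i _
  · exact gen_T k i _

open scoped IsMulCommutative in
/-- The inclusion `S ⊂ 𝒯`, obtained by evaluating polynomials in the commutative subalgebra
generated by the `x_i` and the `T_j`. -/
def inclST : PolyS k d →ₐ[k] WeylT k d :=
  haveI := Algebra.isMulCommutative_adjoin k (varT_comm k (d := d))
  (Algebra.adjoin k (Set.range (varT k (d := d)))).val.comp
    (aeval fun v => ⟨varT k v, Algebra.subset_adjoin (Set.mem_range_self v)⟩)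

open scoped IsMulCommutative in
theorem inclST_X (v : Fin d ⊕ Fin (d + 1)) : inclST k (X v) = varT k v := by
  have := Algebra.isMulCommutative_adjoin k (varT_comm k (d := d))
  change (Algebra.adjoin k (Set.range (varT k (d := d)))).val (aeval _ (X v)) = _
  rw [aeval_X]
  rfl

/-- `f ↦ (h ↦ 𝓕(f) • h)`, the action of `S` on `S` twisted by the Fourier transform. -/
def twistedAct : PolyS k d →ₐ[k] Module.End k (PolyS k d) :=
  (actS k).comp ((fourier k).toAlgHom.comp (inclST k))

theorem twistedAct_X_inl (i : Fin d) (h : PolyS k d) :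
    twistedAct k (X (Sum.inl i)) h = pderiv (Sum.inl i) h := by
  change actS k (liftT k (fourierGen k) (fourierGen_rel k) (inclST k (X (Sum.inl i)))) h = _
  rw [inclST_X]
  change actS k (liftT k (fourierGen k) (fourierGen_rel k) (gen k (.x i))) h = _
  rw [liftT_gen]
  change actS k (gen k (.del i)) h = _
  rw [actS, liftT_gen]
  rfl

theorem twistedAct_X_inr (j : Fin (d + 1)) (h : PolyS k d) :
    twistedAct k (X (Sum.inr j)) h = X (Sum.inr j) * h := by
  change actS k (liftT k (fourierGen k) (fourierGen_rel k) (inclST k (X (Sum.inr j)))) h = _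
  rw [inclST_X]
  change actS k (liftT k (fourierGen k) (fourierGen_rel k) (gen k (.T j))) h = _
  rw [liftT_gen]
  change actS k (gen k (.T j)) h = _
  rw [actS, liftT_gen]
  rfl

variable (d)

/-- `S_𝓕`: the abelian group `S` with the `S`-module structure `f ⋄ h = 𝓕(f) • h`. -/
def TwistS : Type u := PolyS k d

instance : AddCommGroup (TwistS k d) := inferInstanceAs (AddCommGroup (PolyS k d))

instance : Module (Module.End k (PolyS k d)) (TwistS k d) :=
  inferInstanceAs (Module (Module.End k (PolyS k d)) (PolyS k d))

instance : Module (PolyS k d) (TwistS k d) :=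
  Module.compHom (TwistS k d) (twistedAct k (d := d)).toRingHom

/-- The identity `S_𝓕 = S` of abelian groups. -/
def TwistS.toS : TwistS k d ≃+ PolyS k d := AddEquiv.refl (PolyS k d)

variable {k d} in
theorem TwistS.toS_smul (s : PolyS k d) (h : TwistS k d) :
    TwistS.toS k d (s • h) = twistedAct k s (TwistS.toS k d h) := rfl

/-- In `S_𝓕` the variable `x_i` acts as `∂_i` and lowers the `x`-degree of polynomials by one, so
the monomial `x^α T^β` has bidegree `(|β|, -|α|)` there. -/
def twistWeight : Fin d ⊕ Fin (d + 1) → ℤ × ℤ :=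
  Sum.elim (fun _ => (0, -1)) (fun _ => (1, 0))

/-- The component `(S_𝓕)_a`. -/
def gradeTwist (a : ℤ × ℤ) : AddSubgroup (TwistS k d) :=
  (weightedHomogeneousSubmodule k (twistWeight d) a).toAddSubgroup.comap
    (TwistS.toS k d).toAddMonoidHom

end Weyl

section Sol

variable {k : Type u} [Field k] {d : ℕ}

/-- `L_j = 𝓕(g_j) ∈ 𝒯`. -/
def fourierEq (g : Fin d → PolyS k d) (j : Fin d) : WeylT k d := fourier k (inclST k (g j))

/-- `Sol(L₁,…,L_d; S)_𝓕`: the polynomials `h ∈ S` with `L_j • h = 0` for all `j`, where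
`L_j = 𝓕(g_j)`, with the `S`-module structure `f ⋄ h = 𝓕(f) • h`. -/
def solF (g : Fin d → PolyS k d) : Submodule (PolyS k d) (TwistS k d) where
  carrier := {h | ∀ j, actS k (fourierEq g j) (TwistS.toS k d h) = 0}
  zero_mem' j := by rw [map_zero, map_zero]
  add_mem' {a b} ha hb j := by rw [map_add, map_add, ha j, hb j, add_zero]
  smul_mem' s h hh j := by
    have h0 : twistedAct k (g j) (TwistS.toS k d h) = 0 := hh j
    change twistedAct k (g j) (TwistS.toS k d (s • h)) = 0
    rw [TwistS.toS_smul, ← Module.End.mul_apply, ← map_mul, mul_comm, map_mul,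
      Module.End.mul_apply, h0, map_zero]

/-- The components of `Sol(L₁,…,L_d; S)_𝓕`. -/
def gradeSol (g : Fin d → PolyS k d) (a : ℤ × ℤ) : AddSubgroup (solF g) :=
  (gradeTwist k d a).comap (solF g).subtype.toAddMonoidHom

end Sol

end ReesDmod

end

noncomputable section

namespace ReesDmod

open MvPolynomial

universe u

open RingTheory.Sequence IsLocalRing
open scoped Pointwise

/-! ### Regular sequences and regular local rings -/

theorem isWeaklyRegular_self_iff {A : Type*} [CommRing A] (rs : List A) :
    IsWeaklyRegular A rs ↔ ∀ (i : ℕ) (h : i < rs.length) (a : A),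
      rs[i] * a ∈ Ideal.ofList (rs.take i) → a ∈ Ideal.ofList (rs.take i) := by
  rw [isWeaklyRegular_iff]
  refine forall_congr' fun i => forall_congr' fun h => ?_
  rw [isSMulRegular_quotient_iff_mem_of_smul_mem]
  simp only [smul_eq_mul, Ideal.mul_top]

theorem isWeaklyRegular_cons_self {A : Type*} [CommRing A] {r : A} {rs : List A}
    (hr : ∀ a, r * a = 0 → a = 0)
    (h : IsWeaklyRegular (A ⧸ Ideal.span {r}) (rs.map (Ideal.Quotient.mk (Ideal.span {r})))) :
    IsWeaklyRegular A (r :: rs) := by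
  rw [isWeaklyRegular_self_iff] at h ⊢
  have key : ∀ (l : List A) (a : A), a ∈ Ideal.ofList (r :: l) ↔
      Ideal.Quotient.mk (Ideal.span {r}) a ∈
        Ideal.ofList (l.map (Ideal.Quotient.mk (Ideal.span {r}))) := by
    intro l a
    rw [← Ideal.map_ofList, Ideal.mem_map_iff_of_surjective _ Ideal.Quotient.mk_surjective,
      Ideal.ofList_cons, Submodule.mem_sup]
    constructor
    · rintro ⟨y, hy, z, hz, rfl⟩
      exact ⟨z, hz, by rw [map_add, Ideal.Quotient.eq_zero_iff_mem.2 hy, zero_add]⟩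
    · rintro ⟨z, hz, e⟩
      exact ⟨a - z, Ideal.Quotient.eq.1 e.symm, z, hz, by ring⟩
  rintro (_ | i) hi a ha
  · simp only [List.take_zero, Ideal.ofList_nil, List.getElem_cons_zero, Submodule.mem_bot] at ha ⊢
    exact hr a ha
  · simp only [List.take_succ_cons, List.getElem_cons_succ] at ha ⊢
    rw [key, List.map_take] at ha ⊢
    refine h i (by simpa using hi) _ ?_
    simpa using ha

theorem exists_minimalPrimes_ringKrullDim_quotient_ge {A : Type*} [CommRing A] [IsNoetherianRing A]
    [IsLocalRing A] : ∃ q : Ideal A, q.IsPrime ∧ ringKrullDim A ≤ ringKrullDim (A ⧸ q) := by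
  have hfin : FiniteDimensionalOrder (PrimeSpectrum A) := inferInstanceAs (FiniteRingKrullDim A)
  let l := LTSeries.longestOf (PrimeSpectrum A)
  refine ⟨(l 0).asIdeal, (l 0).2, ?_⟩
  rw [ringKrullDim_quotient]
  have h1 : ringKrullDim A = l.length := Order.krullDim_eq_length_of_finiteDimensionalOrder
  rw [h1]
  let l' : LTSeries (PrimeSpectrum.zeroLocus ((l 0).asIdeal : Set A)) :=
    ⟨l.length, fun i => ⟨l i, by
      have : l 0 ≤ l i := l.monotone (Fin.zero_le i)
      exact this⟩, fun i => l.step i⟩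
  exact Order.LTSeries.length_le_krullDim l'

theorem domain_and_weaklyRegular_of_maximalIdeal_eq_ofList (n : ℕ) {A : Type u} [CommRing A]
    [IsNoetherianRing A] [IsLocalRing A] (xs : List A) (hlen : xs.length = n)
    (hx : maximalIdeal A = Ideal.ofList xs) (hdim : (n : WithBot ℕ∞) ≤ ringKrullDim A) :
    IsDomain A ∧ IsWeaklyRegular A xs := by
  induction n generalizing A with
  | zero =>
    obtain rfl : xs = [] := List.length_eq_zero_iff.1 hlen
    refine ⟨?_, IsWeaklyRegular.nil A A⟩
    have : IsField A := by
      rw [IsLocalRing.isField_iff_maximalIdeal_eq, hx, Ideal.ofList_nil]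
    exact this.isDomain
  | succ n ih =>
    match xs, hlen with
    | x :: xs, hlen =>
    have hlen' : xs.length = n := by simpa using hlen
    have hxm : x ∈ maximalIdeal A := by
      rw [hx, Ideal.ofList_cons]
      exact Ideal.mem_sup_left (Ideal.mem_span_singleton_self x)
    have hxt : Ideal.span {x} ≠ ⊤ := by
      intro h
      exact (maximalIdeal.isMaximal A).ne_top
        (top_le_iff.1 (h ▸ (Ideal.span_singleton_le_iff_mem _).2 hxm))
    have : Nontrivial (A ⧸ Ideal.span {x}) := Ideal.Quotient.nontrivial_iff.2 hxt
    have hloc : IsLocalRing (A ⧸ Ideal.span {x}) :=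
      IsLocalRing.of_surjective' _ Ideal.Quotient.mk_surjective
    have hstep : ∀ (B : Type u) [CommRing B] [IsNoetherianRing B] [IsLocalRing B] (y : B),
        y ∈ maximalIdeal B → ringKrullDim B ≤ ringKrullDim (B ⧸ Ideal.span {y}) + 1 := by
      intro B _ _ _ y hy
      have := ringKrullDim_le_ringKrullDim_quotSMulTop_succ hy
      have e : y • (⊤ : Ideal B) = Ideal.span {y} := by
        rw [← Submodule.ideal_span_singleton_smul, smul_eq_mul, Ideal.mul_top]
      rwa [e] at this
    have hmax : maximalIdeal (A ⧸ Ideal.span {x}) =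
        Ideal.ofList (xs.map (Ideal.Quotient.mk (Ideal.span {x}))) := by
      have h1 : (maximalIdeal A).map (Ideal.Quotient.mk (Ideal.span {x})) =
          maximalIdeal (A ⧸ Ideal.span {x}) := by
        refine IsLocalRing.eq_maximalIdeal ?_
        refine (Ideal.map_eq_top_or_isMaximal_of_surjective _ Ideal.Quotient.mk_surjective
          (maximalIdeal.isMaximal A)).resolve_left fun h => ?_
        have := congrArg (Ideal.comap (Ideal.Quotient.mk (Ideal.span {x}))) h
        rw [Ideal.comap_map_of_surjective _ Ideal.Quotient.mk_surjective, Ideal.comap_top,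
          ← RingHom.ker_eq_comap_bot, Ideal.mk_ker,
          sup_eq_left.2 ((Ideal.span_singleton_le_iff_mem _).2 hxm)] at this
        exact (maximalIdeal.isMaximal A).ne_top this
      rw [← h1, hx, Ideal.map_ofList]
      simp [Ideal.Quotient.eq_zero_iff_mem.2 (Ideal.mem_span_singleton_self x)]
    have hdim' : (n : WithBot ℕ∞) ≤ ringKrullDim (A ⧸ Ideal.span {x}) := by
      have := hdim.trans (hstep A x hxm)
      rw [Nat.cast_succ] at this
      exact (ENat.WithBot.add_le_add_one_right_iff).1 this
    obtain ⟨hdom, hreg⟩ := ih _ (by simpa using hlen') hmax hdim'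
    have hdimle : ringKrullDim (A ⧸ Ideal.span {x}) ≤ n := by
      refine (ringKrullDim_le_spanFinrank_maximalIdeal _).trans ?_
      rw [hmax]
      have := Submodule.spanFinrank_span_le_ncard_of_finite (R := A ⧸ Ideal.span {x})
        (s := {a | a ∈ xs.map (Ideal.Quotient.mk (Ideal.span {x}))}) (List.finite_toSet _)
      refine (Nat.cast_le.2 (this.trans ?_))
      rw [Set.ncard_eq_toFinset_card _ (List.finite_toSet _)]
      classical
      have e : (List.finite_toSet (xs.map (Ideal.Quotient.mk (Ideal.span {x})))).toFinset =
          (xs.map (Ideal.Quotient.mk (Ideal.span {x}))).toFinset := by ext; simp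
      rw [e]
      exact (List.toFinset_card_le _).trans (by simp [hlen'])
    obtain ⟨q, hq, hqdim⟩ := exists_minimalPrimes_ringKrullDim_quotient_ge (A := A)
    have hnot : ¬ ((n : WithBot ℕ∞) + 1 ≤ n) := by
      intro h
      have : ((n + 1 : ℕ) : WithBot ℕ∞) ≤ (n : ℕ) := by exact_mod_cast h
      have := Nat.cast_le.1 this
      omega
    have hxq : x ∉ q := by
      intro hxq
      have h1 : ringKrullDim (A ⧸ q) ≤ ringKrullDim (A ⧸ Ideal.span {x}) :=
        ringKrullDim_le_of_surjective
          (Ideal.Quotient.factor ((Ideal.span_singleton_le_iff_mem _).2 hxq))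
          (Ideal.Quotient.factor_surjective _)
      have := (hdim.trans hqdim).trans (h1.trans hdimle)
      rw [Nat.cast_succ] at this
      exact hnot this
    have hqm : q ≤ maximalIdeal A := IsLocalRing.le_maximalIdeal hq.ne_top
    have hqx : q ≤ Ideal.span {x} := by
      intro a ha
      by_contra hax
      have hloc' : IsLocalRing (A ⧸ q) :=
        IsLocalRing.of_surjective' _ Ideal.Quotient.mk_surjective
      have hxm' : Ideal.Quotient.mk q x ∈ maximalIdeal (A ⧸ q) := by
        rw [IsLocalRing.mem_maximalIdeal, mem_nonunits_iff]
        rintro ⟨w, hw⟩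
        obtain ⟨b, hb⟩ := Ideal.Quotient.mk_surjective (I := q) (↑w⁻¹ : A ⧸ q)
        have h1 : Ideal.Quotient.mk q (x * b) = 1 := by rw [map_mul, hb, ← hw, Units.mul_inv]
        have h2 : x * b - 1 ∈ q := Ideal.Quotient.eq.1 (h1.trans (map_one _).symm)
        have h3 := (maximalIdeal A).sub_mem ((maximalIdeal A).mul_mem_right b hxm) (hqm h2)
        rw [sub_sub_cancel] at h3
        exact (maximalIdeal.isMaximal A).ne_top ((Ideal.eq_top_iff_one _).2 h3)
      have h1 := hdim.trans (hqdim.trans (hstep (A ⧸ q) _ hxm'))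
      rw [Nat.cast_succ] at h1
      have h1 := (ENat.WithBot.add_le_add_one_right_iff).1 h1
      have h2 : ringKrullDim ((A ⧸ q) ⧸ Ideal.span {Ideal.Quotient.mk q x}) ≤
          ringKrullDim ((A ⧸ Ideal.span {x}) ⧸
            Ideal.span {Ideal.Quotient.mk (Ideal.span {x}) a}) := by
        let F : ((A ⧸ Ideal.span {x}) ⧸ Ideal.span {Ideal.Quotient.mk (Ideal.span {x}) a}) →+*
            ((A ⧸ q) ⧸ Ideal.span {Ideal.Quotient.mk q x}) :=
          Ideal.Quotient.lift _ (Ideal.Quotient.lift (Ideal.span {x})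
            ((Ideal.Quotient.mk _).comp (Ideal.Quotient.mk q)) (by
              intro b hb
              obtain ⟨c, rfl⟩ := Ideal.mem_span_singleton'.1 hb
              rw [RingHom.comp_apply, Ideal.Quotient.eq_zero_iff_mem, map_mul]
              exact Ideal.mul_mem_left _ _ (Ideal.mem_span_singleton_self _))) (by
            intro b hb
            obtain ⟨c, rfl⟩ := Ideal.mem_span_singleton'.1 hb
            rw [map_mul, Ideal.Quotient.lift_mk, RingHom.comp_apply,
              Ideal.Quotient.eq_zero_iff_mem.2 ha, map_zero, mul_zero])
        refine ringKrullDim_le_of_surjective F ?_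
        refine Ideal.Quotient.lift_surjective_of_surjective _ _ ?_
        refine Ideal.Quotient.lift_surjective_of_surjective _ _ ?_
        exact Ideal.Quotient.mk_surjective.comp Ideal.Quotient.mk_surjective
      have h3 := ringKrullDim_quotient_succ_le_of_nonZeroDivisor
        (r := Ideal.Quotient.mk (Ideal.span {x}) a)
        (mem_nonZeroDivisors_of_ne_zero fun h => hax (Ideal.Quotient.eq_zero_iff_mem.1 h))
      refine hnot (le_trans ?_ (h3.trans hdimle))
      exact add_le_add_left (h1.trans h2) 1
    have hq0 : q = ⊥ := by
      refine Submodule.eq_bot_of_le_smul_of_le_jacobson_bot (Ideal.span {x}) q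
        (IsNoetherian.noetherian q) ?_ ?_
      · intro a ha
        obtain ⟨b, rfl⟩ := Ideal.mem_span_singleton'.1 (hqx ha)
        rw [mul_comm, smul_eq_mul]
        refine Ideal.mul_mem_mul (Ideal.mem_span_singleton_self x) ?_
        exact (hq.mem_or_mem ha).resolve_right hxq
      · rw [IsLocalRing.jacobson_eq_maximalIdeal _ bot_ne_top]
        exact (Ideal.span_singleton_le_iff_mem _).2 hxm
    have hdomA : IsDomain A := by
      rw [hq0] at hq
      exact IsDomain.of_bot_isPrime A
    refine ⟨hdomA, isWeaklyRegular_cons_self (fun a ha => ?_) hreg⟩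
    refine (mul_eq_zero.1 ha).resolve_left fun h => hxq ?_
    rw [h]
    exact q.zero_mem

theorem exists_isWeaklyRegular_of_isRegularLocalRing {A : Type u} [CommRing A]
    [IsRegularLocalRing A] : ∃ ys : List A, (∀ y ∈ ys, y ∈ maximalIdeal A) ∧
      (ys.length : WithBot ℕ∞) = ringKrullDim A ∧ IsWeaklyRegular A ys := by
  have hfg : (maximalIdeal A).FG := IsNoetherian.noetherian _
  have hfin := Submodule.FG.finite_generators hfg
  let ys := hfin.toFinset.toList
  have hmem : ∀ y, y ∈ ys ↔ y ∈ (maximalIdeal A).generators := by intro y; simp [ys]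
  have hlen : (ys.length : WithBot ℕ∞) = ringKrullDim A := by
    rw [← (isRegularLocalRing_iff A).1 inferInstance, ← Submodule.FG.generators_ncard hfg,
      Set.ncard_eq_toFinset_card _ hfin, Finset.length_toList]
  have hspan : maximalIdeal A = Ideal.ofList ys := by
    conv_lhs => rw [← Submodule.span_generators (maximalIdeal A)]
    exact congrArg Ideal.span (Set.ext fun y => (hmem y).symm)
  refine ⟨ys, fun y hy => ?_, hlen,
    (domain_and_weaklyRegular_of_maximalIdeal_eq_ofList _ ys rfl hspan hlen.le).2⟩
  rw [hspan]
  exact Ideal.subset_span hy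

open RingTheory.Sequence IsLocalRing

/-! ### Regular sequences in polynomial rings -/

theorem isWeaklyRegular_concat_iff {A : Type*} [CommRing A] (rs : List A) (r : A) :
    IsWeaklyRegular A (rs ++ [r]) ↔ IsWeaklyRegular A rs ∧
      ∀ a, r * a ∈ Ideal.ofList rs → a ∈ Ideal.ofList rs := by
  rw [isWeaklyRegular_append_iff, isWeaklyRegular_singleton_iff,
    isSMulRegular_quotient_iff_mem_of_smul_mem]
  simp only [smul_eq_mul, Ideal.mul_top]

theorem ker_map_comp_aeval_ite {A σ : Type*} [CommRing A] [DecidableEq σ] (ys : List A)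
    (is : List σ) (F : MvPolynomial σ A)
    (hF : MvPolynomial.map (Ideal.Quotient.mk (Ideal.ofList ys))
      (aeval (fun j => if j ∈ is then (0 : MvPolynomial σ A) else X j) F) = 0) :
    F ∈ Ideal.ofList (ys.map C ++ is.map (X : σ → MvPolynomial σ A)) := by
  set ε : MvPolynomial σ A →ₐ[A] MvPolynomial σ A :=
    aeval (fun j => if j ∈ is then (0 : MvPolynomial σ A) else X j)
  rw [Ideal.ofList_append]
  have h1 : F - ε F ∈ Ideal.ofList (is.map (X : σ → MvPolynomial σ A)) := by
    rw [← Ideal.Quotient.eq]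
    have : (Ideal.Quotient.mkₐ A (Ideal.ofList (is.map (X : σ → MvPolynomial σ A)))) =
        (Ideal.Quotient.mkₐ A (Ideal.ofList (is.map (X : σ → MvPolynomial σ A)))).comp ε := by
      refine MvPolynomial.algHom_ext fun j => ?_
      rw [AlgHom.comp_apply, aeval_X]
      split_ifs with hj
      · rw [map_zero]
        exact Ideal.Quotient.eq_zero_iff_mem.2 (Ideal.subset_span (List.mem_map_of_mem hj))
      · rfl
    exact congrArg (fun f : MvPolynomial σ A →ₐ[A] _ => f F) this
  have h2 : ε F ∈ Ideal.ofList (ys.map (C : A → MvPolynomial σ A)) := by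
    rw [← Ideal.map_ofList, MvPolynomial.mem_map_C_iff]
    intro m
    rw [← Ideal.Quotient.eq_zero_iff_mem, ← coeff_map, hF, coeff_zero]
  have := Ideal.add_mem _ (Ideal.mem_sup_left h2) (Ideal.mem_sup_right h1)
  rwa [add_sub_cancel] at this

theorem isWeaklyRegular_map_C_append_map_X {A σ : Type*} [CommRing A] {ys : List A}
    (hys : IsWeaklyRegular A ys) (is : List σ) (his : is.Nodup) :
    IsWeaklyRegular (MvPolynomial σ A) (ys.map C ++ is.map X) := by
  classical
  induction is using List.reverseRecOn with
  | nil =>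
    simpa using IsWeaklyRegular.of_flat (S := MvPolynomial σ A) hys
  | append_singleton is i ih =>
    rw [List.nodup_append] at his
    rw [List.map_append, ← List.append_assoc, List.map_singleton, isWeaklyRegular_concat_iff]
    refine ⟨ih his.1, fun F hF => ker_map_comp_aeval_ite _ _ _ ?_⟩
    have hi : i ∉ is := fun h => his.2.2 i h i (by simp) rfl
    let Φ : MvPolynomial σ A →+* MvPolynomial σ (A ⧸ Ideal.ofList ys) :=
      (MvPolynomial.map (Ideal.Quotient.mk (Ideal.ofList ys))).comp
      (aeval (fun j => if j ∈ is then (0 : MvPolynomial σ A) else X j) :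
        MvPolynomial σ A →ₐ[A] MvPolynomial σ A).toRingHom
    have hker : Ideal.ofList (ys.map C ++ is.map (X : σ → MvPolynomial σ A)) ≤
        RingHom.ker Φ := by
      refine Ideal.span_le.2 ?_
      intro a ha
      have ha : a ∈ ys.map (C : A → MvPolynomial σ A) ++ is.map X := ha
      rcases List.mem_append.1 ha with ha | ha
      · obtain ⟨y, hy, rfl⟩ := List.mem_map.1 ha
        change MvPolynomial.map _ (aeval _ (C y)) = 0
        have hy' : y ∈ Ideal.ofList ys := Ideal.subset_span hy
        rw [aeval_C, algebraMap_eq, map_C, Ideal.Quotient.eq_zero_iff_mem.2 hy', C_0]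
      · obtain ⟨j, hj, rfl⟩ := List.mem_map.1 ha
        change MvPolynomial.map _ (aeval _ (X j)) = 0
        rw [aeval_X, if_pos hj, map_zero]
    have h1 : Φ (X i * F) = 0 := hker hF
    have h2 : Φ (X i) = X i := by
      change MvPolynomial.map _ (aeval _ (X i)) = _
      rw [aeval_X, if_neg hi, map_X]
    rw [map_mul, h2] at h1
    have h3 : X i * Φ F = X i * 0 := by rw [h1, mul_zero]
    exact MvPolynomial.X_mul_cancel_left_iff.1 h3

/-! ### Vanishing of homomorphisms into quotients by regular sequences -/

theorem subsingleton_ext_quotSMulTop {B : Type u} [CommRing B] (N M : ModuleCat.{u} B) (n : ℕ)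
    (h : ∀ i < n + 1, Subsingleton (CategoryTheory.Abelian.Ext N M i)) {x : B}
    (hx : IsSMulRegular M x) :
    ∀ i < n, Subsingleton (CategoryTheory.Abelian.Ext N (ModuleCat.of B (QuotSMulTop x M)) i) := by
  intro i hi
  have zero1 := AddCommGrpCat.isZero_of_iff_subsingleton.mpr (h i (by omega))
  have zero2 := AddCommGrpCat.isZero_of_iff_subsingleton.mpr (h (i + 1) (by omega))
  exact AddCommGrpCat.subsingleton_of_isZero <|
    CategoryTheory.ShortComplex.Exact.isZero_of_both_zeros
      ((CategoryTheory.Abelian.Ext.covariant_sequence_exact₃' N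
        hx.smulShortComplex_shortExact) i (i + 1) rfl)
      (zero1.eq_zero_of_src _) (zero2.eq_zero_of_tgt _)

theorem subsingleton_linearMap_quotient_of_ext {B : Type u} [CommRing B] (N : ModuleCat.{u} B)
    (rs : List B) (M : ModuleCat.{u} B) (hrs : IsWeaklyRegular M rs)
    (h : ∀ i < rs.length + 1, Subsingleton (CategoryTheory.Abelian.Ext N M i)) :
    Subsingleton (N →ₗ[B] M ⧸ (Ideal.ofList rs • ⊤ : Submodule B M)) := by
  induction rs generalizing M with
  | nil =>
    have h0 := h 0 (by simp)
    have : Subsingleton (N →ₗ[B] M) :=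
      (CategoryTheory.Abelian.Ext.addEquiv₀.trans ModuleCat.homAddEquiv).symm.subsingleton
    have e : (M ⧸ (Ideal.ofList ([] : List B) • ⊤ : Submodule B M)) ≃ₗ[B] M :=
      Submodule.quotEquivOfEqBot _ (by simp)
    exact (LinearEquiv.congrRight e).toEquiv.subsingleton
  | cons r rs ih =>
    rw [isWeaklyRegular_cons_iff] at hrs
    have := ih (ModuleCat.of B (QuotSMulTop r M)) hrs.2
      (subsingleton_ext_quotSMulTop N M _ h hrs.1)
    exact (LinearEquiv.congrRight
      (Submodule.quotOfListConsSMulTopEquivQuotSMulTopInner M r rs)).toEquiv.subsingleton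

/-- If `J` contains a regular sequence longer than the weakly regular sequence `rs`, then no
element outside `(rs)` is multiplied into `(rs)` by `J`. -/
theorem mem_ofList_of_mul_mem {B : Type u} [CommRing B] [IsNoetherianRing B] {rs ls : List B}
    (hrs : IsWeaklyRegular B rs) (hls : IsWeaklyRegular B ls) (hlen : rs.length < ls.length)
    {J : Ideal B} (hJ : ∀ l ∈ ls, l ∈ J) {s : B}
    (hs : ∀ b ∈ J, b * s ∈ Ideal.ofList rs) : s ∈ Ideal.ofList rs := by
  by_cases hJt : J = ⊤
  · simpa using hs 1 (hJt ▸ Submodule.mem_top)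
  have hlt : J • (⊤ : Submodule B B) < ⊤ := by
    rw [smul_eq_mul, Ideal.mul_top]
    exact lt_top_iff_ne_top.2 hJt
  have hreg : IsRegular B ls := ⟨hls, fun h => by
    rw [smul_eq_mul, Ideal.mul_top] at h
    refine hJt (top_le_iff.1 (h.trans_le ?_))
    exact Ideal.span_le.2 hJ⟩
  have hext := ModuleCat.subsingleton_ext_of_exists_isRegular J (ModuleCat.of B (B ⧸ J))
    (by rw [Module.support_eq_zeroLocus, Ideal.annihilator_quotient]) (ModuleCat.of B B) hlt ls hJ
    hreg
  have hsub := subsingleton_linearMap_quotient_of_ext (ModuleCat.of B (B ⧸ J)) rs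
    (ModuleCat.of B B) hrs (fun i hi => hext i (by omega))
  let F : (B ⧸ J) →ₗ[B] (B ⧸ (Ideal.ofList rs • ⊤ : Submodule B B)) :=
    Submodule.liftQ J (LinearMap.toSpanSingleton B _
      (Submodule.Quotient.mk s : B ⧸ (Ideal.ofList rs • ⊤ : Submodule B B))) (by
      intro b hb
      rw [LinearMap.mem_ker, LinearMap.toSpanSingleton_apply, ← Submodule.Quotient.mk_smul,
        Submodule.Quotient.mk_eq_zero, smul_eq_mul, smul_eq_mul, Ideal.mul_top]
      exact hs b hb)
  have hF : F = 0 := hsub.elim _ _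
  have h1 : F (Submodule.Quotient.mk 1) = 0 := by rw [hF]; rfl
  have h1 : LinearMap.toSpanSingleton B _
      (Submodule.Quotient.mk s : B ⧸ (Ideal.ofList rs • ⊤ : Submodule B B)) 1 = 0 := h1
  rwa [LinearMap.toSpanSingleton_apply, one_smul, Submodule.Quotient.mk_eq_zero, smul_eq_mul,
    Ideal.mul_top] at h1

/-! ### Linear forms -/

/-- The linear substitution `T_i ↦ ∑ k, N k i * T_k`. -/
def linSubst {A σ : Type*} [CommRing A] [Fintype σ] (N : Matrix σ σ A) :
    MvPolynomial σ A →ₐ[A] MvPolynomial σ A :=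
  aeval fun i => ∑ k, C (N k i) * X k

theorem linSubst_comp {A σ : Type*} [CommRing A] [Fintype σ] (M N : Matrix σ σ A) :
    (linSubst M).comp (linSubst N) = linSubst (M * N) := by
  refine MvPolynomial.algHom_ext fun i => ?_
  simp only [linSubst, AlgHom.comp_apply, aeval_X, map_sum, map_mul, Matrix.mul_apply,
    MvPolynomial.algHom_C, algebraMap_eq, Finset.mul_sum, Finset.sum_mul]
  rw [Finset.sum_comm]
  refine Finset.sum_congr rfl fun k _ => Finset.sum_congr rfl fun l _ => ?_
  ring

theorem linSubst_one {A σ : Type*} [CommRing A] [Fintype σ] [DecidableEq σ] :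
    linSubst (1 : Matrix σ σ A) = AlgHom.id A _ := by
  refine MvPolynomial.algHom_ext fun i => ?_
  rw [linSubst, aeval_X, Finset.sum_eq_single i]
  · simp
  · intro k _ hk
    simp [Matrix.one_apply_ne hk]
  · simp

/-- The linear substitution by an invertible matrix. -/
def linSubstEquiv {A σ : Type*} [CommRing A] [Fintype σ] [DecidableEq σ] (N : Matrix σ σ A)
    (hN : IsUnit N.det) : MvPolynomial σ A ≃ₐ[A] MvPolynomial σ A :=
  AlgEquiv.ofAlgHom (linSubst N) (linSubst N⁻¹)
    (by rw [linSubst_comp, Matrix.mul_nonsing_inv N hN, linSubst_one])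
    (by rw [linSubst_comp, Matrix.nonsing_inv_mul N hN, linSubst_one])

theorem isWeaklyRegular_map_ringEquiv {A B : Type*} [CommRing A] [CommRing B] (e : A ≃+* B)
    {rs : List A} (h : IsWeaklyRegular A rs) : IsWeaklyRegular B (rs.map e) := by
  refine (AddEquiv.isWeaklyRegular_congr (e := e.toAddEquiv) ?_).1 h
  rw [List.forall₂_map_right_iff, List.forall₂_same]
  intro r _ x
  exact map_mul e r x

/-- Linear forms whose coefficient vectors are linearly independent modulo the maximal ideal
extend a regular sequence of the local base ring. -/
theorem isWeaklyRegular_map_C_append_linear {A : Type*} [CommRing A] [IsLocalRing A] {n r : ℕ}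
    {ys : List A} (hys : IsWeaklyRegular A ys) (φ : Matrix (Fin n) (Fin r) A)
    (hφ : LinearIndependent (ResidueField A) (fun c : Fin r => fun i => residue A (φ i c))) :
    IsWeaklyRegular (MvPolynomial (Fin n) A)
      (ys.map C ++ (List.finRange r).map fun c => ∑ i, C (φ i c) * X i) := by
  let b := Module.Basis.sumExtend hφ
  have hbinl : ∀ c, b (Sum.inl c) = fun i => residue A (φ i c) := fun c => by
    simp only [b, Module.Basis.sumExtend, Module.Basis.reindex_apply, Module.Basis.coe_extend]
    rfl
  have hfin : Finite (Fin r ⊕ _) := Module.Finite.finite_basis b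
  have := Fintype.ofFinite (Fin r ⊕ (Module.Basis.sumExtendIndex hφ))
  have hcard : Fintype.card (Fin r ⊕ (Module.Basis.sumExtendIndex hφ)) = n := by
    rw [← Module.finrank_eq_card_basis b, Module.finrank_fin_fun]
  let E : (Fin r ⊕ (Module.Basis.sumExtendIndex hφ)) ≃ Fin n := Fintype.equivFinOfCardEq hcard
  choose lift hlift using residue_surjective (R := A)
  let N : Matrix (Fin n) (Fin n) A := fun k i =>
    match E.symm i with
    | Sum.inl c => φ k c
    | Sum.inr j => lift (b (Sum.inr j) k)
  have hNres : N.map (residue A) = (Pi.basisFun (ResidueField A) (Fin n)).toMatrix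
      (b.reindex E) := by
    ext k i
    rw [Module.Basis.toMatrix_apply, Pi.basisFun_repr, Module.Basis.reindex_apply, Matrix.map_apply]
    simp only [N]
    rcases hi : E.symm i with c | j
    · rw [hbinl]
    · simp only [hlift]
  have hN : IsUnit N.det := by
    have h1 : residue A N.det ≠ 0 := by
      rw [RingHom.map_det, RingHom.mapMatrix_apply, hNres]
      have := Module.Basis.invertibleToMatrix (Pi.basisFun (ResidueField A) (Fin n))
        (b.reindex E)
      exact (Matrix.isUnit_det_of_invertible _).ne_zero
    exact (residue_ne_zero_iff_isUnit _).1 h1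
  have hreg := isWeaklyRegular_map_ringEquiv (linSubstEquiv N hN).toRingEquiv
    (isWeaklyRegular_map_C_append_map_X hys ((List.finRange r).map fun c => E (Sum.inl c)) (by
      refine List.Nodup.map ?_ (List.nodup_finRange r)
      exact E.injective.comp Sum.inl_injective))
  have h1 : (ys.map (C : A → MvPolynomial (Fin n) A)).map (linSubstEquiv N hN).toRingEquiv =
      ys.map C := by
    rw [List.map_map]
    refine List.map_congr_left fun y _ => ?_
    exact (linSubstEquiv N hN).commutes y
  have h2 : (((List.finRange r).map fun c => E (Sum.inl c)).map
      (X : Fin n → MvPolynomial (Fin n) A)).map (linSubstEquiv N hN).toRingEquiv =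
      (List.finRange r).map (fun c => ∑ i, C (φ i c) * X i) := by
    rw [List.map_map, List.map_map]
    refine List.map_congr_left fun c _ => ?_
    change linSubst N (X (E (Sum.inl c))) = _
    rw [linSubst, aeval_X]
    simp only [N, Equiv.symm_apply_apply]
  rwa [List.map_append, h1, h2] at hreg

open RingTheory.Sequence IsLocalRing

/-! ### Linear forms over regular rings -/

theorem exists_prime_forall_mem_iff {A : Type*} [CommRing A] [IsNoetherianRing A] (Q : Ideal A)
    {s : A} (hs : s ∉ Q) : ∃ (P : Ideal A) (c : A), P.IsPrime ∧ ∀ a, a ∈ P ↔ a * (c * s) ∈ Q := by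
  let M := Submodule.span A {(Ideal.Quotient.mk Q s)}
  have hM : (⟨Ideal.Quotient.mk Q s, Submodule.mem_span_singleton_self _⟩ : M) ≠ 0 := by
    intro h
    exact hs (Ideal.Quotient.eq_zero_iff_mem.1 (congrArg Subtype.val h))
  have : Nontrivial M := ⟨_, _, hM⟩
  obtain ⟨P, hP⟩ := associatedPrimes.nonempty A M
  obtain ⟨hP, ⟨m, hm⟩, hPm⟩ := isAssociatedPrime_iff.1 hP
  obtain ⟨c, hc⟩ := Submodule.mem_span_singleton.1 hm
  refine ⟨P, c, hP, fun a => ?_⟩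
  rw [hPm, Submodule.mem_colon_singleton, Submodule.mem_bot, ← Ideal.Quotient.eq_zero_iff_mem]
  subst hc
  rw [← Subtype.val_inj]
  change a • (c • Ideal.Quotient.mk Q s) = 0 ↔ _
  rw [map_mul, map_mul]
  rfl

/-- `∑ i, φ i j * T_i` as a polynomial in the `T_i` over `R`. -/
def linForm {R : Type*} [CommRing R] {n e : ℕ} (φ : Matrix (Fin n) (Fin e) R) (j : Fin e) :
    MvPolynomial (Fin n) R := ∑ i, C (φ i j) * X i

attribute [local instance] MvPolynomial.algebraMvPolynomial in
theorem card_add_height_le_length {R : Type u} [CommRing R] [IsRegularRing R] {n e : ℕ}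
    (φ : Matrix (Fin n) (Fin e) R) {rs : List (MvPolynomial (Fin n) R)}
    (hrs : IsWeaklyRegular (MvPolynomial (Fin n) R) rs)
    (P : Ideal (MvPolynomial (Fin n) R)) [P.IsPrime] (s : MvPolynomial (Fin n) R)
    (hs : ∀ a, a ∈ P ↔ a * s ∈ Ideal.ofList rs) (p : Ideal R) [p.IsPrime] (hp : p = P.comap C)
    {r : ℕ} (cs : Fin r → Fin e) (hcs : ∀ c, linForm φ (cs c) ∈ P)
    (hind : LinearIndependent p.ResidueField
      (fun c : Fin r => fun i => algebraMap R p.ResidueField (φ i (cs c)))) :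
    (r : ℕ∞) + p.height ≤ rs.length := by
  by_contra hlt
  let A := Localization.AtPrime p
  obtain ⟨ys, hym, hylen, hyreg⟩ := exists_isWeaklyRegular_of_isRegularLocalRing (A := A)
  rw [IsLocalization.AtPrime.ringKrullDim_eq_height p A] at hylen
  have hylen : (ys.length : ℕ∞) = p.height := by exact_mod_cast hylen
  have hlen : rs.length < ys.length + r := by
    rw [← hylen] at hlt
    have : ¬ (r + ys.length ≤ rs.length) := fun h => hlt (by exact_mod_cast h)
    omega
  have hloc : IsLocalization (Submonoid.map C p.primeCompl) (MvPolynomial (Fin n) A) :=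
    MvPolynomial.isLocalization p.primeCompl A
  have hrsB := IsWeaklyRegular.of_isLocalization (MvPolynomial (Fin n) A)
    (Submonoid.map C p.primeCompl) hrs
  have hls := isWeaklyRegular_map_C_append_linear hyreg
    (fun i (c : Fin r) => algebraMap R A (φ i (cs c))) hind
  have halg : ∀ a : MvPolynomial (Fin n) R, algebraMap (MvPolynomial (Fin n) R)
      (MvPolynomial (Fin n) A) a = MvPolynomial.map (algebraMap R A) a := fun a => rfl
  have hmem := mem_ofList_of_mul_mem hrsB hls (by simpa using hlen)
    (J := P.map (algebraMap _ (MvPolynomial (Fin n) A)))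
    (s := algebraMap _ (MvPolynomial (Fin n) A) s) ?_ ?_
  · rw [← Ideal.map_ofList,
      IsLocalization.algebraMap_mem_map_algebraMap_iff (Submonoid.map C p.primeCompl)] at hmem
    obtain ⟨m, ⟨u, hu, rfl⟩, hm⟩ := hmem
    have h1 : C u ∈ P := (hs _).2 hm
    refine hu ?_
    rw [hp]
    exact h1
  · intro l hl
    rcases List.mem_append.1 hl with hl | hl
    · obtain ⟨y, hy, rfl⟩ := List.mem_map.1 hl
      have h1 := hym y hy
      rw [← Localization.AtPrime.map_eq_maximalIdeal] at h1
      have h2 : C y ∈ (p.map (algebraMap R A)).map (C : A →+* MvPolynomial (Fin n) A) :=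
        Ideal.mem_map_of_mem _ h1
      rw [Ideal.map_map] at h2
      refine (Ideal.map_le_iff_le_comap.2 ?_ : _ ≤ _) h2
      intro a ha
      rw [hp] at ha
      have := Ideal.mem_map_of_mem (algebraMap _ (MvPolynomial (Fin n) A)) (Ideal.mem_comap.1 ha)
      rwa [halg, map_C] at this
    · obtain ⟨c, -, rfl⟩ := List.mem_map.1 hl
      have := Ideal.mem_map_of_mem (algebraMap _ (MvPolynomial (Fin n) A)) (hcs c)
      rw [halg, linForm, map_sum] at this
      simpa only [map_mul, map_C, map_X] using this
  · intro b hb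
    rw [← Ideal.map_ofList]
    have : P.map (algebraMap _ (MvPolynomial (Fin n) A)) ≤
        ((Ideal.ofList rs).map (algebraMap _ (MvPolynomial (Fin n) A))).colon
          {algebraMap _ (MvPolynomial (Fin n) A) s} := by
      rw [Ideal.map_le_iff_le_comap]
      intro a ha
      rw [Ideal.mem_comap, Submodule.mem_colon_singleton, smul_eq_mul, ← map_mul]
      exact Ideal.mem_map_of_mem _ ((hs a).1 ha)
    exact Submodule.mem_colon_singleton.1 (this hb)

/-- The rank of `φ` modulo the prime `p`. -/
def rankAt {R : Type*} [CommRing R] {n e : ℕ} (φ : Matrix (Fin n) (Fin e) R) (p : Ideal R)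
    [p.IsPrime] : ℕ := (φ.map (algebraMap R p.ResidueField)).rank

theorem exists_linearIndependent_columns {K : Type*} [Field K] {n e : ℕ}
    (φ : Matrix (Fin n) (Fin e) K) : ∃ cs : Finset (Fin e), cs.card = φ.rank ∧
      LinearIndependent K (fun c : cs => φ.col c) := by
  obtain ⟨b, hb, hspan, hind⟩ := exists_linearIndependent K (Set.range φ.col)
  have hfin : b.Finite := (Set.finite_range _).subset hb
  choose pre hpre using fun x : b => hb x.2
  classical
  have := hfin.fintype
  have hinj : Function.Injective pre := fun x y h => by
    have := congrArg φ.col h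
    rw [hpre, hpre] at this
    exact Subtype.ext this
  refine ⟨Finset.univ.image pre, ?_, ?_⟩
  · rw [Finset.card_image_of_injective _ hinj, Finset.card_univ, Matrix.rank_eq_finrank_span_cols,
      ← hspan, finrank_span_set_eq_card hind, Set.toFinset_card]
  · have h1 : ∀ c : (Finset.univ.image pre : Finset (Fin e)), φ.col c ∈ b := by
      rintro ⟨c, hc⟩
      obtain ⟨x, -, rfl⟩ := Finset.mem_image.1 hc
      rw [hpre]
      exact x.2
    refine hind.comp (fun c : (Finset.univ.image pre : Finset (Fin e)) => ⟨φ.col c, h1 c⟩) ?_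
    rintro ⟨c, hc⟩ ⟨c', hc'⟩ h
    obtain ⟨x, -, rfl⟩ := Finset.mem_image.1 hc
    obtain ⟨x', -, rfl⟩ := Finset.mem_image.1 hc'
    simp only [Subtype.mk.injEq, hpre] at h
    exact Subtype.ext (congrArg pre (Subtype.ext h))

theorem card_filter_add_height_le_length {R : Type u} [CommRing R] [IsRegularRing R] {n e : ℕ}
    (φ : Matrix (Fin n) (Fin e) R) {rs : List (MvPolynomial (Fin n) R)}
    (hrs : IsWeaklyRegular (MvPolynomial (Fin n) R) rs)
    (P : Ideal (MvPolynomial (Fin n) R)) [P.IsPrime] (s : MvPolynomial (Fin n) R)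
    (hs : ∀ a, a ∈ P ↔ a * s ∈ Ideal.ofList rs) (p : Ideal R) [p.IsPrime] (hp : p = P.comap C)
    (m : ℕ) (hm : ∀ c : Fin e, (c : ℕ) < m → linForm φ c ∈ P) :
    (rankAt φ p : ℕ∞) + p.height ≤ rs.length + (e - m : ℕ) := by
  classical
  obtain ⟨cs, hcard, hind⟩ := exists_linearIndependent_columns (φ.map (algebraMap R p.ResidueField))
  let cs' : Finset (Fin e) := cs.filter fun c : Fin e => (c : ℕ) < m
  have h1 : cs.card ≤ cs'.card + (e - m) := by
    rw [← Finset.card_filter_add_card_filter_not (s := cs) (fun c : Fin e => (c : ℕ) < m)]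
    refine add_le_add le_rfl ?_
    refine (Finset.card_le_card (t := Finset.univ.filter fun c : Fin e => ¬ (c : ℕ) < m)
      (Finset.filter_subset_filter _ (Finset.subset_univ _))).trans ?_
    have h2 := Finset.card_filter_add_card_filter_not (s := Finset.univ)
      (fun c : Fin e => (c : ℕ) < m)
    rw [Finset.card_univ, Fintype.card_fin, Fin.card_filter_val_lt] at h2
    omega
  let E := cs'.equivFin
  have h2 := card_add_height_le_length φ hrs P s hs p hp (fun c => (E.symm c).1)
    (fun c => hm _ (Finset.mem_filter.1 (E.symm c).2).2) (by
      refine hind.comp (fun c => ⟨(E.symm c).1,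
        (Finset.mem_filter.1 (E.symm c).2).1⟩) ?_
      intro c c' h
      exact E.symm.injective (Subtype.ext (congrArg (fun x : cs => (x : Fin e)) h)))
  have h3 : rankAt φ p = cs.card := hcard.symm
  rw [h3]
  calc (cs.card : ℕ∞) + p.height ≤ ((cs'.card + (e - m) : ℕ) : ℕ∞) + p.height := by gcongr
    _ = (cs'.card + p.height) + (e - m : ℕ) := by push_cast; ring
    _ ≤ _ := by gcongr

theorem isWeaklyRegular_linForm {R : Type u} [CommRing R] [IsRegularRing R] {n e : ℕ}
    (φ : Matrix (Fin n) (Fin e) R)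
    (h : ∀ (p : Ideal R) [p.IsPrime], (e : ℕ∞) ≤ rankAt φ p + p.height) :
    IsWeaklyRegular (MvPolynomial (Fin n) R) (List.ofFn (linForm φ)) := by
  suffices ∀ m, m ≤ e → IsWeaklyRegular (MvPolynomial (Fin n) R)
      ((List.ofFn (linForm φ)).take m) by
    have := this e le_rfl
    rwa [List.take_of_length_le (by simp)] at this
  intro m
  induction m with
  | zero => intro _; simp
  | succ m ih =>
    intro hm
    have ih := ih (by omega)
    have hme : m < (List.ofFn (linForm φ)).length := by simpa using hm
    rw [List.take_succ_eq_append_getElem hme, isWeaklyRegular_concat_iff]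
    refine ⟨ih, fun a ha => ?_⟩
    by_contra hna
    obtain ⟨P, c, hP, hPc⟩ := exists_prime_forall_mem_iff _ hna
    have hmem : ∀ j : Fin e, (j : ℕ) < m + 1 → linForm φ j ∈ P := by
      intro j hj
      rw [hPc]
      rcases Nat.lt_succ_iff_lt_or_eq.1 hj with hj | hj
      · refine Ideal.mul_mem_right _ _ (Ideal.subset_span ?_)
        change _ ∈ (List.ofFn (linForm φ)).take m
        rw [List.mem_take_iff_getElem]
        exact ⟨j, by simp [hj], by simp⟩
      · have : (List.ofFn (linForm φ))[m] = linForm φ j := by simp [← hj]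
        rw [this] at ha
        rw [mul_left_comm]
        exact Ideal.mul_mem_left _ _ ha
    have hPp : (P.comap C).IsPrime := inferInstance
    have h1 := (h (P.comap C)).trans
      (card_filter_add_height_le_length φ ih P _ hPc (P.comap C) rfl (m + 1) hmem)
    have h2 : e ≤ ((List.ofFn (linForm φ)).take m).length + (e - (m + 1)) := by exact_mod_cast h1
    simp at h2
    omega

open RingTheory.Sequence IsLocalRing

/-! ### The rank of a presentation matrix modulo a prime -/

theorem exists_mulVec_eq_of_isLocalization {R A : Type*} [CommRing R] [IsDomain R] [CommRing A]
    [Algebra R A] (M : Submonoid R) [IsLocalization M A] (hM : M ≤ nonZeroDivisors R) {n e : ℕ}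
    (f : Fin n → R) (φ : Matrix (Fin n) (Fin e) R)
    (hex : ∀ v, f ⬝ᵥ v = 0 → ∃ w, φ.mulVec w = v) (v : Fin n → A)
    (hv : (fun i => algebraMap R A (f i)) ⬝ᵥ v = 0) :
    ∃ w, (φ.map (algebraMap R A)).mulVec w = v := by
  obtain ⟨b, hb⟩ := IsLocalization.exist_integer_multiples_of_finite M v
  choose v' hv' using hb
  have h0 : f ⬝ᵥ v' = 0 := by
    apply IsLocalization.injective A hM
    rw [map_zero, dotProduct, map_sum]
    have : ∀ i, algebraMap R A (f i * v' i) = (b : R) • (algebraMap R A (f i) * v i) := by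
      intro i
      rw [map_mul, hv', Algebra.smul_def, Algebra.smul_def]
      ring
    rw [Finset.sum_congr rfl fun i _ => this i, ← Finset.smul_sum]
    change _ • ((fun i => algebraMap R A (f i)) ⬝ᵥ v) = 0
    rw [hv, smul_zero]
  obtain ⟨w, hw⟩ := hex v' h0
  obtain ⟨u, hu⟩ := IsLocalization.map_units A b
  refine ⟨fun j => ↑u⁻¹ * algebraMap R A (w j), ?_⟩
  funext i
  have h1 := congrArg (algebraMap R A) (congrFun hw i)
  rw [hv' i, Algebra.smul_def, ← hu, Matrix.mulVec, dotProduct, map_sum] at h1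
  rw [Matrix.mulVec, dotProduct]
  have h2 : ∀ j, (φ.map (algebraMap R A)) i j * (↑u⁻¹ * algebraMap R A (w j)) =
      ↑u⁻¹ * algebraMap R A (φ i j * w j) := by
    intro j
    rw [Matrix.map_apply, map_mul]
    ring
  rw [Finset.sum_congr rfl fun j _ => h2 j, ← Finset.mul_sum, h1, Units.inv_mul_cancel_left]

theorem rank_matrix_add_le {K : Type*} [Field K] {m n : ℕ} (M N : Matrix (Fin m) (Fin n) K) :
    (M + N).rank ≤ M.rank + N.rank := by
  rw [Matrix.rank, Matrix.rank, Matrix.rank, Matrix.mulVecLin_add]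
  refine (Submodule.finrank_mono (LinearMap.range_add_le _ _)).trans ?_
  exact Submodule.finrank_add_le_finrank_add_finrank _ _

theorem le_rankAt_add_spanFinrank {R : Type*} [CommRing R] [IsDomain R] [IsNoetherianRing R]
    {n e : ℕ} (f : Fin n → R) (φ : Matrix (Fin n) (Fin e) R)
    (hex : ∀ v, f ⬝ᵥ v = 0 → ∃ w, φ.mulVec w = v) (p : Ideal R) [p.IsPrime] :
    n ≤ rankAt φ p + Submodule.spanFinrank
      ((Ideal.span (Set.range f)).map (algebraMap R (Localization.AtPrime p))) := by
  set A := Localization.AtPrime p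
  set I := (Ideal.span (Set.range f)).map (algebraMap R A) with hI
  have hIspan : I = Ideal.span (Set.range fun i => algebraMap R A (f i)) := by
    rw [hI, Ideal.map_span, ← Set.range_comp]
    rfl
  have hfg : I.FG := IsNoetherian.noetherian I
  have hfin := Submodule.FG.finite_generators hfg
  have hgen : Ideal.span I.generators = I := Submodule.span_generators I
  have := hfin.fintype
  have hcard : Fintype.card I.generators = Submodule.spanFinrank I := by
    rw [← Submodule.FG.generators_ncard hfg, ← Nat.card_eq_fintype_card, Nat.card_coe_set_eq]
  have h1 : ∀ i, ∃ c : I.generators → A, ∑ l, c l * l = algebraMap R A (f i) := by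
    intro i
    have : algebraMap R A (f i) ∈ Ideal.span (Set.range ((↑) : I.generators → A)) := by
      rw [Subtype.range_coe, hgen, hIspan]
      exact Ideal.subset_span ⟨i, rfl⟩
    exact (Ideal.mem_span_range_iff_exists_fun).1 this
  have h2 : ∀ l : I.generators, ∃ c : Fin n → A, ∑ i, c i * algebraMap R A (f i) = l := by
    intro l
    have : (l : A) ∈ Ideal.span (Set.range fun i => algebraMap R A (f i)) := by
      rw [← hIspan]
      exact hgen.le (Ideal.subset_span l.2)
    exact (Ideal.mem_span_range_iff_exists_fun).1 this
  choose c hc using h1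
  choose e' he' using h2
  let P : Matrix (Fin n) I.generators A := fun i l => e' l i
  let Q : Matrix I.generators (Fin n) A := fun l i => c i l
  have h3 : ∀ j, (fun i => algebraMap R A (f i)) ⬝ᵥ (fun i => ((1 : Matrix (Fin n) (Fin n) A) - P * Q) i j) = 0 := by
    intro j
    have h4 : ∀ i, algebraMap R A (f i) * ((1 : Matrix (Fin n) (Fin n) A) - P * Q) i j =
        algebraMap R A (f i) * (1 : Matrix (Fin n) (Fin n) A) i j -
          ∑ l, c j l * (e' l i * algebraMap R A (f i)) := by
      intro i
      rw [Matrix.sub_apply, mul_sub, Matrix.mul_apply, Finset.mul_sum]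
      congr 1
      refine Finset.sum_congr rfl fun l _ => ?_
      simp only [P, Q]
      ring
    rw [dotProduct, Finset.sum_congr rfl fun i _ => h4 i, Finset.sum_sub_distrib,
      Finset.sum_comm]
    simp only [← Finset.mul_sum, he', hc]
    simp [Matrix.one_apply]
  choose W hW using fun j => exists_mulVec_eq_of_isLocalization p.primeCompl
    p.primeCompl_le_nonZeroDivisors f φ hex _ (h3 j)
  let W' : Matrix (Fin e) (Fin n) A := fun a j => W j a
  have h5 : φ.map (algebraMap R A) * W' + P * Q = 1 := by
    have : φ.map (algebraMap R A) * W' = 1 - P * Q := by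
      ext i j
      exact congrFun (hW j) i
    rw [this, sub_add_cancel]
  have h6 : (φ.map (algebraMap R A)).map (residue A) * W'.map (residue A) +
      P.map (residue A) * Q.map (residue A) = 1 := by
    have := congrArg (fun M : Matrix (Fin n) (Fin n) A => M.map (residue A)) h5
    simp only [Matrix.map_add _ (map_add (residue A)), Matrix.map_mul] at this
    rw [this, Matrix.map_one _ (map_zero _) (map_one _)]
  have h7 : n ≤ ((φ.map (algebraMap R A)).map (residue A)).rank + Fintype.card I.generators := by
    calc n = (1 : Matrix (Fin n) (Fin n) (ResidueField A)).rank := by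
          rw [Matrix.rank_one, Fintype.card_fin]
      _ ≤ _ := by rw [← h6]; exact rank_matrix_add_le _ _
      _ ≤ _ := add_le_add (Matrix.rank_mul_le_left _ _)
        ((Matrix.rank_mul_le_left _ _).trans (Matrix.rank_le_card_width _))
  rw [hcard] at h7
  exact h7

theorem length_le_height_of_isWeaklyRegular {R : Type u} [CommRing R] [IsNoetherianRing R]
    {rs : List R} (hrs : IsWeaklyRegular R rs) (p : Ideal R) [p.IsPrime] (hp : ∀ r ∈ rs, r ∈ p) :
    (rs.length : ℕ∞) ≤ p.height := by
  have h2 := IsWeaklyRegular.isRegular_of_isLocalization_of_mem (Localization.AtPrime p) p hrs hp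
  have h3 := ringKrullDim_add_length_eq_ringKrullDim_of_isRegular _ h2
  rw [IsLocalization.AtPrime.ringKrullDim_eq_height p (Localization.AtPrime p),
    List.length_map] at h3
  have h4 : Nontrivial (Localization.AtPrime p ⧸
      Ideal.ofList (rs.map (algebraMap R (Localization.AtPrime p)))) := by
    refine Ideal.Quotient.nontrivial_iff.2 fun h => h2.top_ne_smul ?_
    rw [h, smul_eq_mul, Ideal.mul_top]
  have h5 := ringKrullDim_nonneg_of_nontrivial (R := Localization.AtPrime p ⧸
      Ideal.ofList (rs.map (algebraMap R (Localization.AtPrime p))))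
  have h6 : ((rs.length : ℕ∞) : WithBot ℕ∞) ≤ p.height := by
    rw [← h3]
    exact le_add_of_nonneg_left h5
  exact_mod_cast h6

theorem le_height_span_X (k : Type u) [Field k] (d : ℕ)
    [(Ideal.span (Set.range (X : Fin d → MvPolynomial (Fin d) k))).IsPrime] :
    (d : ℕ∞) ≤ (Ideal.span (Set.range (X : Fin d → MvPolynomial (Fin d) k))).height := by
  have h1 : IsWeaklyRegular (MvPolynomial (Fin d) k)
      ((List.finRange d).map (X : Fin d → MvPolynomial (Fin d) k)) := by
    simpa using isWeaklyRegular_map_C_append_map_X (A := k) (ys := []) (IsWeaklyRegular.nil k k)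
      (List.finRange d) (List.nodup_finRange d)
  have h2 := length_le_height_of_isWeaklyRegular h1
    (Ideal.span (Set.range (X : Fin d → MvPolynomial (Fin d) k))) (by
      intro r hr
      obtain ⟨i, -, rfl⟩ := List.mem_map.1 hr
      exact Ideal.subset_span ⟨i, rfl⟩)
  simpa using h2

section Presentation

variable {k : Type u} [Field k] {d : ℕ}

theorem spanFinrank_map_le_one {I p : Ideal (PolyR k d)} [p.IsPrime] (hI : ¬ I ≤ p) :
    Submodule.spanFinrank
      (I.map (algebraMap (PolyR k d) (Localization.AtPrime p))) ≤ 1 := by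
  have h1 : I.map (algebraMap (PolyR k d) (Localization.AtPrime p)) = ⊤ := by
    by_contra h
    have := (IsLocalRing.le_maximalIdeal h)
    rw [Ideal.map_le_iff_le_comap] at this
    exact hI (this.trans (IsLocalization.AtPrime.under_maximalIdeal _ p).le)
  rw [h1]
  have := Submodule.spanFinrank_span_le_ncard_of_finite (R := Localization.AtPrime p)
    (Set.finite_singleton (1 : Localization.AtPrime p))
  rw [Set.ncard_singleton] at this
  change Submodule.spanFinrank (Ideal.span {1}) ≤ 1 at this
  rwa [Ideal.span_singleton_one] at this

theorem spanFinrank_map_le_height {I : Ideal (PolyR k d)} (hG : SatisfiesG I)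
    (p : Ideal (PolyR k d)) [p.IsPrime] (h0 : p ≠ ⊥)
    (hm : p ≠ Ideal.span (Set.range (X : Fin d → PolyR k d))) :
    ((Submodule.spanFinrank
      (I.map (algebraMap (PolyR k d) (Localization.AtPrime p))) : ℕ) : ℕ∞) ≤ p.height := by
  by_cases hI : I ≤ p
  · have := hG p hI hm
    rw [IsLocalization.AtPrime.ringKrullDim_eq_height p] at this
    exact_mod_cast this
  · have h3 : (1 : ℕ∞) ≤ p.height := by
      rw [Order.one_le_iff_ne_zero]
      exact fun h => h0 (Ideal.height_eq_zero_iff_eq_bot.1 h)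
    exact (Nat.cast_le.2 (spanFinrank_map_le_one hI)).trans (by simpa using h3)

theorem succ_le_rankAt_add_height {f : Fin (d + 1) → PolyR k d}
    {φ : Matrix (Fin (d + 1)) (Fin d) (PolyR k d)} {δ : Fin d → ℕ}
    (hφ : IsResolutionMatrix f φ δ) (hG : SatisfiesG (idealOf f))
    (p : Ideal (PolyR k d)) [p.IsPrime] (h0 : p ≠ ⊥)
    (hm : p ≠ Ideal.span (Set.range (X : Fin d → PolyR k d))) :
    ((d + 1 : ℕ) : ℕ∞) ≤ rankAt φ p + p.height := by
  have h1 := le_rankAt_add_spanFinrank f φ (fun v hv => (hφ.exact v).1 hv) p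
  have h2 := spanFinrank_map_le_height hG p h0 hm
  calc ((d + 1 : ℕ) : ℕ∞) ≤ _ := Nat.cast_le.2 h1
    _ ≤ _ := by push_cast; gcongr

theorem le_rankAt_add_height {f : Fin (d + 1) → PolyR k d}
    {φ : Matrix (Fin (d + 1)) (Fin d) (PolyR k d)} {δ : Fin d → ℕ}
    (hφ : IsResolutionMatrix f φ δ) (hf : idealOf f ≠ ⊥) (hG : SatisfiesG (idealOf f))
    (p : Ideal (PolyR k d)) [p.IsPrime] :
    (d : ℕ∞) ≤ rankAt φ p + p.height := by
  by_cases h0 : p = ⊥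
  · subst h0
    have h1 := le_rankAt_add_spanFinrank f φ (fun v hv => (hφ.exact v).1 hv) ⊥
    have h2 := spanFinrank_map_le_one (p := ⊥) fun h => hf (le_bot_iff.1 h)
    have h3 : d ≤ rankAt φ ⊥ := by
      change d + 1 ≤ _ + Submodule.spanFinrank ((idealOf f).map _) at h1
      omega
    exact (Nat.cast_le.2 h3).trans le_self_add
  by_cases hm : p = Ideal.span (Set.range (X : Fin d → PolyR k d))
  · subst hm
    exact (le_height_span_X k d).trans le_add_self
  · refine le_trans ?_ (succ_le_rankAt_add_height hφ hG p h0 hm)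
    exact Nat.cast_le.2 (Nat.le_succ d)

end Presentation

/-! ### Maximal minors of the presentation matrix -/

theorem exists_mulVec_eq_zero_of_minors_eq_zero {D : Type*} [CommRing D] [IsDomain D] {d : ℕ}
    (φ : Matrix (Fin (d + 1)) (Fin d) D)
    (h : ∀ i : Fin (d + 1), (φ.submatrix i.succAbove id).det = 0) :
    ∃ w ≠ 0, φ.mulVec w = 0 := by
  by_contra hno
  push Not at hno
  have hinj : ∀ w, φ.mulVec w = 0 → w = 0 := fun w hw => by
    by_contra hw0
    exact hno w hw0 hw
  have h1 : ∀ i : Fin (d + 1), ∃ (a : D) (w : Fin d → D), a ≠ 0 ∧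
      φ.mulVec w = Pi.single i a := by
    intro i
    let M : Matrix (Fin (d + 1)) (Fin (d + 1)) D :=
      Matrix.of fun l => Fin.cons ((Pi.single i 1 : Fin (d + 1) → D) l) (φ l)
    have hdet : M.det = 0 := by
      rw [Matrix.det_succ_column_zero]
      refine Finset.sum_eq_zero fun l _ => ?_
      have : M.submatrix l.succAbove Fin.succ = φ.submatrix l.succAbove id := by
        ext a b
        simp [M]
      rw [this, h, mul_zero]
    obtain ⟨v, hv0, hv⟩ := Matrix.exists_mulVec_eq_zero_iff.2 hdet
    have hv' : φ.mulVec (Fin.tail v) = Pi.single i (-v 0) := by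
      funext l
      have := congrFun hv l
      simp only [Matrix.mulVec, dotProduct, Fin.sum_univ_succ, M, Matrix.of_apply, Fin.cons_zero,
        Fin.cons_succ, Pi.zero_apply] at this
      simp only [Matrix.mulVec, dotProduct, Fin.tail]
      rw [eq_neg_of_add_eq_zero_right this]
      by_cases hl : l = i
      · subst hl; simp
      · simp [hl]
    refine ⟨-v 0, Fin.tail v, fun h0 => hv0 ?_, hv'⟩
    rw [h0, Pi.single_zero] at hv'
    have h2 := hinj _ hv'
    funext l
    refine Fin.cases ?_ (fun j => ?_) l
    · simpa using h0
    · exact congrFun h2 j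
  choose a w ha hw using h1
  let W : Matrix (Fin d) (Fin (d + 1)) D := fun j i => w i j
  have hW : Function.Injective W.mulVecLin := by
    rw [injective_iff_map_eq_zero]
    intro u hu
    have h2 : ∀ i, (φ.mulVec (W.mulVec u)) i = a i * u i := by
      intro i
      rw [Matrix.mulVec_mulVec, Matrix.mulVec, dotProduct, Finset.sum_eq_single i]
      · congr 1
        have := congrFun (hw i) i
        rw [Pi.single_eq_same] at this
        exact this
      · intro j _ hj
        have := congrFun (hw j) i
        rw [Pi.single_eq_of_ne (Ne.symm hj)] at this
        have : (φ * W) i j = 0 := this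
        rw [this, zero_mul]
      · simp
    funext i
    have h3 := h2 i
    rw [Matrix.mulVecLin_apply] at hu
    rw [hu, Matrix.mulVec_zero] at h3
    exact (mul_eq_zero.1 h3.symm).resolve_left (ha i)
  have := le_of_fin_injective D W.mulVecLin hW
  omega

/-- The signed maximal minors of a `(d + 1) × d` matrix. -/
def signedMinor {D : Type*} [CommRing D] {d : ℕ} (φ : Matrix (Fin (d + 1)) (Fin d) D)
    (i : Fin (d + 1)) : D := (-1) ^ (i : ℕ) * (φ.submatrix i.succAbove id).det

theorem signedMinor_vecMul {D : Type*} [CommRing D] {d : ℕ}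
    (φ : Matrix (Fin (d + 1)) (Fin d) D) : Matrix.vecMul (signedMinor φ) φ = 0 := by
  funext j
  let M : Matrix (Fin (d + 1)) (Fin (d + 1)) D := Matrix.of fun l => Fin.cons (φ l j) (φ l)
  have hdet : M.det = 0 :=
    Matrix.det_zero_of_column_eq (i := 0) (j := j.succ) (Fin.succ_ne_zero j).symm
      (fun l => by simp [M])
  rw [Matrix.det_succ_column_zero] at hdet
  rw [Pi.zero_apply, ← hdet, Matrix.vecMul, dotProduct]
  refine Finset.sum_congr rfl fun l _ => ?_
  have : M.submatrix l.succAbove Fin.succ = φ.submatrix l.succAbove id := by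
    ext a b
    simp [M]
  rw [this, signedMinor]
  simp only [M, Matrix.of_apply, Fin.cons_zero]
  ring

theorem mul_signedMinor_comm {R : Type*} [CommRing R] {d : ℕ} {f : Fin (d + 1) → R}
    {φ : Matrix (Fin (d + 1)) (Fin d) R} (hex : ∀ v, f ⬝ᵥ v = 0 → ∃ w, φ.mulVec w = v)
    (i l : Fin (d + 1)) : f i * signedMinor φ l = f l * signedMinor φ i := by
  obtain ⟨w, hw⟩ := hex (Pi.single l (f i) - Pi.single i (f l)) (by
    rw [dotProduct_sub, dotProduct_single, dotProduct_single]; ring)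
  have h1 : signedMinor φ ⬝ᵥ φ.mulVec w = 0 := by
    rw [Matrix.dotProduct_mulVec, signedMinor_vecMul, zero_dotProduct]
  rw [hw, dotProduct_sub, dotProduct_single, dotProduct_single] at h1
  linear_combination h1

theorem isUnit_of_signedMinor_eq {R : Type*} [CommRing R] [IsDomain R]
    [UniqueFactorizationMonoid R] {d : ℕ} {f : Fin (d + 1) → R}
    {φ : Matrix (Fin (d + 1)) (Fin d) R} (hinj : Function.Injective φ.mulVec)
    (hex : ∀ v, f ⬝ᵥ v = 0 ↔ ∃ w, φ.mulVec w = v) {c : R}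
    (hc : ∀ i, signedMinor φ i = c * f i) : IsUnit c := by
  have hminor : ∀ q : R, q ∣ c → ∀ i : Fin (d + 1), q ∣ (φ.submatrix i.succAbove id).det := by
    intro q hq i
    have h1 : q ∣ signedMinor φ i := by
      rw [hc]
      exact hq.mul_right _
    rw [signedMinor] at h1
    rcases neg_one_pow_eq_or R (i : ℕ) with h | h
    · simpa [h] using h1
    · simpa [h] using h1
  have hzero : ∀ w, φ.mulVec w = 0 → w = 0 := fun w hw =>
    hinj (hw.trans (Matrix.mulVec_zero φ).symm)
  by_contra hu
  by_cases hc0 : c = 0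
  · obtain ⟨w, hw0, hw⟩ := exists_mulVec_eq_zero_of_minors_eq_zero φ
      (fun i => zero_dvd_iff.1 (hminor 0 (hc0 ▸ dvd_rfl) i))
    exact hw0 (hzero w hw)
  · obtain ⟨q, hqi, hqc⟩ := WfDvdMonoid.exists_irreducible_factor hu hc0
    have hq : Prime q := hqi.prime
    have hqp : (Ideal.span {q}).IsPrime := (Ideal.span_singleton_prime hq.ne_zero).2 hq
    obtain ⟨w, hw0, hw⟩ := exists_mulVec_eq_zero_of_minors_eq_zero
      (φ.map (Ideal.Quotient.mk (Ideal.span {q}))) (fun i => by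
        rw [Matrix.submatrix_map, ← RingHom.mapMatrix_apply, ← RingHom.map_det,
          Ideal.Quotient.eq_zero_iff_dvd]
        exact hminor q hqc i)
    choose w' hw' using fun j => Ideal.Quotient.mk_surjective (w j)
    have h1 : ∀ i, q ∣ φ.mulVec w' i := by
      intro i
      refine (Ideal.Quotient.eq_zero_iff_dvd _ _).1 (Eq.trans ?_ (congrFun hw i))
      rw [Matrix.mulVec, dotProduct, map_sum]
      refine Finset.sum_congr rfl fun j _ => ?_
      rw [map_mul, hw']
      rfl
    choose u hu' using h1
    have h2 : φ.mulVec w' = q • u := funext hu'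
    have h3 : f ⬝ᵥ u = 0 := by
      have h4 : f ⬝ᵥ φ.mulVec w' = 0 := (hex _).2 ⟨w', rfl⟩
      rw [h2, dotProduct_smul, smul_eq_mul] at h4
      exact (mul_eq_zero.1 h4).resolve_left hq.ne_zero
    obtain ⟨z, hz⟩ := (hex u).1 h3
    have h5 : w' = q • z := hinj (by rw [h2, Matrix.mulVec_smul, hz])
    refine hw0 (funext fun j => ?_)
    rw [← hw', h5, Pi.smul_apply, smul_eq_mul, Pi.zero_apply, Ideal.Quotient.eq_zero_iff_dvd]
    exact dvd_mul_right _ _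

theorem isUnit_of_forall_dvd_of_height {R : Type*} [CommRing R] [IsNoetherianRing R] {n : ℕ}
    {f : Fin n → R} (hht : (Ideal.span (Set.range f)).height = 2) {a : R} (ha : ∀ i, a ∣ f i) :
    IsUnit a := by
  by_contra hu
  have h1 : Ideal.span (Set.range f) ≤ Ideal.span {a} := by
    rw [Ideal.span_le]
    rintro _ ⟨i, rfl⟩
    exact Ideal.mem_span_singleton.2 (ha i)
  have h2 := (Ideal.height_mono h1).trans (Ideal.height_span_singleton_le_one hu)
  rw [hht] at h2
  exact absurd h2 (by decide)

theorem exists_signedMinor_eq_mul {R : Type*} [CommRing R] [IsDomain R] [IsNoetherianRing R]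
    [UniqueFactorizationMonoid R] {d : ℕ} {f : Fin (d + 1) → R}
    {φ : Matrix (Fin (d + 1)) (Fin d) R} (hht : (Ideal.span (Set.range f)).height = 2)
    (hex : ∀ v, f ⬝ᵥ v = 0 → ∃ w, φ.mulVec w = v) :
    ∃ c, ∀ i, signedMinor φ i = c * f i := by
  obtain ⟨i, hi⟩ : ∃ i, f i ≠ 0 := by
    by_contra! h
    exact not_isUnit_zero (isUnit_of_forall_dvd_of_height hht (a := (0 : R)) (fun i => by rw [h i]))
  obtain ⟨a, b, c, hab, hca, hcb⟩ :=
    UniqueFactorizationMonoid.exists_reduced_factors (f i) hi (signedMinor φ i)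
  have hc0 : c ≠ 0 := by
    rintro rfl
    exact hi (by rw [← hca, zero_mul])
  have h1 : ∀ l, a ∣ f l := by
    intro l
    have h2 := mul_signedMinor_comm hex i l
    rw [← hca, ← hcb] at h2
    have h3 : a * signedMinor φ l = f l * b := by
      apply mul_left_cancel₀ hc0
      linear_combination h2
    exact hab.dvd_of_dvd_mul_right (Dvd.intro _ h3)
  obtain ⟨u, rfl⟩ := isUnit_of_forall_dvd_of_height hht h1
  refine ⟨↑u⁻¹ * b, fun l => ?_⟩
  have h2 := mul_signedMinor_comm hex i l
  rw [← hca, ← hcb] at h2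
  have h3 : (u : R) * signedMinor φ l = f l * b := by
    apply mul_left_cancel₀ hc0
    linear_combination h2
  calc signedMinor φ l = ↑u⁻¹ * (↑u * signedMinor φ l) := by rw [Units.inv_mul_cancel_left]
    _ = _ := by rw [h3]; ring

theorem isHomogeneous_det {k σ : Type*} [CommRing k] {d : ℕ}
    (M : Matrix (Fin d) (Fin d) (MvPolynomial σ k)) (δ : Fin d → ℕ)
    (h : ∀ i j, (M i j).IsHomogeneous (δ j)) : M.det.IsHomogeneous (∑ j, δ j) := by
  rw [Matrix.det_apply]
  refine IsHomogeneous.sum _ _ _ fun s _ => ?_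
  have h1 := IsHomogeneous.prod Finset.univ (fun j => M (s j) j) δ fun j _ => h (s j) j
  rcases Int.units_eq_one_or (Equiv.Perm.sign s) with hs | hs
  · rwa [hs, one_smul]
  · rw [hs, Units.neg_smul, one_smul]
    exact h1.neg

theorem sum_degrees_eq {k : Type u} [Field k] {d ν : ℕ} {f : Fin (d + 1) → PolyR k d}
    (hdeg : ∀ i, (f i).IsHomogeneous ν) (hht : (idealOf f).height = 2)
    {φ : Matrix (Fin (d + 1)) (Fin d) (PolyR k d)} {δ : Fin d → ℕ}
    (hφ : IsResolutionMatrix f φ δ) : ∑ j, δ j = ν := by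
  obtain ⟨c, hc⟩ := exists_signedMinor_eq_mul hht (fun v hv => (hφ.exact v).1 hv)
  have hu := isUnit_of_signedMinor_eq hφ.injective hφ.exact hc
  obtain ⟨i, hi⟩ : ∃ i, f i ≠ 0 := by
    by_contra! h
    exact not_isUnit_zero (isUnit_of_forall_dvd_of_height hht (a := (0 : PolyR k d))
      (fun i => by rw [h i]))
  obtain ⟨r, hr, rfl⟩ := MvPolynomial.isUnit_iff_eq_C_of_isReduced.1 hu
  have h1 : (signedMinor φ i).IsHomogeneous (∑ j, δ j) := by
    have := isHomogeneous_det (φ.submatrix i.succAbove id) δ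
      (fun a j => hφ.homogeneous (i.succAbove a) j)
    rw [signedMinor]
    rcases neg_one_pow_eq_or (PolyR k d) (i : ℕ) with h | h
    · simpa [h] using this
    · simpa [h] using this.neg
  have h2 : (signedMinor φ i).IsHomogeneous ν := by
    rw [hc i]
    simpa using (isHomogeneous_C (Fin d) r).mul (hdeg i)
  refine h1.inj_right h2 ?_
  rw [hc i]
  exact mul_ne_zero hu.ne_zero hi

open RingTheory.Sequence

/-! ### Existence of the graded free resolution -/

theorem grade_le_two {R : Type u} [CommRing R] [IsNoetherianRing R] {I : Ideal R}
    (hht : I.height = 2) : grade I ≤ 2 := by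
  obtain ⟨p, hp, hIp, hph⟩ := Ideal.exists_isPrime_height_eq (n := 2) (I := I) (by simpa using hht)
  refine iSup_le fun rs => iSup_le fun hrs => iSup_le fun hmem => ?_
  have := length_le_height_of_isWeaklyRegular hrs.toIsWeaklyRegular p fun r hr => hIp (hmem r hr)
  rw [hph] at this
  simpa using this

/-- The linear map `v ↦ ∑ f_i v_i`. -/
def dotMap {R : Type*} [CommRing R] {n : ℕ} (f : Fin n → R) : (Fin n → R) →ₗ[R] R :=
  Fintype.linearCombination R f

theorem dotMap_apply {R : Type*} [CommRing R] {n : ℕ} (f v : Fin n → R) :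
    dotMap f v = f ⬝ᵥ v := by
  rw [dotMap, Fintype.linearCombination_apply, dotProduct]
  exact Finset.sum_congr rfl fun i _ => by rw [smul_eq_mul, mul_comm]

theorem range_dotMap {R : Type*} [CommRing R] {n : ℕ} (f : Fin n → R) :
    LinearMap.range (dotMap f) = Ideal.span (Set.range f) :=
  Fintype.range_linearCombination R f

theorem projective_ker_dotMap {R : Type u} [CommRing R] [IsNoetherianRing R] {n : ℕ}
    (f : Fin n → R) (hht : (Ideal.span (Set.range f)).height = 2)
    (hperf : IsPerfectIdeal (Ideal.span (Set.range f))) :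
    Module.Projective R (LinearMap.ker (dotMap f)) := by
  set I := Ideal.span (Set.range f) with hI
  have h1 : CategoryTheory.HasProjectiveDimensionLT (ModuleCat.of R (R ⧸ I)) 3 := by
    have h2 : CategoryTheory.projectiveDimension (ModuleCat.of R (R ⧸ I)) ≤ (2 : ℕ) := by
      rw [hperf]
      exact WithBot.coe_le_coe.2 (grade_le_two hht)
    exact (CategoryTheory.projectiveDimension_le_iff _ 2).1 h2
  have hfree : ∀ (m : ℕ) (M : Type u) [AddCommGroup M] [Module R M] [Module.Projective R M],
      1 ≤ m → CategoryTheory.HasProjectiveDimensionLT (ModuleCat.of R M) m := by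
    intro m M _ _ _ hm
    have : CategoryTheory.Projective (ModuleCat.of R M) :=
      (IsProjective.iff_projective M).1 inferInstance
    have : CategoryTheory.HasProjectiveDimensionLT (ModuleCat.of R M) 1 :=
      CategoryTheory.projective_iff_hasProjectiveDimensionLT_one.1 this
    exact CategoryTheory.hasProjectiveDimensionLT_of_ge _ 1 m hm
  have h3 := (LinearMap.shortExact_shortComplexKer (f := Submodule.mkQ I)
    (Submodule.mkQ_surjective I)).hasProjectiveDimensionLT_X₁ 2 (hfree 2 R (by omega)) h1
  have h4 : CategoryTheory.HasProjectiveDimensionLT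
      (ModuleCat.of R (LinearMap.range (dotMap f))) 2 := by
    have e : LinearMap.ker (Submodule.mkQ I) ≃ₗ[R] LinearMap.range (dotMap f) :=
      LinearEquiv.ofEq _ _ (by rw [Submodule.ker_mkQ, range_dotMap])
    have h3 : CategoryTheory.HasProjectiveDimensionLT
      (ModuleCat.of R (LinearMap.ker (Submodule.mkQ I))) 2 := h3
    exact CategoryTheory.hasProjectiveDimensionLT_of_iso e.toModuleIso 2
  have h5 := (LinearMap.shortExact_shortComplexKer (f := (dotMap f).rangeRestrict)
    (LinearMap.surjective_rangeRestrict _)).hasProjectiveDimensionLT_X₁ 1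
    (hfree 1 (Fin n → R) le_rfl) h4
  have h6 : CategoryTheory.Projective
      (ModuleCat.of R (LinearMap.ker (dotMap f).rangeRestrict)) :=
    CategoryTheory.projective_iff_hasProjectiveDimensionLT_one.2 h5
  have h7 := (IsProjective.iff_projective _).2 h6
  rwa [LinearMap.ker_rangeRestrict] at h7

theorem homogeneousComponent_mul_of_isHomogeneous {k σ : Type*} [CommRing k]
    (p q : MvPolynomial σ k) {m : ℕ} (hq : q.IsHomogeneous m) (n : ℕ) :
    homogeneousComponent n (p * q) =
      (if m ≤ n then homogeneousComponent (n - m) p else 0) * q := by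
  classical
  ext e
  have hq' : ∀ b : σ →₀ ℕ, coeff b q ≠ 0 → b.degree = m := by
    intro b hb
    rw [Finsupp.degree_eq_weight_one]
    exact hq hb
  rw [coeff_homogeneousComponent, coeff_mul, coeff_mul]
  have key : ∀ x ∈ Finset.HasAntidiagonal.antidiagonal e,
      coeff x.1 (if m ≤ n then homogeneousComponent (n - m) p else 0) * coeff x.2 q =
      if e.degree = n then coeff x.1 p * coeff x.2 q else 0 := by
    intro x hx
    by_cases hx2 : coeff x.2 q = 0
    · simp [hx2]
    have h1 : x.1.degree + m = e.degree := by
      rw [← hq' _ hx2, ← map_add, Finset.HasAntidiagonal.mem_antidiagonal.1 hx]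
    split_ifs with h2 h3 h3
    · rw [coeff_homogeneousComponent, if_pos (by omega)]
    · rw [coeff_homogeneousComponent, if_neg (by omega), zero_mul]
    · omega
    · rw [coeff_zero, zero_mul]
  rw [Finset.sum_congr rfl key]
  split_ifs <;> simp

section Generators

variable {k : Type u} [Field k] {d N : ℕ}

/-- The degree `n` part of a vector of polynomials. -/
def vecComponent (n : ℕ) (v : Fin N → PolyR k d) : Fin N → PolyR k d :=
  fun i => homogeneousComponent n (v i)

theorem exists_homogeneous_generators (Z : Submodule (PolyR k d) (Fin N → PolyR k d))
    (hZ : ∀ v ∈ Z, ∀ n, vecComponent n v ∈ Z) :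
    ∃ (n : ℕ) (v : Fin n → Fin N → PolyR k d) (δ : Fin n → ℕ),
      (∀ j i, (v j i).IsHomogeneous (δ j)) ∧ Submodule.span (PolyR k d) (Set.range v) = Z := by
  obtain ⟨m, s, hs⟩ := Submodule.fg_iff_exists_fin_generating_family.1
    (IsNoetherian.noetherian Z)
  let D := (Finset.univ.sup fun j => Finset.univ.sup fun i => (s j i).totalDegree) + 1
  have hD : ∀ j i, (s j i).totalDegree < D := fun j i => Nat.lt_succ_of_le
    ((Finset.le_sup (f := fun i => (s j i).totalDegree) (Finset.mem_univ i)).trans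
      (Finset.le_sup (f := fun j => Finset.univ.sup fun i => (s j i).totalDegree)
        (Finset.mem_univ j)))
  let E := Fintype.equivFin (Fin m × Fin D)
  refine ⟨_, fun a => vecComponent (E.symm a).2 (s (E.symm a).1), fun a => (E.symm a).2,
    fun a i => homogeneousComponent_isHomogeneous _ _, le_antisymm ?_ ?_⟩
  · rw [Submodule.span_le]
    rintro _ ⟨a, rfl⟩
    exact hZ _ (hs ▸ Submodule.subset_span ⟨_, rfl⟩) _
  · rw [← hs, Submodule.span_le]
    rintro _ ⟨j, rfl⟩
    have : s j = ∑ n : Fin D, vecComponent n (s j) := by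
      funext i
      rw [Finset.sum_apply, Fin.sum_univ_eq_sum_range (fun n => vecComponent n (s j) i) D]
      conv_lhs => rw [← sum_homogeneousComponent (s j i)]
      refine Finset.sum_subset (Finset.range_subset_range.2 (hD j i)) fun n _ hn => ?_
      exact homogeneousComponent_eq_zero _ _ (by simpa using hn)
    rw [this]
    refine Submodule.sum_mem _ fun n _ => Submodule.subset_span ⟨E (j, n), ?_⟩
    simp

theorem constantCoeff_eq_zero_of_minimal {n : ℕ}
    (Z : Submodule (PolyR k d) (Fin N → PolyR k d))
    (v : Fin n → Fin N → PolyR k d) (δ : Fin n → ℕ)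
    (hv : ∀ j i, (v j i).IsHomogeneous (δ j)) (hspan : Submodule.span (PolyR k d) (Set.range v) = Z)
    (hmin : ∀ m < n, ¬ ∃ (v : Fin m → Fin N → PolyR k d) (δ : Fin m → ℕ),
      (∀ j i, (v j i).IsHomogeneous (δ j)) ∧ Submodule.span (PolyR k d) (Set.range v) = Z)
    (c : Fin n → PolyR k d) (hc : ∑ j, c j • v j = 0) (j : Fin n) : constantCoeff (c j) = 0 := by
  by_contra hj
  rw [constantCoeff_eq] at hj
  obtain _ | n := n
  · exact j.elim0
  have h1 : ∑ l, (if δ l ≤ δ j then homogeneousComponent (δ j - δ l) (c l) else 0) • v l = 0 := by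
    funext i
    have h2 := congrArg (homogeneousComponent (δ j)) (congrFun hc i)
    rw [Finset.sum_apply, map_sum, Pi.zero_apply, map_zero] at h2
    rw [Finset.sum_apply, Pi.zero_apply]
    refine Eq.trans ?_ h2
    refine Finset.sum_congr rfl fun l _ => ?_
    rw [Pi.smul_apply, Pi.smul_apply, smul_eq_mul, smul_eq_mul,
      homogeneousComponent_mul_of_isHomogeneous _ _ (hv l i)]
  rw [Fin.sum_univ_succAbove _ j, if_pos le_rfl, Nat.sub_self, homogeneousComponent_zero] at h1
  refine hmin n (Nat.lt_succ_self n) ⟨fun l => v (j.succAbove l), fun l => δ (j.succAbove l),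
    fun l i => hv _ i, ?_⟩
  refine le_antisymm ?_ ?_
  · rw [← hspan]
    exact Submodule.span_mono (by rintro _ ⟨l, rfl⟩; exact ⟨_, rfl⟩)
  · rw [← hspan, Submodule.span_le]
    rintro _ ⟨l, rfl⟩
    by_cases hl : l = j
    · subst hl
      have h3 : v l = (C (coeff 0 (c l))⁻¹ : PolyR k d) • ((C (coeff 0 (c l)) : PolyR k d) • v l) := by
        rw [smul_smul, ← C_mul, inv_mul_cancel₀ hj, C_1, one_smul]
      rw [h3, eq_neg_of_add_eq_zero_left h1]
      refine Submodule.smul_mem _ _ (Submodule.neg_mem _ (Submodule.sum_mem _ fun a _ => ?_))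
      exact Submodule.smul_mem _ _ (Submodule.subset_span ⟨a, rfl⟩)
    · obtain ⟨a, rfl⟩ := Fin.exists_succAbove_eq hl
      exact Submodule.subset_span ⟨a, rfl⟩

theorem linearIndependent_of_projective {n : ℕ}
    (Z : Submodule (PolyR k d) (Fin N → PolyR k d)) [Module.Projective (PolyR k d) Z]
    (v : Fin n → Fin N → PolyR k d) (hspan : Submodule.span (PolyR k d) (Set.range v) = Z)
    (hmin : ∀ c : Fin n → PolyR k d, ∑ j, c j • v j = 0 → ∀ j, constantCoeff (c j) = 0) :
    LinearIndependent (PolyR k d) v := by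
  let q : (Fin n → PolyR k d) →ₗ[PolyR k d] Z :=
    (Fintype.linearCombination (PolyR k d) v).codRestrict Z (fun c => by
      rw [← hspan, ← Fintype.range_linearCombination (PolyR k d) v]
      exact ⟨c, rfl⟩)
  have hq : ∀ c, (q c : Fin N → PolyR k d) = ∑ j, c j • v j := fun c =>
    Fintype.linearCombination_apply ..
  have hsurj : LinearMap.range q = ⊤ := by
    rw [LinearMap.range_eq_top]
    rintro ⟨z, hz⟩
    have hz' := hz
    rw [← hspan, ← Fintype.range_linearCombination (PolyR k d) v] at hz'
    obtain ⟨c, hc⟩ := hz'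
    exact ⟨c, Subtype.ext hc⟩
  obtain ⟨s, hs⟩ := LinearMap.exists_rightInverse_of_surjective q hsurj
  have hs' : ∀ z, q (s z) = z := fun z => LinearMap.congr_fun hs z
  let π : (Fin n → PolyR k d) →ₗ[PolyR k d] (Fin n → PolyR k d) := LinearMap.id - s ∘ₗ q
  have hπ : ∀ c, π c ∈ LinearMap.ker q := fun c => by
    rw [LinearMap.mem_ker]
    simp [π, hs']
  have hπ' : ∀ c ∈ LinearMap.ker q, π c = c := fun c hc => by
    rw [LinearMap.mem_ker] at hc
    simp [π, hc]
  obtain ⟨r, hr, hrN⟩ := Submodule.exists_sub_one_mem_and_smul_eq_zero_of_fg_of_le_smul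
    (RingHom.ker (constantCoeff (σ := Fin d) (R := k))) (LinearMap.ker q)
    (IsNoetherian.noetherian _) (by
      intro c hc
      have hc0 := hmin c (by rw [← hq]; exact congrArg Subtype.val hc)
      rw [← hπ' c hc, pi_eq_sum_univ' c, map_sum]
      refine Submodule.sum_mem _ fun j _ => ?_
      rw [map_smul]
      exact Submodule.smul_mem_smul (hc0 j) (hπ _))
  have hr0 : r ≠ 0 := by
    rintro rfl
    rw [RingHom.mem_ker] at hr
    simp at hr
  rw [Fintype.linearIndependent_iff]
  intro c hc j
  have h1 : c ∈ LinearMap.ker q := Subtype.ext ((hq c).trans hc)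
  have h2 := congrFun (hrN c h1) j
  exact (mul_eq_zero.1 h2).resolve_left hr0

end Generators

theorem exists_resolutionMatrix {k : Type u} [Field k] {d ν : ℕ} {f : Fin (d + 1) → PolyR k d}
    (hdeg : ∀ i, (f i).IsHomogeneous ν) (hht : (idealOf f).height = 2)
    (hperf : IsPerfectIdeal (idealOf f)) :
    ∃ (φ : Matrix (Fin (d + 1)) (Fin d) (PolyR k d)) (δ : Fin d → ℕ),
      IsResolutionMatrix f φ δ := by
  classical
  set Z := LinearMap.ker (dotMap f) with hZdef
  have hproj : Module.Projective (PolyR k d) Z := projective_ker_dotMap f hht hperf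
  have hZ : ∀ v ∈ Z, ∀ n, vecComponent n v ∈ Z := by
    intro v hv n
    rw [hZdef, LinearMap.mem_ker, dotMap_apply] at hv ⊢
    have h1 := congrArg (homogeneousComponent (n + ν)) hv
    rw [map_zero, dotProduct, map_sum] at h1
    rw [dotProduct, ← h1]
    refine Finset.sum_congr rfl fun i _ => ?_
    rw [mul_comm (f i) (v i), homogeneousComponent_mul_of_isHomogeneous _ _ (hdeg i),
      if_pos (Nat.le_add_left _ _), Nat.add_sub_cancel, mul_comm]
    rfl
  have hex := exists_homogeneous_generators Z hZ
  obtain ⟨v, δ, hv, hspan⟩ := Nat.find_spec hex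
  have hind := linearIndependent_of_projective Z v hspan
    (constantCoeff_eq_zero_of_minimal Z v δ hv hspan (fun m hm => Nat.find_min hex hm))
  generalize Nat.find hex = n at *
  have hn : n = d := by
    have h1 := LinearMap.rank_range_add_rank_ker (dotMap f)
    have h2 : Module.rank (PolyR k d) (LinearMap.range (dotMap f)) = 1 := by
      refine le_antisymm ?_ ?_
      · exact (Submodule.rank_le _).trans (by simp)
      · have : Nontrivial (LinearMap.range (dotMap f)) := by
          rw [Submodule.nontrivial_iff_ne_bot, range_dotMap]
          intro h0
          have hht' := hht
          simp only [idealOf] at hht'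
          rw [h0, Ideal.height_bot] at hht'
          exact absurd hht' (by decide)
        exact Cardinal.one_le_iff_pos.2 rank_pos
    have h3 : Module.rank (PolyR k d) (LinearMap.ker (dotMap f)) = (n : ℕ) := by
      rw [← hZdef, ← hspan, rank_eq_card_basis (Module.Basis.span hind), Fintype.card_fin]
    rw [h2, h3] at h1
    have h4 : ((1 + n : ℕ) : Cardinal.{u}) = ((d + 1 : ℕ) : Cardinal.{u}) := by
      push_cast
      rw [h1]
      simp
    have := Nat.cast_injective h4
    omega
  subst hn
  have hmul : ∀ w, Matrix.mulVec (fun i j => v j i) w = ∑ j, w j • v j := by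
    intro w
    funext i
    simp [Matrix.mulVec, dotProduct, mul_comm]
  refine ⟨fun i j => v j i, δ, fun i j => hv j i, ?_, fun z => ?_⟩
  · intro w w' h
    rw [hmul, hmul] at h
    exact (linearIndependent_iff_injective_fintypeLinearCombination.1 hind) (by
      rw [Fintype.linearCombination_apply, Fintype.linearCombination_apply, h])
  · rw [← dotMap_apply, ← LinearMap.mem_ker, ← hZdef, ← hspan,
      ← Fintype.range_linearCombination (PolyR _ _) v]
    simp only [LinearMap.mem_range, Fintype.linearCombination_apply, hmul]

open RingTheory.Sequence

open Matrix

/-! ### The graded Koszul resolution of a weakly regular sequence -/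

/-- A graded free resolution of `A/(rs)` over `A = k[σ]` of length `|rs|`, with the features of the
Koszul complex that matter for duality: it starts in `A`, it ends in a free module of rank one
generated in degree `top`, and the entries of its last differential generate `(rs)`. -/
structure KoszulResolution {σ : Type*} {k : Type u} [CommRing k] {G : Type*} [AddCommGroup G]
    (w : σ → G) (rs : List (MvPolynomial σ k)) (top : G) where
  ι : ℕ → Type
  fintype : ∀ i, Fintype (ι i)
  D : ∀ i, Matrix (ι i) (ι (i + 1)) (MvPolynomial σ k)
  ε : ∀ i, ι i → G
  D_mul_D : ∀ i, D i * D (i + 1) = 0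
  exact : ∀ i v, D i *ᵥ v = 0 → ∃ u, D (i + 1) *ᵥ u = v
  uniqueZero : Unique (ι 0)
  ε_zero : ∀ a, ε 0 a = 0
  mem_iff : ∀ s, s ∈ Ideal.ofList rs ↔ ∃ v, D 0 *ᵥ v = fun _ => s
  uniqueTop : Unique (ι rs.length)
  ε_top : ∀ a, ε rs.length a = top
  isEmpty : ∀ i, rs.length < i → IsEmpty (ι i)
  span_top : ∀ i, i + 1 = rs.length → ∀ b, Ideal.span (Set.range fun a => D i a b) = Ideal.ofList rs
  homogeneous : ∀ i a b, IsWeightedHomogeneous w (D i a b) (ε (i + 1) b - ε i a)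

/-- Index types of the mapping cone. -/
abbrev coneIndex (ι : ℕ → Type) : ℕ → Type
  | 0 => ι 0
  | i + 1 => ι (i + 1) ⊕ ι i

open Classical in
/-- Differentials of the mapping cone of multiplication by `r`. -/
def coneD {A : Type*} [CommRing A] {ι : ℕ → Type} (D : ∀ i, Matrix (ι i) (ι (i + 1)) A) (r : A) :
    ∀ i, Matrix (coneIndex ι i) (coneIndex ι (i + 1)) A
  | 0 => fromCols (D 0) (r • (1 : Matrix (ι 0) (ι 0) A))
  | i + 1 => fromBlocks (D (i + 1)) (r • (1 : Matrix (ι (i + 1)) (ι (i + 1)) A)) 0 (-D i)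

/-- Degrees of the basis of the mapping cone. -/
def coneDegree {G : Type*} [AddCommGroup G] {ι : ℕ → Type} (ε : ∀ i, ι i → G) (m : G) :
    ∀ i, coneIndex ι i → G
  | 0 => ε 0
  | i + 1 => Sum.elim (ε (i + 1)) (fun b => ε i b + m)

/-- Finiteness of the bases of the mapping cone. -/
abbrev coneFintype {ι : ℕ → Type} (h : ∀ i, Fintype (ι i)) : ∀ i, Fintype (coneIndex ι i)
  | 0 => h 0
  | i + 1 => @instFintypeSum _ _ (h (i + 1)) (h i)

theorem isWeightedHomogeneous_smul_one {σ : Type*} {k : Type u} [CommRing k] {G : Type*}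
    [AddCommGroup G] {w : σ → G} {r : MvPolynomial σ k} {m : G} (hr : IsWeightedHomogeneous w r m)
    {κ : Type} [DecidableEq κ] (ε : κ → G) (a b : κ) :
    IsWeightedHomogeneous w ((r • (1 : Matrix κ κ (MvPolynomial σ k))) a b) (ε b + m - ε a) := by
  rw [Matrix.smul_apply, Matrix.one_apply]
  split_ifs with h
  · subst h
    simpa using hr
  · simpa using isWeightedHomogeneous_zero k w _

section Cone

variable {A : Type*} [CommRing A] {α β γ : Type} (r : A)

theorem fromCols_mul_fromBlocks_eq_zero [Fintype α] [Fintype β] [DecidableEq α] [DecidableEq β]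
    {M : Matrix α β A} {N : Matrix β γ A} (h : M * N = 0) :
    fromCols M (r • (1 : Matrix α α A)) * fromBlocks N (r • (1 : Matrix β β A)) 0 (-M) = 0 := by
  rw [fromCols_mul_fromBlocks]
  simp [h]

theorem fromBlocks_mul_fromBlocks_eq_zero [Fintype α] [Fintype β] [DecidableEq α] [DecidableEq β]
    {κ : Type} {L : Matrix κ α A} {M : Matrix α β A}
    {N : Matrix β γ A} (h : M * N = 0) (h' : L * M = 0) :
    fromBlocks M (r • (1 : Matrix α α A)) 0 (-L) *
      fromBlocks N (r • (1 : Matrix β β A)) 0 (-M) = 0 := by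
  rw [fromBlocks_multiply]
  simp [h, h']

theorem exists_fromBlocks_mulVec [Fintype β] [Fintype γ] [DecidableEq β]
    {M : Matrix α β A} {N : Matrix β γ A}
    (h : ∀ v, M *ᵥ v = 0 → ∃ u, N *ᵥ u = v) (v : β ⊕ α → A)
    (hv : M *ᵥ (v ∘ Sum.inl) + r • (v ∘ Sum.inr) = 0) (hu : ∃ u, M *ᵥ u = v ∘ Sum.inr) :
    ∃ u, fromBlocks N (r • (1 : Matrix β β A)) 0 (-M) *ᵥ u = v := by
  obtain ⟨u, hu⟩ := hu
  obtain ⟨t, ht⟩ := h (v ∘ Sum.inl + r • u) (by rw [mulVec_add, mulVec_smul, hu, hv])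
  refine ⟨Sum.elim t (-u), ?_⟩
  rw [fromBlocks_mulVec, Sum.elim_comp_inl, Sum.elim_comp_inr, ht, smul_mulVec, one_mulVec,
    zero_mulVec, neg_mulVec, mulVec_neg, hu, neg_neg, zero_add, smul_neg, add_neg_cancel_right,
    Sum.elim_comp_inl_inr]

theorem exists_fromBlocks_mulVec_of_fromCols [Fintype α] [Fintype β] [Fintype γ] [DecidableEq α] [DecidableEq β]
    {M : Matrix α β A} {N : Matrix β γ A}
    (h : ∀ v, M *ᵥ v = 0 → ∃ u, N *ᵥ u = v)
    (hreg : ∀ v, (∃ u, M *ᵥ u = r • v) → ∃ u, M *ᵥ u = v) (v : β ⊕ α → A)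
    (hv : fromCols M (r • (1 : Matrix α α A)) *ᵥ v = 0) :
    ∃ u, fromBlocks N (r • (1 : Matrix β β A)) 0 (-M) *ᵥ u = v := by
  rw [fromCols_mulVec, smul_mulVec, one_mulVec] at hv
  refine exists_fromBlocks_mulVec r h v hv (hreg _ ⟨-(v ∘ Sum.inl), ?_⟩)
  rw [mulVec_neg, neg_eq_iff_add_eq_zero, hv]

theorem exists_fromBlocks_mulVec_of_fromBlocks [Fintype α] [Fintype β] [Fintype γ] [DecidableEq α] [DecidableEq β]
    {κ : Type} {L : Matrix κ α A} {M : Matrix α β A}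
    {N : Matrix β γ A} (h : ∀ v, M *ᵥ v = 0 → ∃ u, N *ᵥ u = v)
    (h' : ∀ v, L *ᵥ v = 0 → ∃ u, M *ᵥ u = v) (v : β ⊕ α → A)
    (hv : fromBlocks M (r • (1 : Matrix α α A)) 0 (-L) *ᵥ v = 0) :
    ∃ u, fromBlocks N (r • (1 : Matrix β β A)) 0 (-M) *ᵥ u = v := by
  rw [fromBlocks_mulVec, smul_mulVec, one_mulVec, zero_mulVec, zero_add] at hv
  refine exists_fromBlocks_mulVec r h v (funext fun a => congrFun hv (Sum.inl a)) (h' _ ?_)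
  ext1 a
  have := congrFun hv (Sum.inr a)
  rw [Sum.elim_inr, neg_mulVec] at this
  exact neg_eq_zero.1 this

theorem exists_fromCols_mulVec_iff [Fintype α] [Fintype β] [DecidableEq α]
    {M : Matrix α β A} {y : α → A} :
    (∃ v, fromCols M (r • (1 : Matrix α α A)) *ᵥ v = y) ↔ ∃ v c, M *ᵥ v + r • c = y := by
  constructor
  · rintro ⟨v, hv⟩
    rw [fromCols_mulVec, smul_mulVec, one_mulVec] at hv
    exact ⟨_, _, hv⟩
  · rintro ⟨v, c, hv⟩
    refine ⟨Sum.elim v c, ?_⟩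
    rw [fromCols_mulVec, smul_mulVec, one_mulVec, Sum.elim_comp_inl, Sum.elim_comp_inr, hv]

end Cone

theorem span_range_fromCols {A : Type*} [CommRing A] {α β : Type} [DecidableEq α] (r : A)
    (hα : ∀ a b : α, a = b) (M : Matrix α β A) (b : α) :
    Ideal.span (Set.range fun a => fromCols M (r • (1 : Matrix α α A)) a (Sum.inr b)) =
      Ideal.span {r} := by
  congr 1
  ext s
  constructor
  · rintro ⟨a, rfl⟩
    simp [hα a b]
  · rintro rfl
    exact ⟨b, by simp⟩

theorem span_range_fromBlocks {A : Type*} [CommRing A] {α β κ : Type} [DecidableEq α] (r : A)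
    (hα : ∀ a b : α, a = b) (L : Matrix κ α A) (M : Matrix α β A) (b : α) :
    Ideal.span (Set.range fun a => fromBlocks M (r • (1 : Matrix α α A)) 0 (-L) a (Sum.inr b)) =
      Ideal.span (Set.range fun a => L a b) ⊔ Ideal.span {r} := by
  apply le_antisymm
  · rw [Ideal.span_le]
    rintro _ ⟨a | a, rfl⟩
    · refine Submodule.mem_sup_right ?_
      simp [hα a b]
    · refine Submodule.mem_sup_left ?_
      change (-L) a b ∈ _
      rw [Matrix.neg_apply]
      exact neg_mem (Ideal.subset_span ⟨a, rfl⟩)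
  · refine sup_le (Ideal.span_le.2 ?_) (Ideal.span_le.2 ?_)
    · rintro _ ⟨a, rfl⟩
      change L a b ∈ _
      rw [← neg_neg (L a b)]
      exact neg_mem (Ideal.subset_span ⟨Sum.inr a, rfl⟩)
    · rintro _ rfl
      exact Ideal.subset_span ⟨Sum.inl b, by simp⟩

/-- The mapping cone of multiplication by `r` on a Koszul resolution. -/
def KoszulResolution.cone {σ : Type*} {k : Type u} [CommRing k] {G : Type*} [AddCommGroup G]
    {w : σ → G} {rs : List (MvPolynomial σ k)} {top : G} (K : KoszulResolution w rs top)
    {r : MvPolynomial σ k} {m : G} (hr : IsWeightedHomogeneous w r m)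
    (hreg : ∀ a, r * a ∈ Ideal.ofList rs → a ∈ Ideal.ofList rs) :
    KoszulResolution w (rs ++ [r]) (top + m) where
  ι := coneIndex K.ι
  fintype := coneFintype K.fintype
  D := coneD K.D r
  ε := coneDegree K.ε m
  D_mul_D := by
    classical
    let := K.fintype
    rintro (_ | i)
    · exact fromCols_mul_fromBlocks_eq_zero r (K.D_mul_D 0)
    · exact fromBlocks_mul_fromBlocks_eq_zero r (K.D_mul_D (i + 1)) (K.D_mul_D i)
  exact := by
    classical
    let := K.fintype
    rintro (_ | i) v hv
    · refine exists_fromBlocks_mulVec_of_fromCols r (K.exact 0) ?_ v hv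
      have hconst : ∀ v : K.ι 0 → MvPolynomial σ k, v = fun _ => v K.uniqueZero.default :=
        fun v => funext fun a => congrArg v (K.uniqueZero.eq_default a)
      intro v hu
      rw [hconst v] at hu ⊢
      exact (K.mem_iff _).1 (hreg _ ((K.mem_iff _).2 hu))
    · exact exists_fromBlocks_mulVec_of_fromBlocks r (K.exact (i + 1)) (K.exact i) v hv
  uniqueZero := K.uniqueZero
  ε_zero := K.ε_zero
  mem_iff := by
    classical
    let := K.fintype
    intro s
    refine Iff.trans ?_ (exists_fromCols_mulVec_iff r (M := K.D 0)).symm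
    rw [Ideal.ofList_append, Ideal.ofList_singleton]
    constructor
    · intro h
      obtain ⟨a, ha, b, hb, rfl⟩ := Submodule.mem_sup.1 h
      obtain ⟨c, rfl⟩ := Ideal.mem_span_singleton'.1 hb
      obtain ⟨v, hv⟩ := (K.mem_iff a).1 ha
      refine ⟨v, fun _ => c, ?_⟩
      rw [hv]
      exact funext fun _ => congrArg (a + ·) (mul_comm r c)
    · rintro ⟨v, c, hv⟩
      have h := congrFun hv K.uniqueZero.default
      rw [← h]
      refine Submodule.add_mem_sup ((K.mem_iff _).2 ⟨v, ?_⟩)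
        (Ideal.mem_span_singleton.2 ⟨c K.uniqueZero.default, rfl⟩)
      exact funext fun a => by rw [K.uniqueZero.eq_default a]
  uniqueTop := by
    rw [List.length_append, List.length_singleton]
    haveI := K.isEmpty (rs.length + 1) (Nat.lt_succ_self _)
    haveI := K.uniqueTop
    exact (Equiv.emptySum (K.ι (rs.length + 1)) (K.ι rs.length)).unique
  ε_top := by
    rw [List.length_append, List.length_singleton]
    rintro (a | a)
    · exact ((K.isEmpty (rs.length + 1) (Nat.lt_succ_self _)).false a).elim
    · change K.ε _ a + m = top + m
      rw [K.ε_top]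
  isEmpty := by
    rw [List.length_append, List.length_singleton]
    rintro (_ | i) hi
    · omega
    · have := K.isEmpty (i + 1) (by omega)
      have := K.isEmpty i (by omega)
      exact inferInstanceAs (IsEmpty (K.ι (i + 1) ⊕ K.ι i))
  span_top := by
    classical
    rw [List.length_append, List.length_singleton, Ideal.ofList_append, Ideal.ofList_singleton]
    intro i hi b
    have hi : i = rs.length := by omega
    have hsub : ∀ a b : K.ι i, a = b := by
      rw [hi]
      exact K.uniqueTop.instSubsingleton.elim
    rcases b with b | b
    · exact ((K.isEmpty _ (by omega)).false b).elim
    cases i with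
    | zero =>
      obtain rfl : rs = [] := List.length_eq_zero_iff.1 hi.symm
      rw [Ideal.ofList_nil, bot_sup_eq]
      exact span_range_fromCols r hsub (K.D 0) b
    | succ n =>
      rw [← K.span_top n hi b]
      exact span_range_fromBlocks r hsub (K.D n) (K.D (n + 1)) b
  homogeneous := by
    classical
    rintro (_ | i) a b
    · rcases b with b | b
      · exact K.homogeneous 0 a b
      · exact isWeightedHomogeneous_smul_one hr (K.ε 0) a b
    · rcases a with a | a <;> rcases b with b | b
      · exact K.homogeneous (i + 1) a b
      · exact isWeightedHomogeneous_smul_one hr (K.ε (i + 1)) a b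
      · exact isWeightedHomogeneous_zero k w _
      · change IsWeightedHomogeneous w (-K.D i a b) (K.ε (i + 1) b + m - (K.ε i a + m))
        rw [add_sub_add_right_eq_sub]
        exact (weightedHomogeneousSubmodule k w _).neg_mem (K.homogeneous i a b)

/-- The trivial resolution of `A`. -/
def koszulResolutionNil {σ : Type*} {k : Type u} [CommRing k] {G : Type*} [AddCommGroup G]
    (w : σ → G) : KoszulResolution (k := k) w [] 0 :=
  letI inst : ∀ i, Fintype (Nat.casesOn (motive := fun _ => Type) i Unit fun _ => Empty) :=
    fun i => match i with
      | 0 => inferInstanceAs (Fintype Unit)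
      | _ + 1 => inferInstanceAs (Fintype Empty)
  { ι := fun i => Nat.casesOn (motive := fun _ => Type) i Unit fun _ => Empty
    fintype := inst
    D := fun _ _ => Empty.elim
    ε := fun _ _ => 0
    D_mul_D := fun i => by ext a b; exact b.elim
    exact := fun i v _ => ⟨fun b => b.elim, funext fun b => b.elim⟩
    uniqueZero := inferInstanceAs (Unique Unit)
    ε_zero := fun _ => rfl
    mem_iff := fun s => by
      rw [Ideal.ofList_nil, Ideal.mem_bot]
      constructor
      · rintro rfl
        exact ⟨fun _ => 0, _root_.funext fun _ => rfl⟩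
      · rintro ⟨v, hv⟩
        rw [← congrFun hv (show Unit from ())]
        rfl
    uniqueTop := inferInstanceAs (Unique Unit)
    ε_top := fun _ => rfl
    isEmpty := fun i hi => match i, hi with
      | _ + 1, _ => inferInstanceAs (IsEmpty Empty)
    span_top := fun i hi => by simp at hi
    homogeneous := fun i a b => Empty.elim b }

theorem nonempty_koszulResolution {σ : Type*} {k : Type u} [CommRing k] {G : Type*}
    [AddCommGroup G] (w : σ → G) (L : List (MvPolynomial σ k × G))
    (hL : ∀ p ∈ L, IsWeightedHomogeneous w p.1 p.2)
    (hreg : IsWeaklyRegular (MvPolynomial σ k) (L.map Prod.fst)) :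
    Nonempty (KoszulResolution w (L.map Prod.fst) (L.map Prod.snd).sum) := by
  induction L using List.reverseRecOn with
  | nil => exact ⟨koszulResolutionNil w⟩
  | append_singleton L p ih =>
    rw [List.map_append, List.map_singleton, isWeaklyRegular_concat_iff] at hreg
    obtain ⟨K⟩ := ih (fun q hq => hL q (by simp [hq])) hreg.1
    rw [List.map_append, List.map_singleton, List.map_append, List.map_singleton, List.sum_append,
      List.sum_singleton]
    exact ⟨K.cone (hL p (by simp)) hreg.2⟩

open Matrix

/-! ### Laurent polynomials with restricted support -/

section Laurent

variable {k : Type u} [Field k] {σ : Type*}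

/-- Laurent polynomials in the variables `σ`. -/
abbrev Laurent (k : Type u) [Field k] (σ : Type*) := AddMonoidAlgebra k (σ → ℤ)

/-- Natural exponents as integral exponents. -/
def expHom (σ : Type*) : (σ →₀ ℕ) →+ (σ → ℤ) where
  toFun α v := α v
  map_zero' := by ext; simp
  map_add' _ _ := by ext; simp

theorem expHom_injective (σ : Type*) : Function.Injective (expHom σ) := fun α β h => by
  ext v
  exact Nat.cast_injective (R := ℤ) (congrFun h v)

/-- The inclusion of polynomials into Laurent polynomials. -/
def toLaurent : MvPolynomial σ k →+* Laurent k σ := AddMonoidAlgebra.mapDomainRingHom k (expHom σ)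

theorem coeff_toLaurent (p : MvPolynomial σ k) (α : σ →₀ ℕ) :
    (toLaurent p).coeff (expHom σ α) = coeff α p :=
  Finsupp.mapDomain_apply (expHom_injective σ) (AddMonoidAlgebra.coeff p) α

theorem toLaurent_injective : Function.Injective (toLaurent (k := k) (σ := σ)) :=
  AddMonoidAlgebra.mapDomain_injective (expHom_injective σ)

theorem toLaurent_monomial (α : σ →₀ ℕ) (c : k) :
    toLaurent (monomial α c) = AddMonoidAlgebra.single (expHom σ α) c :=
  AddMonoidAlgebra.mapDomain_single

/-- Laurent polynomials whose exponents lie in `A`. -/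
def supportedOn (k : Type u) [Field k] (A : Set (σ → ℤ)) : Submodule k (Laurent k σ) where
  carrier := {z | ∀ e, z.coeff e ≠ 0 → e ∈ A}
  zero_mem' e he := by simp at he
  add_mem' {a b} ha hb e he := by
    by_contra h
    refine he ?_
    rw [AddMonoidAlgebra.coeff_add, Finsupp.add_apply, not_not.1 (mt (ha e) h),
      not_not.1 (mt (hb e) h), add_zero]
  smul_mem' c a ha e he := by
    refine ha e fun h => he ?_
    rw [AddMonoidAlgebra.coeff_smul, Finsupp.smul_apply, h, smul_zero]

theorem supportedOn_mono {A B : Set (σ → ℤ)} (h : A ⊆ B) : supportedOn k A ≤ supportedOn k B :=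
  fun _ hz e he => h (hz e he)

theorem mul_mem_supportedOn {A B C : Set (σ → ℤ)} (h : ∀ a ∈ A, ∀ b ∈ B, a + b ∈ C)
    {y z : Laurent k σ} (hy : y ∈ supportedOn k A) (hz : z ∈ supportedOn k B) :
    y * z ∈ supportedOn k C := by
  classical
  intro e he
  obtain ⟨a, ha, b, hb, rfl⟩ := Finset.mem_add.1
    (AddMonoidAlgebra.support_coeff_mul_subset y z (Finsupp.mem_support_iff.2 he))
  exact h a (hy a (Finsupp.mem_support_iff.1 ha)) b (hz b (Finsupp.mem_support_iff.1 hb))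

theorem single_mem_supportedOn {A : Set (σ → ℤ)} {e : σ → ℤ} (he : e ∈ A) (c : k) :
    AddMonoidAlgebra.single e c ∈ supportedOn k A := by
  classical
  intro e' he'
  rw [AddMonoidAlgebra.coeff_single, Finsupp.single_apply] at he'
  split_ifs at he' with h
  · exact h ▸ he
  · exact absurd rfl he'

theorem toLaurent_mem_supportedOn {A : Set (σ → ℤ)} {p : MvPolynomial σ k}
    (h : ∀ α, coeff α p ≠ 0 → expHom σ α ∈ A) : toLaurent p ∈ supportedOn k A := by
  intro e he
  by_cases hr : e ∈ Set.range (expHom σ)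
  · obtain ⟨α, rfl⟩ := hr
    rw [coeff_toLaurent] at he
    exact h α he
  · exact absurd (Finsupp.mapDomain_of_notMem_range (AddMonoidAlgebra.coeff p) e hr) he

theorem coeff_mem_of_toLaurent_mem {A : Set (σ → ℤ)} {p : MvPolynomial σ k}
    (h : toLaurent p ∈ supportedOn k A) (α : σ →₀ ℕ) (hα : coeff α p ≠ 0) : expHom σ α ∈ A :=
  h _ (by rwa [coeff_toLaurent])

theorem exists_toLaurent_eq [Finite σ] {z : Laurent k σ}
    (hz : z ∈ supportedOn k {e : σ → ℤ | ∀ v, 0 ≤ e v}) : ∃ p : MvPolynomial σ k,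
      toLaurent p = z := by
  refine ⟨AddMonoidAlgebra.comapDomain (expHom σ) (expHom_injective σ) z,
    AddMonoidAlgebra.mapDomain_comapDomain ?_ _⟩
  intro e he
  have h0 := hz e (Finsupp.mem_support_iff.1 he)
  refine ⟨Finsupp.equivFunOnFinite.symm fun v => (e v).toNat, ?_⟩
  ext v
  exact Int.toNat_of_nonneg (h0 v)

open Classical in
/-- The part of a Laurent polynomial with exponents in `A`. -/
def restrictTo (A : Set (σ → ℤ)) (z : Laurent k σ) : Laurent k σ :=
  .ofCoeff (z.coeff.filter (· ∈ A))

theorem restrictTo_mem (A : Set (σ → ℤ)) (z : Laurent k σ) : restrictTo A z ∈ supportedOn k A := by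
  classical
  intro e he
  by_contra h
  exact he (Finsupp.filter_apply_neg _ _ h)

theorem restrictTo_mem_of_mem (A : Set (σ → ℤ)) {B : Set (σ → ℤ)} {z : Laurent k σ}
    (hz : z ∈ supportedOn k B) : restrictTo A z ∈ supportedOn k B := by
  classical
  intro e he
  refine hz e fun h => he ?_
  change (z.coeff.filter (· ∈ A)) e = 0
  rw [Finsupp.filter_apply, h, ite_self]

theorem sub_restrictTo_mem {A B : Set (σ → ℤ)} {z : Laurent k σ} (hz : z ∈ supportedOn k (A ∪ B)) :
    z - restrictTo A z ∈ supportedOn k B := by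
  classical
  intro e he
  have h1 : (z - restrictTo A z).coeff e = z.coeff e - (z.coeff.filter (· ∈ A)) e := rfl
  rw [h1, Finsupp.filter_apply] at he
  split_ifs at he with h
  · exact absurd (sub_self _) he
  · exact (hz e (by simpa using he)).resolve_left h

variable [Fintype σ] {G : Type*} [AddCommGroup G]

/-- The degree of a Laurent monomial. -/
def expDegree (w : σ → G) : (σ → ℤ) →+ G where
  toFun e := ∑ v, e v • w v
  map_zero' := by simp
  map_add' a b := by simp [add_smul, Finset.sum_add_distrib]

theorem expDegree_expHom (w : σ → G) (α : σ →₀ ℕ) :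
    expDegree w (expHom σ α) = Finsupp.weight w α := by
  rw [Finsupp.weight_apply, Finsupp.sum_fintype _ _ (by simp)]
  exact Finset.sum_congr rfl fun v _ => natCast_zsmul (w v) (α v)

theorem toLaurent_mem_iff_isWeightedHomogeneous (w : σ → G) {p : MvPolynomial σ k} {n : G} :
    toLaurent p ∈ supportedOn k {e | expDegree w e = n} ↔ IsWeightedHomogeneous w p n := by
  constructor
  · intro h α hα
    rw [← expDegree_expHom]
    exact coeff_mem_of_toLaurent_mem h α hα
  · intro h
    refine toLaurent_mem_supportedOn fun α hα => ?_
    change expDegree w _ = n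
    rw [expDegree_expHom]
    exact h hα

end Laurent

/-! ### Exponents of local cohomology -/

section Exponents

variable {σ : Type*} (r : σ → ℕ)

/-- Exponents that may be negative only at the variables of rank less than `l`. -/
def localExp (l : ℕ) : Set (σ → ℤ) := {e | ∀ v, e v < 0 → r v < l}

/-- The exponents in `localExp r m` that are nonnegative at some variable of rank less than `l`. -/
def partialExp (l m : ℕ) : Set (σ → ℤ) := {e | e ∈ localExp r m ∧ ∃ v, r v < l ∧ 0 ≤ e v}

/-- `A` is stable under adding exponents of polynomials. -/
def IsUpperExp (A : Set (σ → ℤ)) : Prop := ∀ a : σ → ℤ, (∀ v, 0 ≤ a v) → ∀ e ∈ A, a + e ∈ A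

theorem isUpperExp_localExp (l : ℕ) : IsUpperExp (localExp r l) := fun a ha e he v hv => by
  refine he v ?_
  have := ha v
  rw [Pi.add_apply] at hv
  omega

theorem isUpperExp_partialExp (l m : ℕ) : IsUpperExp (partialExp r l m) := by
  rintro a ha e ⟨he, v, hv, h0⟩
  exact ⟨isUpperExp_localExp r m a ha e he, v, hv, add_nonneg (ha v) h0⟩

theorem localExp_mono {l m : ℕ} (h : l ≤ m) : localExp r l ⊆ localExp r m :=
  fun _ he v hv => (he v hv).trans_le h

theorem partialExp_subset (l m : ℕ) : partialExp r l m ⊆ localExp r m := fun _ he => he.1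

theorem partialExp_mono {l m l' m' : ℕ} (h : l ≤ l') (h' : m ≤ m') :
    partialExp r l m ⊆ partialExp r l' m' :=
  fun _ ⟨he, v, hv, h0⟩ => ⟨localExp_mono r h' he, v, hv.trans_le h, h0⟩

theorem localExp_inter_partialExp (l m : ℕ) :
    localExp r l ∩ partialExp r l m ⊆ partialExp r l l := fun _ ⟨h, h'⟩ => ⟨h, h'.2⟩

theorem partialExp_zero (m : ℕ) : partialExp r 0 m = ∅ := by
  ext e
  simp [partialExp]

variable {r} {l : ℕ} {v₀ : σ}

theorem localExp_subset_partialExp (hv₀ : ∀ v, r v = l ↔ v = v₀) :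
    localExp r l ⊆ partialExp r (l + 1) (l + 1) := by
  intro e he
  have h0 := (hv₀ v₀).2 rfl
  refine ⟨localExp_mono r (Nat.le_succ l) he, v₀, by omega, ?_⟩
  by_contra h
  have := he v₀ (not_le.1 h)
  omega

theorem partialExp_succ_subset (hv₀ : ∀ v, r v = l ↔ v = v₀) :
    partialExp r (l + 1) (l + 1) ⊆ localExp r l ∪ partialExp r l (l + 1) := by
  rintro e ⟨he, v, hv, h0⟩
  by_cases h : r v < l
  · exact Or.inr ⟨he, v, h, h0⟩
  · left
    have hvv : v = v₀ := (hv₀ v).1 (by omega)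
    intro v' hv'
    by_contra h'
    have h2 := he v' hv'
    have h3 : v' = v₀ := (hv₀ v').1 (by omega)
    rw [h3, ← hvv] at hv'
    omega

variable [DecidableEq σ]

theorem single_add_mem_localExp (hv₀ : ∀ v, r v = l ↔ v = v₀) {e : σ → ℤ}
    (he : e ∈ localExp r (l + 1)) {N : ℤ} (hN : 0 ≤ N + e v₀) : Pi.single v₀ N + e ∈ localExp r l := by
  intro v hv
  rw [Pi.add_apply] at hv
  by_cases h : v = v₀
  · subst h
    rw [Pi.single_eq_same] at hv
    omega
  · rw [Pi.single_eq_of_ne h, zero_add] at hv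
    have := he v hv
    have h2 := mt (hv₀ v).1 h
    omega

theorem single_add_mem_localExp_succ (hv₀ : ∀ v, r v = l ↔ v = v₀) {e : σ → ℤ}
    (he : e ∈ localExp r l) (N : ℤ) :
    Pi.single v₀ N + e ∈ localExp r (l + 1) := by
  intro v hv
  rw [Pi.add_apply] at hv
  by_cases h : v = v₀
  · have := (hv₀ v).2 h
    omega
  · rw [Pi.single_eq_of_ne h, zero_add] at hv
    have := he v hv
    omega

theorem exists_nonneg_single_add (hv₀ : ∀ v, r v = l ↔ v = v₀) {e : σ → ℤ}
    (he : ∃ v, r v < l ∧ 0 ≤ e v) (N : ℤ) :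
    ∃ v, r v < l ∧ 0 ≤ (Pi.single v₀ N + e : σ → ℤ) v := by
  obtain ⟨v, hv, h0⟩ := he
  refine ⟨v, hv, ?_⟩
  have h : v ≠ v₀ := fun h => by
    have := (hv₀ v).2 h
    omega
  rwa [Pi.add_apply, Pi.single_eq_of_ne h, zero_add]

end Exponents

open Matrix

/-! ### Chains of Laurent polynomials -/

section Chains

variable {k : Type u} [Field k] {σ : Type*} {ι : Type}

/-- Vectors of Laurent polynomials whose entry at `a` has exponents in `A a`. -/
def chainsOn (k : Type u) [Field k] (A : ι → Set (σ → ℤ)) : AddSubgroup (ι → Laurent k σ) where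
  carrier := {z | ∀ a, z a ∈ supportedOn k (A a)}
  zero_mem' _ := zero_mem _
  add_mem' hy hz a := add_mem (hy a) (hz a)
  neg_mem' hz a := neg_mem (hz a)

/-- Vectors of Laurent polynomials with exponents in `A`. -/
abbrev chains (k : Type u) [Field k] (ι : Type) (A : Set (σ → ℤ)) :
    AddSubgroup (ι → Laurent k σ) := chainsOn k fun _ => A

theorem chains_mono {A B : Set (σ → ℤ)} (h : A ⊆ B) : chains k ι A ≤ chains k ι B :=
  fun _ hz a => supportedOn_mono h (hz a)

theorem mem_chains_of_inter {A B C : Set (σ → ℤ)} (h : A ∩ B ⊆ C) {z : ι → Laurent k σ}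
    (hA : z ∈ chains k ι A) (hB : z ∈ chains k ι B) : z ∈ chains k ι C :=
  fun a e he => h ⟨hA a e he, hB a e he⟩

theorem chains_empty {z : ι → Laurent k σ} (hz : z ∈ chains k ι (∅ : Set (σ → ℤ))) : z = 0 := by
  ext a e
  by_contra h
  exact hz a e h

theorem exists_add_of_mem_chains {A B C : Set (σ → ℤ)} (h : C ⊆ A ∪ B) {z : ι → Laurent k σ}
    (hz : z ∈ chains k ι C) : ∃ a ∈ chains k ι A, ∃ b ∈ chains k ι B, z = a + b ∧
      ∀ E : ι → Set (σ → ℤ), z ∈ chainsOn k E → a ∈ chainsOn k E :=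
  ⟨fun i => restrictTo A (z i), fun i => restrictTo_mem A _, fun i => z i - restrictTo A (z i),
    fun i => sub_restrictTo_mem (supportedOn_mono h (hz i)), by ext1 i; simp,
    fun _ hE i => restrictTo_mem_of_mem A (hE i)⟩

theorem single_smul_mem_chains {A B : Set (σ → ℤ)} {e : σ → ℤ} (h : ∀ a ∈ A, e + a ∈ B)
    {z : ι → Laurent k σ} (hz : z ∈ chains k ι A) :
    (AddMonoidAlgebra.single e (1 : k) : Laurent k σ) • z ∈ chains k ι B := fun a =>
  mul_mem_supportedOn (A := {e}) (B := A) (by rintro _ rfl; exact h)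
    (single_mem_supportedOn (Set.mem_singleton e) 1) (hz a)

theorem toLaurent_smul_mem_chains {A : Set (σ → ℤ)} (hA : IsUpperExp A) (p : MvPolynomial σ k)
    {z : ι → Laurent k σ} (hz : z ∈ chains k ι A) : toLaurent p • z ∈ chains k ι A := fun a =>
  mul_mem_supportedOn hA (toLaurent_mem_supportedOn fun α _ v => Int.natCast_nonneg (α v)) (hz a)

theorem exists_bound [Finite ι] (v : σ) (z : ι → Laurent k σ) :
    ∃ N : ℕ, z ∈ chains k ι {e : σ → ℤ | 0 ≤ (N : ℤ) + e v} := by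
  classical
  have := Fintype.ofFinite ι
  refine ⟨Finset.univ.sup fun a => (z a).coeff.support.sup fun e => (-e v).toNat,
    fun a e he => ?_⟩
  have h1 : (-e v).toNat ≤ (z a).coeff.support.sup fun e => (-e v).toNat :=
    Finset.le_sup (f := fun e : σ → ℤ => (-e v).toNat) (Finsupp.mem_support_iff.2 he)
  have h2 : ((z a).coeff.support.sup fun e => (-e v).toNat) ≤
      Finset.univ.sup fun a => (z a).coeff.support.sup fun e => (-e v).toNat :=
    Finset.le_sup (f := fun a => (z a).coeff.support.sup fun e => (-e v).toNat) (Finset.mem_univ a)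
  change (0 : ℤ) ≤ _ + e v
  omega

theorem mem_chains_of_le {v : σ} {z : ι → Laurent k σ} {M N : ℕ} (h : M ≤ N)
    (hz : z ∈ chains k ι {e : σ → ℤ | 0 ≤ (M : ℤ) + e v}) :
    z ∈ chains k ι {e : σ → ℤ | 0 ≤ (N : ℤ) + e v} :=
  chains_mono (fun e (he : (0 : ℤ) ≤ M + e v) => show (0 : ℤ) ≤ N + e v by omega) hz

variable {r : σ → ℕ} {l : ℕ} {v₀ : σ} [DecidableEq σ]

/-- The Laurent monomial `v ^ N`. -/
def laurentPow (k : Type u) [Field k] (v : σ) (N : ℤ) : Laurent k σ :=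
  AddMonoidAlgebra.single (Pi.single v N) 1

theorem laurentPow_mul_neg (v : σ) (N : ℤ) : laurentPow k v N * laurentPow k v (-N) = 1 := by
  rw [laurentPow, laurentPow, AddMonoidAlgebra.single_mul_single, ← Pi.single_add]
  simp [AddMonoidAlgebra.one_def]

theorem toLaurent_X_pow (v : σ) (N : ℕ) :
    toLaurent (X v ^ N : MvPolynomial σ k) = laurentPow k v N := by
  rw [X_pow_eq_monomial, toLaurent_monomial, laurentPow]
  congr 1
  ext v'
  change ((Finsupp.single v N v' : ℕ) : ℤ) = _
  by_cases h : v' = v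
  · subst h
    simp
  · rw [Finsupp.single_eq_of_ne h, Pi.single_eq_of_ne h, Nat.cast_zero]

theorem laurentPow_smul_mem_local (hv₀ : ∀ v, r v = l ↔ v = v₀) {z : ι → Laurent k σ} {N : ℕ}
    (hz : z ∈ chains k ι (localExp r (l + 1)))
    (hN : z ∈ chains k ι {e : σ → ℤ | 0 ≤ (N : ℤ) + e v₀}) :
    laurentPow k v₀ N • z ∈ chains k ι (localExp r l) :=
  single_smul_mem_chains (fun _ he => single_add_mem_localExp hv₀ he.1 he.2)
    (mem_chains_of_inter (C := localExp r (l + 1) ∩ {e : σ → ℤ | 0 ≤ (N : ℤ) + e v₀}) subset_rfl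
      hz hN)

theorem laurentPow_smul_mem_partial (hv₀ : ∀ v, r v = l ↔ v = v₀) {z : ι → Laurent k σ} {N : ℕ}
    (hz : z ∈ chains k ι (partialExp r l (l + 1)))
    (hN : z ∈ chains k ι {e : σ → ℤ | 0 ≤ (N : ℤ) + e v₀}) :
    laurentPow k v₀ N • z ∈ chains k ι (partialExp r l l) :=
  single_smul_mem_chains (B := partialExp r l l) (fun _ he => ⟨single_add_mem_localExp hv₀ he.1.1 he.2,
    exists_nonneg_single_add hv₀ he.1.2 N⟩)
    (mem_chains_of_inter (C := partialExp r l (l + 1) ∩ {e : σ → ℤ | 0 ≤ (N : ℤ) + e v₀})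
      subset_rfl hz hN)

theorem laurentPow_smul_mem_local_succ (hv₀ : ∀ v, r v = l ↔ v = v₀) {z : ι → Laurent k σ} (N : ℤ)
    (hz : z ∈ chains k ι (localExp r l)) :
    laurentPow k v₀ N • z ∈ chains k ι (localExp r (l + 1)) :=
  single_smul_mem_chains (fun _ he => single_add_mem_localExp_succ hv₀ he N) hz

theorem laurentPow_smul_mem_partial_succ (hv₀ : ∀ v, r v = l ↔ v = v₀) {z : ι → Laurent k σ}
    (N : ℤ) (hz : z ∈ chains k ι (partialExp r l l)) :
    laurentPow k v₀ N • z ∈ chains k ι (partialExp r l (l + 1)) :=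
  single_smul_mem_chains (B := partialExp r l (l + 1)) (fun _ he =>
    ⟨single_add_mem_localExp_succ hv₀ he.1 N,
    exists_nonneg_single_add hv₀ he.2 N⟩) hz

end Chains

/-! ### The connecting relation -/

attribute [instance] KoszulResolution.fintype

namespace KoszulResolution

variable {k : Type u} [Field k] {σ : Type*} {G : Type*} [AddCommGroup G] {w : σ → G}
  {rs : List (MvPolynomial σ k)} {top : G} (K : KoszulResolution w rs top) (r : σ → ℕ)

/-- The differential of the complex with Laurent polynomial coefficients. -/
def bd (i : ℕ) : (K.ι (i + 1) → Laurent k σ) →ₗ[Laurent k σ] (K.ι i → Laurent k σ) :=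
  ((K.D i).map toLaurent).mulVecLin

theorem bd_bd (i : ℕ) (z : K.ι (i + 1 + 1) → Laurent k σ) : K.bd i (K.bd (i + 1) z) = 0 := by
  rw [bd, bd, mulVecLin_apply, mulVecLin_apply, mulVec_mulVec, ← Matrix.map_mul, K.D_mul_D]
  simp

theorem bd_toLaurent (i : ℕ) (s : K.ι (i + 1) → MvPolynomial σ k) :
    K.bd i (toLaurent ∘ s) = toLaurent ∘ (K.D i *ᵥ s) := by
  ext1 a
  exact (RingHom.map_mulVec toLaurent (K.D i) s a).symm

theorem bd_mem {A : Set (σ → ℤ)} (hA : IsUpperExp A) {i : ℕ} {z : K.ι (i + 1) → Laurent k σ}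
    (hz : z ∈ chains k _ A) : K.bd i z ∈ chains k _ A := fun a =>
  Submodule.sum_mem _ fun b _ => toLaurent_smul_mem_chains hA (K.D i a b) hz b

/-- `z` is a boundary of chains in `localExp r m` modulo chains in `partialExp r l m`. -/
def IsBoundary (l m : ℕ) (i : ℕ) (z : K.ι i → Laurent k σ) : Prop :=
  ∃ y ∈ chains k (K.ι (i + 1)) (localExp r m), ∃ v ∈ chains k (K.ι i) (partialExp r l m),
    z = K.bd i y + v

/-- `z` is a cycle modulo chains in `partialExp r l l`. -/
def IsCycle (l : ℕ) : ∀ i, (K.ι i → Laurent k σ) → Prop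
  | 0, _ => True
  | i + 1, z => K.bd i z ∈ chains k _ (partialExp r l l)

theorem mem_localExp_zero {e : σ → ℤ} : e ∈ localExp r 0 ↔ ∀ v, 0 ≤ e v := by
  simp [localExp]

variable {K r}

theorem toLaurent_comp_mem_chains {κ : Type} (s : κ → MvPolynomial σ k) :
    toLaurent ∘ s ∈ chains k κ (localExp r 0) := fun _ =>
  toLaurent_mem_supportedOn fun α _ v hv => absurd hv (not_lt.2 (Int.natCast_nonneg (α v)))

theorem isBoundary_localize {l i : ℕ} {v₀ : σ} (hv₀ : ∀ v, r v = l ↔ v = v₀)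
    (h : ∀ z : K.ι (i + 1) → Laurent k σ, z ∈ chains k _ (localExp r l) →
      K.bd i z ∈ chains k _ (partialExp r l l) → K.IsBoundary r l l (i + 1) z)
    {z : K.ι (i + 1) → Laurent k σ} (hz : z ∈ chains k _ (localExp r (l + 1)))
    (hbd : K.bd i z ∈ chains k _ (partialExp r l (l + 1))) :
    K.IsBoundary r l (l + 1) (i + 1) z := by
  classical
  obtain ⟨N₁, h₁⟩ := exists_bound v₀ z
  obtain ⟨N₂, h₂⟩ := exists_bound v₀ (K.bd i z)
  set N := max N₁ N₂
  obtain ⟨y, hy, v, hv, he⟩ := h (laurentPow k v₀ N • z)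
    (laurentPow_smul_mem_local hv₀ hz (mem_chains_of_le (le_max_left _ _) h₁))
    (by
      rw [map_smul]
      exact laurentPow_smul_mem_partial hv₀ hbd (mem_chains_of_le (le_max_right _ _) h₂))
  refine ⟨_, laurentPow_smul_mem_local_succ hv₀ (-N) hy, _,
    laurentPow_smul_mem_partial_succ hv₀ (-N) hv, ?_⟩
  rw [map_smul, ← smul_add, ← he, smul_smul, mul_comm, laurentPow_mul_neg, one_smul]

variable (K r)

/-- The relation between `l`-cycles with coefficients in the `l`-th local cohomology and elements
of `A` that is obtained by iterating the connecting homomorphisms. -/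
def Connects : ∀ l, (K.ι l → Laurent k σ) → MvPolynomial σ k → Prop
  | 0, z, s => z ∈ chains k _ (localExp r 0) ∧ K.IsBoundary r 0 0 0 (z - (fun _ => toLaurent s : K.ι 0 → Laurent k σ))
  | l + 1, z', s => z' ∈ chains k _ (localExp r (l + 1)) ∧
      ∃ z, Connects l z s ∧ K.bd l z' - z ∈ chains k _ (partialExp r l (l + 1))

variable {K r}

theorem IsBoundary.add {l m i : ℕ} {y z : K.ι i → Laurent k σ} (hy : K.IsBoundary r l m i y)
    (hz : K.IsBoundary r l m i z) : K.IsBoundary r l m i (y + z) := by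
  obtain ⟨a, ha, b, hb, rfl⟩ := hy
  obtain ⟨a', ha', b', hb', rfl⟩ := hz
  refine ⟨_, add_mem ha ha', _, add_mem hb hb', ?_⟩
  rw [map_add]
  abel

theorem IsBoundary.smul {l m i : ℕ} {z : K.ι i → Laurent k σ} (p : MvPolynomial σ k)
    (hz : K.IsBoundary r l m i z) : K.IsBoundary r l m i (toLaurent p • z) := by
  obtain ⟨a, ha, b, hb, rfl⟩ := hz
  refine ⟨_, toLaurent_smul_mem_chains (isUpperExp_localExp r m) p ha, _,
    toLaurent_smul_mem_chains (isUpperExp_partialExp r l m) p hb, ?_⟩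
  rw [map_smul, smul_add]

theorem Connects.mem : ∀ {l : ℕ} {z : K.ι l → Laurent k σ} {s : MvPolynomial σ k},
    K.Connects r l z s → z ∈ chains k _ (localExp r l)
  | 0, _, _, h => h.1
  | _ + 1, _, _, h => h.1

theorem Connects.add {l : ℕ} {y z : K.ι l → Laurent k σ} {s t : MvPolynomial σ k}
    (hy : K.Connects r l y s) (hz : K.Connects r l z t) : K.Connects r l (y + z) (s + t) := by
  induction l with
  | zero =>
    refine ⟨add_mem hy.1 hz.1, ?_⟩
    have h := hy.2.add hz.2
    rw [sub_add_sub_comm] at h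
    rw [map_add]
    exact h
  | succ l ih =>
    obtain ⟨hy, y', hyy, hy'⟩ := hy
    obtain ⟨hz, z', hzz, hz'⟩ := hz
    refine ⟨add_mem hy hz, y' + z', ih hyy hzz, ?_⟩
    rw [map_add, add_sub_add_comm]
    exact add_mem hy' hz'

theorem Connects.smul {l : ℕ} {z : K.ι l → Laurent k σ} {s : MvPolynomial σ k}
    (p : MvPolynomial σ k) (hz : K.Connects r l z s) :
    K.Connects r l (toLaurent p • z) (p * s) := by
  induction l with
  | zero =>
    refine ⟨toLaurent_smul_mem_chains (isUpperExp_localExp r 0) p hz.1, ?_⟩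
    have h := hz.2.smul p
    rw [smul_sub] at h
    rw [map_mul]
    exact h
  | succ l ih =>
    obtain ⟨hz, z', hzz, hz'⟩ := hz
    refine ⟨toLaurent_smul_mem_chains (isUpperExp_localExp r _) p hz, _, ih hzz, ?_⟩
    rw [map_smul, ← smul_sub]
    exact toLaurent_smul_mem_chains (isUpperExp_partialExp r _ _) p hz'

theorem connects_zero_of_mem {l : ℕ} {s : MvPolynomial σ k} (hs : s ∈ Ideal.ofList rs) :
    K.Connects r l 0 s := by
  induction l with
  | zero =>
    refine ⟨zero_mem _, ?_⟩
    obtain ⟨v, hv⟩ := (K.mem_iff s).1 hs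
    refine ⟨-(toLaurent ∘ v), neg_mem (toLaurent_comp_mem_chains v), 0, zero_mem _, ?_⟩
    rw [map_neg, bd_toLaurent, hv]
    ext1 a
    simp
  | succ l ih =>
    exact ⟨zero_mem _, 0, ih, by rw [map_zero, sub_zero]; exact zero_mem _⟩

theorem Connects.congr {l : ℕ} {z : K.ι l → Laurent k σ} {s t : MvPolynomial σ k}
    (h : K.Connects r l z s) (hst : t - s ∈ Ideal.ofList rs) : K.Connects r l z t := by
  have := h.add (connects_zero_of_mem hst)
  rwa [add_zero, add_sub_cancel] at this

variable (K) [Fintype σ]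

/-- Homogeneous chains of degree `n`. -/
def homChains (i : ℕ) (n : G) : AddSubgroup (K.ι i → Laurent k σ) :=
  chainsOn k fun a => {e | expDegree w e = n - K.ε i a}

theorem bd_mem_homChains {i : ℕ} {n : G} {z : K.ι (i + 1) → Laurent k σ}
    (hz : z ∈ K.homChains (i + 1) n) : K.bd i z ∈ K.homChains i n := fun a =>
  Submodule.sum_mem _ fun b _ => mul_mem_supportedOn
    (A := {e | expDegree w e = K.ε (i + 1) b - K.ε i a})
    (B := {e | expDegree w e = n - K.ε (i + 1) b})
    (fun x (hx : expDegree w x = _) y (hy : expDegree w y = _) => by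
      change expDegree w (x + y) = _
      rw [map_add, hx, hy]
      abel)
    ((toLaurent_mem_iff_isWeightedHomogeneous w).2 (K.homogeneous i a b)) (hz b)

variable {K}

theorem exists_toLaurent_comp_eq {i : ℕ} {z : K.ι i → Laurent k σ}
    (hz : z ∈ chains k _ (localExp r 0)) : ∃ s, toLaurent ∘ s = z := by
  have : ∀ a, ∃ p : MvPolynomial σ k, toLaurent p = z a := fun a =>
    exists_toLaurent_eq (supportedOn_mono (fun e he => (mem_localExp_zero r).1 he) (hz a))
  choose s hs using this
  exact ⟨s, _root_.funext hs⟩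

theorem isBoundary_of_lt (d : ℕ) (hr : ∀ l < d, ∃ v₀, ∀ v, r v = l ↔ v = v₀) (l : ℕ) (hl : l ≤ d) :
    ∀ i, l ≤ i → ∀ z : K.ι (i + 1) → Laurent k σ, z ∈ chains k _ (localExp r l) →
      K.bd i z ∈ chains k _ (partialExp r l l) → K.IsBoundary r l l (i + 1) z := by
  induction l with
  | zero =>
    intro i _ z hz hbd
    obtain ⟨s, rfl⟩ := exists_toLaurent_comp_eq hz
    rw [partialExp_zero] at hbd
    have h0 := chains_empty hbd
    rw [bd_toLaurent] at h0
    obtain ⟨u, rfl⟩ := K.exact i s (_root_.funext fun a => toLaurent_injective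
      ((congrFun h0 a).trans (map_zero _).symm))
    refine ⟨toLaurent ∘ u, toLaurent_comp_mem_chains u, 0, zero_mem _, ?_⟩
    rw [bd_toLaurent, add_zero]
  | succ l ih =>
    intro i hi z hz hbd
    obtain ⟨v₀, hv₀⟩ := hr l hl
    cases i with
    | zero => omega
    | succ i =>
      obtain ⟨b, hb, a, ha, hab, -⟩ := exists_add_of_mem_chains (partialExp_succ_subset hv₀) hbd
      have hb' : K.bd i b ∈ chains k _ (partialExp r l l) := by
        refine mem_chains_of_inter (localExp_inter_partialExp r l (l + 1))
          (K.bd_mem (isUpperExp_localExp r l) hb) ?_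
        have h1 : K.bd i b = -K.bd i a := by
          rw [← sub_eq_zero, sub_neg_eq_add, ← map_add, ← hab, bd_bd]
        rw [h1]
        exact neg_mem (K.bd_mem (isUpperExp_partialExp r l (l + 1)) ha)
      obtain ⟨y, hy, v, hv, hbyv⟩ := ih (by omega) i (by omega) b hb hb'
      have hloc : chains k (K.ι (i + 1 + 1)) (localExp r l) ≤ chains k _ (localExp r (l + 1)) :=
        chains_mono (localExp_mono r (Nat.le_succ l))
      obtain ⟨u, hu, t, ht, hut⟩ := isBoundary_localize (K := K) (r := r) (i := i + 1) hv₀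
        (ih (by omega) (i + 1) (by omega)) (z := z - y) (sub_mem hz (hloc hy)) (by
          have h1 : K.bd (i + 1) (z - y) = a + v := by
            rw [map_sub, hab, hbyv]
            abel
          rw [h1]
          exact add_mem ha (chains_mono (partialExp_mono r le_rfl (Nat.le_succ l)) hv))
      refine ⟨u, hu, t + y, add_mem (chains_mono (partialExp_mono r (Nat.le_succ l) le_rfl) ht)
        (chains_mono (localExp_subset_partialExp hv₀) hy), ?_⟩
      rw [← add_assoc, ← hut, sub_add_cancel]

theorem mem_of_isBoundary_toLaurent {s : MvPolynomial σ k}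
    (h : K.IsBoundary r 0 0 0 fun _ => toLaurent s) : s ∈ Ideal.ofList rs := by
  obtain ⟨y, hy, v, hv, h⟩ := h
  rw [partialExp_zero] at hv
  obtain rfl := chains_empty hv
  obtain ⟨u, rfl⟩ := exists_toLaurent_comp_eq hy
  rw [bd_toLaurent, add_zero] at h
  exact (K.mem_iff s).2 ⟨u, _root_.funext fun a => (toLaurent_injective (congrFun h a)).symm⟩

theorem exists_connects {d : ℕ} (hr : ∀ l < d, ∃ v₀, ∀ v, r v = l ↔ v = v₀) {l : ℕ} (hl : l ≤ d)
    {z : K.ι l → Laurent k σ} (hz : z ∈ chains k _ (localExp r l)) (hc : K.IsCycle r l l z) :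
    ∃ s, K.Connects r l z s ∧ ∀ n, z ∈ K.homChains l n → IsWeightedHomogeneous w s n := by
  induction l with
  | zero =>
    obtain ⟨s, rfl⟩ := exists_toLaurent_comp_eq hz
    refine ⟨s K.uniqueZero.default, ⟨hz, 0, zero_mem _, 0, zero_mem _, ?_⟩, fun n hn => ?_⟩
    · rw [map_zero, add_zero, sub_eq_zero]
      exact _root_.funext fun a => by rw [K.uniqueZero.eq_default a]; rfl
    · have := hn K.uniqueZero.default
      beta_reduce at this
      rw [K.ε_zero, sub_zero] at this
      exact (toLaurent_mem_iff_isWeightedHomogeneous w).1 this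
  | succ l ih =>
    obtain ⟨v₀, hv₀⟩ := hr l hl
    obtain ⟨b, hb, a, ha, hab, hhom⟩ := exists_add_of_mem_chains (partialExp_succ_subset hv₀) hc
    have hcb : K.IsCycle r l l b := by
      cases l with
      | zero => trivial
      | succ l =>
        refine mem_chains_of_inter (localExp_inter_partialExp r (l + 1) (l + 1 + 1))
          (K.bd_mem (isUpperExp_localExp r _) hb) ?_
        have h1 : K.bd l b = -K.bd l a := by
          rw [← sub_eq_zero, sub_neg_eq_add, ← map_add, ← hab, bd_bd]
        rw [h1]
        exact neg_mem (K.bd_mem (isUpperExp_partialExp r _ _) ha)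
    obtain ⟨s, hs, hsn⟩ := ih (by omega) hb hcb
    refine ⟨s, ⟨hz, b, hs, ?_⟩, fun n hn => hsn n (hhom _ (K.bd_mem_homChains hn))⟩
    rw [hab, add_sub_cancel_left]
    exact ha

theorem Connects.isBoundary {d : ℕ} (hr : ∀ l < d, ∃ v₀, ∀ v, r v = l ↔ v = v₀) {l : ℕ}
    (hl : l ≤ d) {z : K.ι l → Laurent k σ} (h : K.Connects r l z 0) : K.IsBoundary r l l l z := by
  induction l with
  | zero =>
    have h2 := h.2
    rw [map_zero] at h2
    rwa [show z - (fun _ => (0 : Laurent k σ)) = z from sub_zero z] at h2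
  | succ l ih =>
    obtain ⟨v₀, hv₀⟩ := hr l hl
    obtain ⟨hz, z', hzz, hw⟩ := h
    obtain ⟨y, hy, v, hv, rfl⟩ := ih (by omega) hzz
    obtain ⟨u, hu, t, ht, hut⟩ := isBoundary_localize (K := K) (r := r) (i := l) hv₀
      (isBoundary_of_lt d hr l (by omega) l le_rfl) (z := z - y)
      (sub_mem hz (chains_mono (localExp_mono r (Nat.le_succ l)) hy)) (by
        have h1 : K.bd l (z - y) = K.bd l z - (K.bd l y + v) + v := by
          rw [map_sub]
          abel
        rw [h1]
        exact add_mem hw (chains_mono (partialExp_mono r le_rfl (Nat.le_succ l)) hv))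
    refine ⟨u, hu, t + y, add_mem (chains_mono (partialExp_mono r (Nat.le_succ l) le_rfl) ht)
      (chains_mono (localExp_subset_partialExp hv₀) hy), ?_⟩
    rw [← add_assoc, ← hut, sub_add_cancel]

theorem Connects.mem_of_isBoundary {d : ℕ} (hr : ∀ l < d, ∃ v₀, ∀ v, r v = l ↔ v = v₀) {l : ℕ}
    (hl : l ≤ d) {z : K.ι l → Laurent k σ} {s : MvPolynomial σ k} (h : K.Connects r l z s)
    (hb : K.IsBoundary r l l l z) : s ∈ Ideal.ofList rs := by
  induction l with
  | zero =>
    have h1 := IsBoundary.add (h.2.smul (-1)) hb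
    refine mem_of_isBoundary_toLaurent (K := K) (r := r) ?_
    convert h1 using 1
    ext1 a
    simp
  | succ l ih =>
    obtain ⟨v₀, hv₀⟩ := hr l hl
    obtain ⟨y, hy, v, hv, rfl⟩ := hb
    obtain ⟨b, hbm, a, ha, rfl, -⟩ := exists_add_of_mem_chains (partialExp_succ_subset hv₀) hv
    obtain ⟨-, z, hzz, hw⟩ := h
    refine ih (by omega) hzz ⟨b, hbm, z - K.bd l b, ?_, by abel⟩
    refine mem_chains_of_inter (localExp_inter_partialExp r l (l + 1))
      (sub_mem hzz.mem (K.bd_mem (isUpperExp_localExp r l) hbm)) ?_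
    rw [map_add, map_add, bd_bd, zero_add] at hw
    have h1 : z - K.bd l b = K.bd l a - (K.bd l b + K.bd l a - z) := by abel
    rw [h1]
    exact sub_mem (K.bd_mem (isUpperExp_partialExp r l (l + 1)) ha) hw

theorem connects_zero_of_mem_partialExp {d : ℕ} (hr : ∀ l < d, ∃ v₀, ∀ v, r v = l ↔ v = v₀)
    {l : ℕ} (hl : l ≤ d) {z : K.ι l → Laurent k σ} (hz : z ∈ chains k _ (partialExp r l l)) :
    K.Connects r l z 0 := by
  obtain ⟨s, hs, -⟩ := exists_connects hr hl (chains_mono (partialExp_subset r l l) hz) (by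
    cases l with
    | zero => trivial
    | succ l => exact K.bd_mem (isUpperExp_partialExp r _ _) hz)
  have h := hs.mem_of_isBoundary hr hl ⟨0, zero_mem _, z, hz, by rw [map_zero, zero_add]⟩
  exact hs.congr (by rw [zero_sub]; exact neg_mem h)

theorem Connects.exists_pow_mul_mem {d : ℕ} (hr : ∀ l < d, ∃ v₀, ∀ v, r v = l ↔ v = v₀) {l : ℕ}
    (hl : l ≤ d) {z : K.ι l → Laurent k σ} {s : MvPolynomial σ k} (h : K.Connects r l z s)
    (v : σ) (hv : r v < l) : ∃ N : ℕ, X v ^ N * s ∈ Ideal.ofList rs := by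
  classical
  induction l with
  | zero => omega
  | succ l ih =>
    obtain ⟨v₀, hv₀⟩ := hr l hl
    obtain ⟨hz, z', hzz, hw⟩ := h
    by_cases hvl : r v < l
    · exact ih (by omega) hzz hvl
    obtain rfl : v = v₀ := (hv₀ v).1 (by omega)
    obtain ⟨N₁, h₁⟩ := exists_bound v z
    obtain ⟨N₂, h₂⟩ := exists_bound v (K.bd l z - z')
    obtain ⟨N, hN₁, hN₂⟩ : ∃ N, N₁ ≤ N ∧ N₂ ≤ N := ⟨_, le_max_left _ _, le_max_right _ _⟩
    refine ⟨N, (hzz.smul (X v ^ N)).mem_of_isBoundary hr (by omega) ?_⟩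
    rw [toLaurent_X_pow]
    refine ⟨_, laurentPow_smul_mem_local hv₀ hz (mem_chains_of_le hN₁ h₁), _,
      neg_mem (laurentPow_smul_mem_partial hv₀ hw (mem_chains_of_le hN₂ h₂)), ?_⟩
    rw [map_smul, smul_sub]
    abel

theorem exists_connects_of_pow_mul_mem {d : ℕ} (hr : ∀ l < d, ∃ v₀, ∀ v, r v = l ↔ v = v₀) {l : ℕ}
    (hl : l ≤ d) {s : MvPolynomial σ k}
    (hs : ∀ v, r v < l → ∃ N : ℕ, X v ^ N * s ∈ Ideal.ofList rs) :
    ∃ z, K.Connects r l z s := by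
  classical
  induction l with
  | zero =>
    refine ⟨toLaurent ∘ fun _ => s, toLaurent_comp_mem_chains _, 0, zero_mem _, 0, zero_mem _, ?_⟩
    rw [map_zero, add_zero, sub_eq_zero]
    rfl
  | succ l ih =>
    obtain ⟨v₀, hv₀⟩ := hr l hl
    obtain ⟨z, hz⟩ := ih (by omega) fun v hv => hs v (by omega)
    obtain ⟨N, hN⟩ := hs v₀ (by have := (hv₀ v₀).2 rfl; omega)
    obtain ⟨y, hy, v, hv, he⟩ := ((hz.smul (X v₀ ^ N)).congr (t := 0)
      (by rw [zero_sub]; exact neg_mem hN)).isBoundary hr (by omega)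
    rw [toLaurent_X_pow] at he
    refine ⟨laurentPow k v₀ (-N) • y, laurentPow_smul_mem_local_succ hv₀ _ hy, z, hz, ?_⟩
    have h1 : z = laurentPow k v₀ (-N) • (K.bd l y + v) := by
      rw [← he, smul_smul, mul_comm, laurentPow_mul_neg, one_smul]
    have h2 : K.bd l (laurentPow k v₀ (-N) • y) - z = -(laurentPow k v₀ (-N) • v) := by
      rw [h1, map_smul, smul_add]
      abel
    rw [h2]
    exact neg_mem (laurentPow_smul_mem_partial_succ hv₀ _ hv)

end KoszulResolution

open RingTheory.Sequence

/-! ### The equations of the symmetric algebra and of the Rees algebra -/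

section Equations

variable {k : Type u} [Field k] {d : ℕ}

/-- `S` as polynomial ring in the `T_j` over `R`. -/
def polyEquiv (k : Type u) [Field k] (d : ℕ) :
    PolyS k d ≃ₐ[k] MvPolynomial (Fin (d + 1)) (PolyR k d) :=
  (renameEquiv k (Equiv.sumComm _ _)).trans (sumAlgEquiv k (Fin (d + 1)) (Fin d))

theorem polyEquiv_X_inl (i : Fin d) : polyEquiv k d (X (Sum.inl i)) = C (X i) := by
  simp [polyEquiv]

theorem polyEquiv_X_inr (j : Fin (d + 1)) : polyEquiv k d (X (Sum.inr j)) = X j := by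
  simp [polyEquiv]

theorem polyEquiv_inclRS (a : PolyR k d) : polyEquiv k d (inclRS k d a) = C a := by
  have h : ((polyEquiv k d).toAlgHom.comp (inclRS k d)) =
      IsScalarTower.toAlgHom k (PolyR k d) (MvPolynomial (Fin (d + 1)) (PolyR k d)) := by
    ext i
    simp [inclRS, polyEquiv_X_inl, MvPolynomial.algebraMap_eq]
  exact DFunLike.congr_fun h a

theorem polyEquiv_symEq (φ : Matrix (Fin (d + 1)) (Fin d) (PolyR k d)) (j : Fin d) :
    polyEquiv k d (symEq φ j) = linForm φ j := by
  simp [symEq, linForm, polyEquiv_inclRS, polyEquiv_X_inr]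

theorem ofList_ofFn {A : Type*} [CommRing A] {n : ℕ} (g : Fin n → A) :
    Ideal.ofList (List.ofFn g) = Ideal.span (Set.range g) := by
  rw [Ideal.ofList]
  congr 1
  ext a
  simp [List.mem_ofFn]

theorem polyEquiv_mem_span_iff (φ : Matrix (Fin (d + 1)) (Fin d) (PolyR k d)) (F : PolyS k d) :
    polyEquiv k d F ∈ Ideal.span (Set.range (linForm φ)) ↔ F ∈ Ideal.span (Set.range (symEq φ)) := by
  have h : Ideal.span (Set.range (linForm φ)) =
      (Ideal.span (Set.range (symEq φ))).map (polyEquiv k d).toRingEquiv.toRingHom := by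
    rw [Ideal.map_span, ← Set.range_comp]
    congr 2
    ext1 j
    exact (polyEquiv_symEq φ j).symm
  rw [h]
  exact Ideal.mem_map_of_equiv (polyEquiv k d).toRingEquiv _ |>.trans
    ⟨fun ⟨x, hx, hxF⟩ => (polyEquiv k d).injective hxF ▸ hx, fun h => ⟨F, h, rfl⟩⟩

theorem isWeaklyRegular_symEq {f : Fin (d + 1) → PolyR k d}
    {φ : Matrix (Fin (d + 1)) (Fin d) (PolyR k d)} {δ : Fin d → ℕ} (hφ : IsResolutionMatrix f φ δ)
    (hf : idealOf f ≠ ⊥) (hG : SatisfiesG (idealOf f)) :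
    IsWeaklyRegular (PolyS k d) (List.ofFn (symEq φ)) := by
  have h := isWeaklyRegular_map_ringEquiv (polyEquiv k d).symm.toRingEquiv
    (isWeaklyRegular_linForm φ (le_rankAt_add_height hφ hf hG))
  rw [List.map_ofFn] at h
  have h1 : (polyEquiv k d).symm.toRingEquiv ∘ linForm φ = symEq φ :=
    _root_.funext fun j => (AlgEquiv.symm_apply_eq _).2 (polyEquiv_symEq φ j).symm
  rwa [h1] at h

/-- The map `R[T_1,…,T_n] → R[t]` with `T_i ↦ f_i t`. -/
def reesEval {R : Type*} [CommRing R] {n : ℕ} (f : Fin n → R) :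
    MvPolynomial (Fin n) R →ₐ[R] Polynomial R :=
  aeval fun j => Polynomial.C (f j) * Polynomial.X

theorem sum_C_mul_X_mem_of_dotProduct_eq_zero {R : Type*} [CommRing R] {n e : ℕ} {f : Fin n → R}
    {φ : Matrix (Fin n) (Fin e) R} (hφ : ∀ v, f ⬝ᵥ v = 0 → ∃ w, φ.mulVec w = v) {v : Fin n → R}
    (hv : f ⬝ᵥ v = 0) : ∑ i, C (v i) * X i ∈ Ideal.span (Set.range (linForm φ)) := by
  obtain ⟨w, rfl⟩ := hφ v hv
  have h : ∑ i, C (φ.mulVec w i) * X i = ∑ j, C (w j) * linForm φ j := by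
    simp only [Matrix.mulVec, dotProduct, map_sum, map_mul, linForm, Finset.sum_mul,
      Finset.mul_sum]
    rw [Finset.sum_comm]
    exact Finset.sum_congr rfl fun j _ => Finset.sum_congr rfl fun i _ => by ring
  rw [h]
  exact Ideal.sum_mem _ fun j _ => Ideal.mul_mem_left _ _ (Ideal.subset_span ⟨j, rfl⟩)

theorem reesEval_linForm {R : Type*} [CommRing R] {n e : ℕ} {f : Fin n → R}
    {φ : Matrix (Fin n) (Fin e) R} (hφ : ∀ w, f ⬝ᵥ φ.mulVec w = 0) (j : Fin e) :
    reesEval f (linForm φ j) = 0 := by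
  have h := hφ (Pi.single j 1)
  rw [Matrix.mulVec_single_one] at h
  have h2 : reesEval f (linForm φ j) = Polynomial.C (f ⬝ᵥ φ.col j) * Polynomial.X := by
    rw [linForm, map_sum, dotProduct, map_sum, Finset.sum_mul]
    refine Finset.sum_congr rfl fun i _ => ?_
    rw [map_mul, reesEval, aeval_X, aeval_C, Polynomial.algebraMap_eq, Matrix.col_apply, map_mul]
    ring
  rw [h2, h, map_zero, zero_mul]

theorem reesEval_eq_zero_of_mem {R : Type*} [CommRing R] {n e : ℕ} {f : Fin n → R}
    {φ : Matrix (Fin n) (Fin e) R} (hφ : ∀ w, f ⬝ᵥ φ.mulVec w = 0) {F : MvPolynomial (Fin n) R}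
    (hF : F ∈ Ideal.span (Set.range (linForm φ))) : reesEval f F = 0 := by
  have h : Ideal.span (Set.range (linForm φ)) ≤ RingHom.ker (reesEval f) := by
    rw [Ideal.span_le]
    rintro _ ⟨j, rfl⟩
    exact reesEval_linForm hφ j
  exact h hF

theorem exists_pow_mul_sub_aeval_mem {R : Type*} [CommRing R] {n e : ℕ} {f : Fin n → R}
    {φ : Matrix (Fin n) (Fin e) R} (hφ : ∀ v, f ⬝ᵥ v = 0 → ∃ w, φ.mulVec w = v) (i : Fin n)
    (F : MvPolynomial (Fin n) R) : ∃ (m : ℕ) (h : Polynomial R),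
      C (f i) ^ m * F - Polynomial.aeval (X i : MvPolynomial (Fin n) R) h ∈
        Ideal.span (Set.range (linForm φ)) := by
  set Q := Ideal.span (Set.range (linForm φ))
  induction F using MvPolynomial.induction_on with
  | C a => exact ⟨0, Polynomial.C a, by simp [MvPolynomial.algebraMap_eq]⟩
  | add F G hF hG =>
    obtain ⟨m, h, hm⟩ := hF
    obtain ⟨m', h', hm'⟩ := hG
    refine ⟨m + m', Polynomial.C (f i ^ m') * h + Polynomial.C (f i ^ m) * h', ?_⟩
    have := Ideal.add_mem _ (Ideal.mul_mem_left _ (C (f i) ^ m') hm)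
      (Ideal.mul_mem_left _ (C (f i) ^ m) hm')
    convert this using 1
    simp only [map_add, map_mul, Polynomial.aeval_C, MvPolynomial.algebraMap_eq, map_pow]
    ring
  | mul_X F j hF =>
    obtain ⟨m, h, hm⟩ := hF
    have hswap : C (f i) * X j - C (f j) * X i ∈ Q := by
      have := sum_C_mul_X_mem_of_dotProduct_eq_zero hφ
        (v := Pi.single j (f i) - Pi.single i (f j)) (by
          rw [dotProduct_sub, dotProduct_single, dotProduct_single, mul_comm, sub_self])
      convert this using 1
      simp [sub_mul, Finset.sum_sub_distrib, Pi.single_apply, apply_ite C]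
    refine ⟨m + 1, Polynomial.C (f j) * Polynomial.X * h, ?_⟩
    have := Ideal.add_mem _ (Ideal.mul_mem_left _ (C (f i) * X j) hm)
      (Ideal.mul_mem_left _ (Polynomial.aeval (X i : MvPolynomial (Fin n) R) h) hswap)
    convert this using 1
    simp only [map_mul, Polynomial.aeval_C, MvPolynomial.algebraMap_eq, Polynomial.aeval_X]
    ring

theorem exists_pow_mul_mem_of_reesEval_eq_zero {R : Type*} [CommRing R] [IsDomain R] {n e : ℕ}
    {f : Fin n → R} {φ : Matrix (Fin n) (Fin e) R}
    (hφ : ∀ v, f ⬝ᵥ v = 0 ↔ ∃ w, φ.mulVec w = v) {i : Fin n} (hi : f i ≠ 0)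
    {F : MvPolynomial (Fin n) R} (hF : reesEval f F = 0) :
    ∃ m : ℕ, C (f i) ^ m * F ∈ Ideal.span (Set.range (linForm φ)) := by
  obtain ⟨m, h, hm⟩ := exists_pow_mul_sub_aeval_mem (fun v hv => (hφ v).1 hv) i F
  have h0 := reesEval_eq_zero_of_mem (fun w => (hφ _).2 ⟨w, rfl⟩) hm
  rw [map_sub, map_mul, hF, mul_zero, zero_sub, neg_eq_zero, ← Polynomial.aeval_algHom_apply,
    reesEval, aeval_X] at h0
  have h1 : h.comp (Polynomial.C (f i) * Polynomial.X) = 0 := h0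
  rw [Polynomial.comp_C_mul_X_eq_zero_iff (mem_nonZeroDivisors_of_ne_zero hi)] at h1
  rw [h1, map_zero, sub_zero] at hm
  exact ⟨m, hm⟩

theorem reesEval_eq_zero_iff {f : Fin (d + 1) → PolyR k d}
    {φ : Matrix (Fin (d + 1)) (Fin d) (PolyR k d)} {δ : Fin d → ℕ} (hφ : IsResolutionMatrix f φ δ)
    (hf : idealOf f ≠ ⊥) (hG : SatisfiesG (idealOf f)) (hd : 0 < d)
    (F : MvPolynomial (Fin (d + 1)) (PolyR k d)) : reesEval f F = 0 ↔
      ∀ i : Fin d, ∃ N : ℕ, C (X i) ^ N * F ∈ Ideal.span (Set.range (linForm φ)) := by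
  constructor
  swap
  · intro h
    obtain ⟨N, hN⟩ := h ⟨0, hd⟩
    have h0 := reesEval_eq_zero_of_mem (fun w => (hφ.exact _).2 ⟨w, rfl⟩) hN
    rw [map_mul, map_pow, reesEval, aeval_C, Polynomial.algebraMap_eq] at h0
    exact (mul_eq_zero.1 h0).resolve_left (pow_ne_zero _ (Polynomial.C_ne_zero.2 (X_ne_zero _)))
  intro hF i
  obtain ⟨a, ha⟩ : ∃ a, f a ≠ 0 := by
    by_contra! h
    refine hf (Ideal.span_eq_bot.2 ?_)
    rintro _ ⟨a, rfl⟩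
    exact h a
  obtain ⟨m, hm⟩ := exists_pow_mul_mem_of_reesEval_eq_zero hφ.exact ha hF
  set Q := Ideal.span (Set.range (linForm φ)) with hQ
  set x : MvPolynomial (Fin (d + 1)) (PolyR k d) := C (X i)
  let Qs : Ideal (MvPolynomial (Fin (d + 1)) (PolyR k d)) :=
    { carrier := {a | ∃ N : ℕ, x ^ N * a ∈ Q}
      zero_mem' := ⟨0, by simp⟩
      add_mem' := by
        rintro a b ⟨N, hN⟩ ⟨M, hM⟩
        refine ⟨N + M, ?_⟩
        have := Ideal.add_mem _ (Ideal.mul_mem_left _ (x ^ M) hN) (Ideal.mul_mem_left _ (x ^ N) hM)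
        convert this using 1
        ring
      smul_mem' := by
        rintro c a ⟨N, hN⟩
        refine ⟨N, ?_⟩
        have := Ideal.mul_mem_left _ c hN
        convert this using 1
        rw [smul_eq_mul]
        ring }
  by_contra hcon
  obtain ⟨P, c, hP, hPc⟩ := exists_prime_forall_mem_iff Qs (s := F) hcon
  have hfg : ∃ N : ℕ, ∀ a ∈ P, x ^ N * (a * (c * F)) ∈ Q := by
    obtain ⟨t, ht⟩ := (isNoetherianRing_iff_ideal_fg _).1 inferInstance P
    have hN : ∀ a : MvPolynomial (Fin (d + 1)) (PolyR k d), ∃ N : ℕ, a ∈ P →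
        x ^ N * (a * (c * F)) ∈ Q := fun a => by
      by_cases haP : a ∈ P
      · obtain ⟨N, hN⟩ := (hPc a).1 haP
        exact ⟨N, fun _ => hN⟩
      · exact ⟨0, fun h => absurd h haP⟩
    choose N hN using hN
    refine ⟨t.sup N, fun a haP => ?_⟩
    rw [← ht] at haP
    induction haP using Submodule.span_induction with
    | mem a hat =>
      have h1 : a ∈ P := ht ▸ Ideal.subset_span hat
      obtain ⟨M, hM⟩ := Nat.exists_eq_add_of_le' (Finset.le_sup hat : N a ≤ t.sup N)
      rw [hM, pow_add, mul_assoc]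
      exact Ideal.mul_mem_left _ _ (hN a h1)
    | zero => simp
    | add a b _ _ hat hbt =>
      rw [add_mul, mul_add]
      exact Ideal.add_mem _ hat hbt
    | smul b a _ hat =>
      rw [smul_eq_mul, mul_assoc, mul_left_comm]
      exact Ideal.mul_mem_left _ _ hat
  obtain ⟨N, hN⟩ := hfg
  have hs : ∀ a, a ∈ P ↔ a * (x ^ N * (c * F)) ∈ Ideal.ofList (List.ofFn (linForm φ)) := by
    intro a
    rw [ofList_ofFn, mul_left_comm]
    exact ⟨hN a, fun h => (hPc a).2 ⟨N, h⟩⟩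
  have hx : x ∉ P := fun h => by
    obtain ⟨M, hM⟩ := (hPc x).1 h
    refine hP.ne_top ((Ideal.eq_top_iff_one _).2 ((hPc 1).2 ⟨M + 1, ?_⟩))
    rwa [one_mul, pow_succ, mul_assoc]
  have hfP : C (f a) ∈ P := by
    refine hP.mem_of_pow_mem m ((hPc _).2 ⟨0, ?_⟩)
    rw [pow_zero, one_mul, mul_left_comm]
    exact Ideal.mul_mem_left _ _ hm
  have hle := card_filter_add_height_le_length φ
    (isWeaklyRegular_linForm φ (le_rankAt_add_height hφ hf hG)) P (x ^ N * (c * F)) hs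
    (P.comap C) rfl d fun j _ => (hs _).2 (by
      rw [ofList_ofFn]
      exact Ideal.mul_mem_right _ _ (Ideal.subset_span ⟨j, rfl⟩))
  have hge := succ_le_rankAt_add_height hφ hG (P.comap C)
    (fun h => ha (by
      have h1 : f a ∈ P.comap C := hfP
      rwa [h, Ideal.mem_bot] at h1))
    (fun h => hx (by
      have h1 : (X i : PolyR k d) ∈ P.comap C := h ▸ Ideal.subset_span ⟨i, rfl⟩
      exact h1))
  have := hge.trans hle
  rw [List.length_ofFn, Nat.sub_self, Nat.cast_zero, add_zero, Nat.cast_le] at this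
  omega

/-! ### The presentation of the symmetric algebra -/

theorem symPresentation_X_inl (f : Fin (d + 1) → PolyR k d) (i : Fin d) :
    symPresentation f (X (Sum.inl i)) =
      algebraMap (PolyR k d) (SymmetricAlgebra (PolyR k d) (idealOf f)) (X i) :=
  eval₂_X _ _ _

theorem symPresentation_X_inr (f : Fin (d + 1) → PolyR k d) (j : Fin (d + 1)) :
    symPresentation f (X (Sum.inr j)) = SymmetricAlgebra.ι (PolyR k d) (idealOf f)
        ⟨f j, Ideal.subset_span (Set.mem_range_self j)⟩ :=
  eval₂_X _ _ _

theorem symPresentation_inclRS (f : Fin (d + 1) → PolyR k d) (a : PolyR k d) :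
    symPresentation f (inclRS k d a) =
      algebraMap (PolyR k d) (SymmetricAlgebra (PolyR k d) (idealOf f)) a := by
  have h : (symPresentation f).comp (inclRS k d).toRingHom =
      algebraMap (PolyR k d) (SymmetricAlgebra (PolyR k d) (idealOf f)) := by
    refine MvPolynomial.ringHom_ext (fun c => ?_) fun i => ?_
    · change symPresentation f (inclRS k d (C c)) = _
      rw [inclRS, rename_C, symPresentation]
      exact eval₂_C _ _ _
    · change symPresentation f (inclRS k d (X i)) = _
      rw [inclRS, rename_X]
      exact symPresentation_X_inl f i
  exact DFunLike.congr_fun h a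

theorem symPresentation_surjective (f : Fin (d + 1) → PolyR k d) :
    Function.Surjective (symPresentation f) := by
  intro y
  change SymmetricAlgebra (PolyR k d) (idealOf f) at y
  change ∃ F, symPresentation f F = y
  induction y using SymmetricAlgebra.induction with
  | algebraMap a => exact ⟨_, symPresentation_inclRS f a⟩
  | ι x =>
    obtain ⟨x, hx⟩ := x
    induction hx using Submodule.span_induction with
    | mem x hx =>
      obtain ⟨j, rfl⟩ := hx
      exact ⟨_, symPresentation_X_inr f j⟩
    | zero => exact ⟨0, (map_zero _).trans (map_zero (SymmetricAlgebra.ι _ _)).symm⟩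
    | add x y hx hy h1 h2 =>
      obtain ⟨F, hF⟩ := h1
      obtain ⟨G, hG⟩ := h2
      refine ⟨F + G, (map_add _ _ _).trans ?_⟩
      rw [hF, hG]
      exact (map_add (SymmetricAlgebra.ι _ _) (⟨x, hx⟩ : idealOf f) ⟨y, hy⟩).symm
    | smul a x hx h =>
      obtain ⟨F, hF⟩ := h
      refine ⟨inclRS k d a * F, (map_mul _ _ _).trans ?_⟩
      rw [hF, symPresentation_inclRS]
      refine Eq.trans ?_ (map_smul (SymmetricAlgebra.ι _ _) a (⟨x, hx⟩ : idealOf f)).symm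
      rw [Algebra.smul_def]
      rfl
  | mul x y hx hy =>
    obtain ⟨F, hF⟩ := hx
    obtain ⟨G, hG⟩ := hy
    exact ⟨F * G, (map_mul _ _ _).trans (by rw [hF, hG]; rfl)⟩
  | add x y hx hy =>
    obtain ⟨F, hF⟩ := hx
    obtain ⟨G, hG⟩ := hy
    exact ⟨F + G, (map_add _ _ _).trans (by rw [hF, hG]; rfl)⟩

theorem symPresentation_symEq {f : Fin (d + 1) → PolyR k d}
    {φ : Matrix (Fin (d + 1)) (Fin d) (PolyR k d)} {δ : Fin d → ℕ} (hφ : IsResolutionMatrix f φ δ)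
    (j : Fin d) : symPresentation f (symEq φ j) = 0 := by
  have h0 : f ⬝ᵥ φ.col j = 0 := (hφ.exact _).2 ⟨Pi.single j 1, Matrix.mulVec_single_one φ j⟩
  have h1 : ∑ i, φ i j • (⟨f i, Ideal.subset_span (Set.mem_range_self i)⟩ : idealOf f) = 0 := by
    refine Subtype.ext (Eq.trans ?_ h0)
    rw [dotProduct, AddSubmonoidClass.coe_finsetSum]
    exact Finset.sum_congr rfl fun i _ => mul_comm _ _
  have h2 := congrArg (SymmetricAlgebra.ι (PolyR k d) (idealOf f)) h1
  rw [map_sum, map_zero] at h2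
  refine Eq.trans ?_ h2
  rw [symEq, map_sum]
  refine Finset.sum_congr rfl fun i _ => ?_
  rw [map_mul, symPresentation_inclRS, symPresentation_X_inr, map_smul, Algebra.smul_def]
  rfl

theorem symPresentation_eq_zero_iff {f : Fin (d + 1) → PolyR k d}
    {φ : Matrix (Fin (d + 1)) (Fin d) (PolyR k d)} {δ : Fin d → ℕ} (hφ : IsResolutionMatrix f φ δ)
    (F : PolyS k d) : symPresentation f F = 0 ↔ F ∈ Ideal.span (Set.range (symEq φ)) := by
  constructor
  swap
  · intro hF
    have h : Ideal.span (Set.range (symEq φ)) ≤ RingHom.ker (symPresentation f) := by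
      rw [Ideal.span_le]
      rintro _ ⟨j, rfl⟩
      exact symPresentation_symEq hφ j
    exact h hF
  intro hF
  set Q := Ideal.span (Set.range (linForm φ)) with hQ
  let B := MvPolynomial (Fin (d + 1)) (PolyR k d) ⧸ Q
  let π : (Fin (d + 1) → PolyR k d) →ₗ[PolyR k d] idealOf f :=
    (dotMap f).codRestrict (idealOf f) fun v => by
      have : dotMap f v ∈ LinearMap.range (dotMap f) := ⟨v, rfl⟩
      rwa [range_dotMap] at this
  have hπ : Function.Surjective π := by
    rintro ⟨x, hx⟩
    have hx' : x ∈ Ideal.span (Set.range f) := hx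
    rw [← range_dotMap] at hx'
    obtain ⟨v, hv⟩ := hx'
    exact ⟨v, Subtype.ext hv⟩
  let ψ : (Fin (d + 1) → PolyR k d) →ₗ[PolyR k d] B :=
    Fintype.linearCombination (PolyR k d) fun i => (Ideal.Quotient.mk Q (X i) : B)
  have hψ : ∀ v, ψ v = Ideal.Quotient.mk Q (∑ i, C (v i) * X i) := by
    intro v
    rw [Fintype.linearCombination_apply, map_sum]
    refine Finset.sum_congr rfl fun i _ => ?_
    rw [← smul_eq_C_mul]
    rfl
  have hker : LinearMap.ker π ≤ LinearMap.ker ψ := by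
    intro v hv
    rw [LinearMap.mem_ker, hψ, Ideal.Quotient.eq_zero_iff_mem]
    refine sum_C_mul_X_mem_of_dotProduct_eq_zero (fun v hv => (hφ.exact v).1 hv) ?_
    rw [← dotMap_apply]
    exact congrArg Subtype.val hv
  let lam : idealOf f →ₗ[PolyR k d] B :=
    (LinearMap.ker π).liftQ ψ hker ∘ₗ (π.quotKerEquivOfSurjective hπ).symm.toLinearMap
  have hlam : ∀ v, lam (π v) = ψ v := by
    intro v
    have : (π.quotKerEquivOfSurjective hπ).symm (π v) = Submodule.Quotient.mk v := by
      rw [LinearEquiv.symm_apply_eq]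
      rfl
    change (LinearMap.ker π).liftQ ψ hker ((π.quotKerEquivOfSurjective hπ).symm (π v)) = _
    rw [this]
    exact Submodule.liftQ_apply _ _ _
  let γ : SymmetricAlgebra (PolyR k d) (idealOf f) →ₐ[PolyR k d] B := SymmetricAlgebra.lift lam
  have hγ : γ.toRingHom.comp (symPresentation f) =
      (Ideal.Quotient.mk Q).comp (polyEquiv k d).toRingEquiv.toRingHom := by
    refine MvPolynomial.ringHom_ext (fun c => ?_) fun i => ?_
    · have h1 : (C c : PolyS k d) = inclRS k d (C c) := (rename_C _ _).symm
      change γ (symPresentation f (C c)) = Ideal.Quotient.mk Q (polyEquiv k d (C c))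
      rw [h1, symPresentation_inclRS, polyEquiv_inclRS]
      exact γ.commutes _
    · rcases i with i | j
      · change γ (symPresentation f (X (Sum.inl i))) =
          Ideal.Quotient.mk Q (polyEquiv k d (X (Sum.inl i)))
        rw [symPresentation_X_inl, polyEquiv_X_inl]
        exact γ.commutes _
      · change γ (symPresentation f (X (Sum.inr j))) =
          Ideal.Quotient.mk Q (polyEquiv k d (X (Sum.inr j)))
        rw [symPresentation_X_inr, polyEquiv_X_inr]
        refine (SymmetricAlgebra.lift_ι_apply lam _).trans ?_
        have h1 : (⟨f j, Ideal.subset_span (Set.mem_range_self j)⟩ : idealOf f) =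
            π (Pi.single j 1) := by
          ext1
          change f j = dotMap f (Pi.single j 1)
          rw [dotMap_apply, dotProduct_single, mul_one]
        rw [h1, hlam, hψ]
        congr 1
        simp [Pi.single_apply, apply_ite C]
  have h1 : Ideal.Quotient.mk Q (polyEquiv k d F) = 0 := by
    have := DFunLike.congr_fun hγ F
    refine this.symm.trans ?_
    change γ (symPresentation f F) = 0
    rw [hF]
    exact map_zero γ
  rw [Ideal.Quotient.eq_zero_iff_mem] at h1
  exact (polyEquiv_mem_span_iff φ F).1 h1

theorem alphaI_symPresentation (f : Fin (d + 1) → PolyR k d) (F : PolyS k d) :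
    (alphaI f (symPresentation f F) : Polynomial (PolyR k d)) = reesEval f (polyEquiv k d F) := by
  have h : ((reesAlgebra (idealOf f)).val.toRingHom.comp (alphaI f)).comp (symPresentation f) =
      (reesEval f).toRingHom.comp (polyEquiv k d).toRingEquiv.toRingHom := by
    refine MvPolynomial.ringHom_ext (fun c => ?_) fun i => ?_
    · have h1 : (C c : PolyS k d) = inclRS k d (C c) := (rename_C _ _).symm
      change (symToRees (idealOf f) (symPresentation f (C c)) : Polynomial (PolyR k d)) =
        reesEval f (polyEquiv k d (C c))
      rw [h1, symPresentation_inclRS, polyEquiv_inclRS, AlgHom.commutes, reesEval, aeval_C]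
      rfl
    · rcases i with i | j
      · change (symToRees (idealOf f) (symPresentation f (X (Sum.inl i))) :
          Polynomial (PolyR k d)) = reesEval f (polyEquiv k d (X (Sum.inl i)))
        rw [symPresentation_X_inl, polyEquiv_X_inl, AlgHom.commutes, reesEval, aeval_C]
        rfl
      · change (symToRees (idealOf f) (symPresentation f (X (Sum.inr j))) :
          Polynomial (PolyR k d)) = reesEval f (polyEquiv k d (X (Sum.inr j)))
        rw [symPresentation_X_inr, polyEquiv_X_inr, reesEval, aeval_X, symToRees,
          SymmetricAlgebra.lift_ι_apply, Polynomial.C_mul_X_eq_monomial]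
        rfl
  exact DFunLike.congr_fun h F

theorem symPresentation_mem_kernelK_iff {f : Fin (d + 1) → PolyR k d}
    {φ : Matrix (Fin (d + 1)) (Fin d) (PolyR k d)} {δ : Fin d → ℕ} (hφ : IsResolutionMatrix f φ δ)
    (hf : idealOf f ≠ ⊥) (hG : SatisfiesG (idealOf f)) (hd : 0 < d) (F : PolyS k d) :
    symPresentation f F ∈ kernelK f ↔
      ∀ i : Fin d, ∃ N : ℕ, X (Sum.inl i) ^ N * F ∈ Ideal.span (Set.range (symEq φ)) := by
  have h1 : symPresentation f F ∈ kernelK f ↔ reesEval f (polyEquiv k d F) = 0 := by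
    rw [← alphaI_symPresentation]
    exact ⟨fun h => congrArg Subtype.val h, fun h => Subtype.ext h⟩
  rw [h1, reesEval_eq_zero_iff hφ hf hG hd]
  refine forall_congr' fun i => exists_congr fun N => ?_
  rw [← polyEquiv_mem_span_iff, map_mul, map_pow, polyEquiv_X_inl]

end Equations

/-! ### Gradings -/

theorem isInternal_of_forall_sum {M ι : Type*} [AddCommGroup M] [DecidableEq ι]
    (𝓜 : ι → AddSubgroup M)
    (hsum : ∀ m, ∃ (s : Finset ι) (c : ι → M), (∀ i, c i ∈ 𝓜 i) ∧ m = ∑ i ∈ s, c i)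
    (hzero : ∀ (s : Finset ι) (c : ι → M), (∀ i, c i ∈ 𝓜 i) → ∑ i ∈ s, c i = 0 →
      ∀ i ∈ s, c i = 0) : DirectSum.IsInternal 𝓜 := by
  classical
  constructor
  · rw [injective_iff_map_eq_zero]
    intro x hx
    rw [DirectSum.coeAddMonoidHom_eq_dfinsuppSum, DFinsupp.sum] at hx
    have h := hzero _ (fun i => (x i : M)) (fun i => (x i).2) hx
    refine DFinsupp.ext fun i => ?_
    by_contra hi
    exact hi (Subtype.ext (h i (DFinsupp.mem_support_iff.2 hi)))
  · intro m
    obtain ⟨s, c, hc, rfl⟩ := hsum m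
    refine ⟨∑ i ∈ s, DirectSum.of (fun i => 𝓜 i) i ⟨c i, hc i⟩, ?_⟩
    rw [map_sum]
    exact Finset.sum_congr rfl fun i _ => DirectSum.coeAddMonoidHom_of 𝓜 i _

theorem exists_sum_homogeneous {k : Type u} [CommRing k] {σ G : Type*} [AddCommGroup G]
    [DecidableEq G] (w : σ → G) (p : MvPolynomial σ k) :
    ∃ s : Finset G, p = ∑ n ∈ s, weightedHomogeneousComponent w n p := by
  refine ⟨(weightedHomogeneousComponent_finsupp (w := w) p).toFinset, ?_⟩
  conv_lhs => rw [← sum_weightedHomogeneousComponent w p]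
  exact finsum_eq_sum _ _

theorem weightedHomogeneousComponent_sum {k : Type u} [CommRing k] {σ G : Type*} [AddCommGroup G]
    [DecidableEq G] (w : σ → G) (s : Finset G) (c : G → MvPolynomial σ k)
    (hc : ∀ n, IsWeightedHomogeneous w (c n) n) {n : G} (hn : n ∈ s) :
    weightedHomogeneousComponent w n (∑ m ∈ s, c m) = c n := by
  rw [map_sum, Finset.sum_eq_single n]
  · exact (hc n).weightedHomogeneousComponent_same
  · intro m _ hm
    exact (hc m).weightedHomogeneousComponent_ne n hm.symm
  · exact fun h => absurd hn h

theorem weightedHomogeneousComponent_mul {k : Type u} [CommRing k] {σ G : Type*} [AddCommGroup G]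
    (w : σ → G) {q : MvPolynomial σ k} {m : G} (hq : IsWeightedHomogeneous w q m)
    (p : MvPolynomial σ k) (n : G) :
    weightedHomogeneousComponent w (m + n) (q * p) = q * weightedHomogeneousComponent w n p := by
  classical
  obtain ⟨s, hs⟩ := exists_sum_homogeneous w p
  have hadd : ∀ c, weightedHomogeneousComponent w (m + n)
      (q * weightedHomogeneousComponent w c p) =
        q * weightedHomogeneousComponent w n (weightedHomogeneousComponent w c p) := by
    intro c
    have h1 := weightedHomogeneousComponent_isWeightedHomogeneous (w := w) c p
    by_cases hc : c = n
    · subst hc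
      rw [(hq.mul h1).weightedHomogeneousComponent_same, h1.weightedHomogeneousComponent_same]
    · rw [(hq.mul h1).weightedHomogeneousComponent_ne _ (fun h => hc (add_left_cancel h).symm),
        h1.weightedHomogeneousComponent_ne _ (Ne.symm hc), mul_zero]
  rw [hs, Finset.mul_sum, map_sum, map_sum, Finset.mul_sum]
  exact Finset.sum_congr rfl fun c _ => hadd c

theorem weightedHomogeneousComponent_mem_span {k : Type u} [CommRing k] {σ G ι : Type*}
    [AddCommGroup G] (w : σ → G) {g : ι → MvPolynomial σ k} {δ : ι → G}
    (hg : ∀ j, IsWeightedHomogeneous w (g j) (δ j)) {p : MvPolynomial σ k}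
    (hp : p ∈ Ideal.span (Set.range g)) (n : G) :
    weightedHomogeneousComponent w n p ∈ Ideal.span (Set.range g) := by
  induction hp using Submodule.span_induction generalizing n with
  | mem p hp =>
    obtain ⟨j, rfl⟩ := hp
    by_cases h : δ j = n
    · subst h
      rw [(hg j).weightedHomogeneousComponent_same]
      exact Ideal.subset_span ⟨j, rfl⟩
    · rw [(hg j).weightedHomogeneousComponent_ne _ (Ne.symm h)]
      exact zero_mem _
  | zero => rw [map_zero]; exact zero_mem _
  | add p q _ _ hp hq => rw [map_add]; exact add_mem (hp n) (hq n)
  | smul a p _ hp =>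
    classical
    obtain ⟨s, hs⟩ := exists_sum_homogeneous w a
    rw [smul_eq_mul, hs, Finset.sum_mul, map_sum]
    refine sum_mem fun c _ => ?_
    rw [show n = c + (n - c) by abel, weightedHomogeneousComponent_mul w
      (weightedHomogeneousComponent_isWeightedHomogeneous (w := w) c a)]
    exact Ideal.mul_mem_left _ _ (hp _)

section Bigraded

variable {k : Type u} [Field k] {d : ℕ}

theorem weight_rename_inl (α : Fin d →₀ ℕ) :
    Finsupp.weight (bidegWeight d) (α.mapDomain Sum.inl) = ((0 : ℤ), (α.degree : ℤ)) := by
  induction α using Finsupp.induction_linear with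
  | zero => simpa using Prod.mk_zero_zero.symm
  | add a b ha hb =>
    rw [Finsupp.mapDomain_add, map_add, ha, hb, map_add]
    simp
  | single i n =>
    rw [Finsupp.mapDomain_single, Finsupp.weight_single]
    simp [bidegWeight]

theorem inclRS_isWeightedHomogeneous {a : PolyR k d} {n : ℕ} (ha : a.IsHomogeneous n) :
    IsWeightedHomogeneous (bidegWeight d) (inclRS k d a) ((0 : ℤ), (n : ℤ)) := by
  intro β hβ
  rw [inclRS] at hβ
  obtain ⟨α, rfl, hα⟩ := coeff_rename_ne_zero _ _ _ hβ
  have h := ha hα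
  rw [weight_rename_inl, Finsupp.degree_eq_weight_one]
  exact congrArg (fun m : ℕ => ((0 : ℤ), (m : ℤ))) h

theorem symEq_isWeightedHomogeneous {φ : Matrix (Fin (d + 1)) (Fin d) (PolyR k d)} {δ : Fin d → ℕ}
    (hφ : ∀ i j, (φ i j).IsHomogeneous (δ j)) (j : Fin d) :
    IsWeightedHomogeneous (bidegWeight d) (symEq φ j) ((1 : ℤ), (δ j : ℤ)) := by
  refine IsWeightedHomogeneous.sum _ _ _ fun i _ => ?_
  have h := (inclRS_isWeightedHomogeneous (hφ i j)).mul
    (isWeightedHomogeneous_X k (bidegWeight d) (Sum.inr i))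
  convert h using 1
  simp [bidegWeight]

theorem component_mem_kernelK {f : Fin (d + 1) → PolyR k d}
    {φ : Matrix (Fin (d + 1)) (Fin d) (PolyR k d)} {δ : Fin d → ℕ} (hφ : IsResolutionMatrix f φ δ)
    (hf : idealOf f ≠ ⊥) (hG : SatisfiesG (idealOf f)) (hd : 0 < d) {F : PolyS k d}
    (hF : symPresentation f F ∈ kernelK f) (n : ℤ × ℤ) :
    symPresentation f (weightedHomogeneousComponent (bidegWeight d) n F) ∈ kernelK f := by
  rw [symPresentation_mem_kernelK_iff hφ hf hG hd] at hF ⊢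
  intro i
  obtain ⟨N, hN⟩ := hF i
  refine ⟨N, ?_⟩
  rw [← weightedHomogeneousComponent_mul _
    ((isWeightedHomogeneous_X k (bidegWeight d) (Sum.inl i)).pow N)]
  exact weightedHomogeneousComponent_mem_span _ (symEq_isWeightedHomogeneous hφ.homogeneous) hN _

theorem isBigraded_gradeK {f : Fin (d + 1) → PolyR k d}
    {φ : Matrix (Fin (d + 1)) (Fin d) (PolyR k d)} {δ : Fin d → ℕ} (hφ : IsResolutionMatrix f φ δ)
    (hf : idealOf f ≠ ⊥) (hG : SatisfiesG (idealOf f)) (hd : 0 < d) :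
    IsBigraded (k := k) (d := d) (gradeK f) where
  isInternal := by
    refine isInternal_of_forall_sum _ ?_ ?_
    · rintro ⟨m, hm⟩
      obtain ⟨F, rfl⟩ := symPresentation_surjective f m
      obtain ⟨s, hs⟩ := exists_sum_homogeneous (bidegWeight d) F
      refine ⟨s, fun n => ⟨_, component_mem_kernelK hφ hf hG hd hm n⟩, fun n => ?_, ?_⟩
      · exact ⟨_, weightedHomogeneousComponent_isWeightedHomogeneous n F, rfl⟩
      · refine Subtype.ext ?_
        rw [AddSubmonoidClass.coe_finsetSum]
        change symPresentation f F = _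
        conv_lhs => rw [hs, map_sum]
    · intro s c hc hsum n hn
      choose F hF hFc using hc
      have h1 : symPresentation f (∑ m ∈ s, F m) = 0 := by
        have := congrArg Subtype.val hsum
        rw [AddSubmonoidClass.coe_finsetSum] at this
        rw [map_sum]
        exact (Finset.sum_congr rfl fun m _ => hFc m).trans this
      rw [symPresentation_eq_zero_iff hφ] at h1
      have h2 := weightedHomogeneousComponent_mem_span _
        (symEq_isWeightedHomogeneous hφ.homogeneous) h1 n
      rw [weightedHomogeneousComponent_sum _ _ _ hF hn, ← symPresentation_eq_zero_iff hφ] at h2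
      exact Subtype.ext ((hFc n).symm.trans h2)
  smul_mem := by
    rintro a b s ⟨m, hm⟩ hs ⟨F, hF, hFm⟩
    refine ⟨s * F, IsWeightedHomogeneous.mul hs hF, ?_⟩
    exact (map_mul (symPresentation f) s F).trans (congrArg (symPresentation f s * ·) hFm)

theorem twistedAct_X_isWeightedHomogeneous (v : Fin d ⊕ Fin (d + 1)) {h : PolyS k d} {n : ℤ × ℤ}
    (hh : IsWeightedHomogeneous (twistWeight d) h n) :
    IsWeightedHomogeneous (twistWeight d) (twistedAct k (X v) h) (bidegWeight d v + n) := by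
  rcases v with i | j
  · rw [twistedAct_X_inl]
    refine hh.pderiv ?_
    rw [add_right_comm]
    simp [bidegWeight, twistWeight]
  · rw [twistedAct_X_inr]
    exact (isWeightedHomogeneous_X k (twistWeight d) (Sum.inr j)).mul hh

theorem twistedAct_monomial_isWeightedHomogeneous (α : Fin d ⊕ Fin (d + 1) →₀ ℕ) (c : k)
    {h : PolyS k d} {n : ℤ × ℤ} (hh : IsWeightedHomogeneous (twistWeight d) h n) :
    IsWeightedHomogeneous (twistWeight d) (twistedAct k (monomial α c) h)
      (Finsupp.weight (bidegWeight d) α + n) := by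
  induction α using Finsupp.induction_linear generalizing c h n with
  | zero =>
    rw [map_zero, zero_add]
    change IsWeightedHomogeneous _ (twistedAct k (C c) h) n
    rw [show (C c : PolyS k d) = algebraMap k _ c from rfl, AlgHom.commutes,
      Module.algebraMap_end_apply]
    exact (weightedHomogeneousSubmodule k (twistWeight d) n).smul_mem c hh
  | add a b ha hb =>
    rw [← one_mul c, ← monomial_mul, map_mul, Module.End.mul_apply, map_add, add_assoc]
    exact ha 1 (hb c hh)
  | single v m =>
    rw [← mul_one c, ← C_mul_monomial, map_mul, Module.End.mul_apply, ← X_pow_eq_monomial, map_pow,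
      show (C c : PolyS k d) = algebraMap k _ c from rfl, AlgHom.commutes,
      Module.algebraMap_end_apply]
    refine (weightedHomogeneousSubmodule k (twistWeight d) _).smul_mem c ?_
    rw [Finsupp.weight_single]
    induction m with
    | zero => simpa using hh
    | succ m ih =>
      have h1 := twistedAct_X_isWeightedHomogeneous v ih
      rwa [← add_assoc, ← succ_nsmul', ← Module.End.mul_apply, ← pow_succ'] at h1

theorem twistedAct_isWeightedHomogeneous {s h : PolyS k d} {a n : ℤ × ℤ}
    (hs : IsWeightedHomogeneous (bidegWeight d) s a)
    (hh : IsWeightedHomogeneous (twistWeight d) h n) :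
    IsWeightedHomogeneous (twistWeight d) (twistedAct k s h) (a + n) := by
  rw [s.as_sum, map_sum, LinearMap.sum_apply]
  refine IsWeightedHomogeneous.sum _ _ _ fun α hα => ?_
  rw [← hs (mem_support_iff.1 hα)]
  exact twistedAct_monomial_isWeightedHomogeneous α _ hh

theorem mem_solF {g : Fin d → PolyS k d} {h : TwistS k d} :
    h ∈ solF g ↔ ∀ j, twistedAct k (g j) (TwistS.toS k d h) = 0 := Iff.rfl

theorem component_mem_solF {g : Fin d → PolyS k d} {δ : Fin d → ℤ × ℤ}
    (hg : ∀ j, IsWeightedHomogeneous (bidegWeight d) (g j) (δ j)) {h : PolyS k d}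
    (hh : (TwistS.toS k d).symm h ∈ solF g) (n : ℤ × ℤ) :
    (TwistS.toS k d).symm (weightedHomogeneousComponent (twistWeight d) n h) ∈ solF g := by
  rw [mem_solF] at hh ⊢
  intro j
  rw [AddEquiv.apply_symm_apply]
  have h0 : twistedAct k (g j) h = 0 := hh j
  obtain ⟨s, hs⟩ := exists_sum_homogeneous (twistWeight d) h
  have hhom : ∀ c, IsWeightedHomogeneous (twistWeight d)
      (twistedAct k (g j) (weightedHomogeneousComponent (twistWeight d) c h)) (δ j + c) := fun c =>
    twistedAct_isWeightedHomogeneous (hg j) (weightedHomogeneousComponent_isWeightedHomogeneous c h)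
  by_cases hn : n ∈ s
  · rw [hs, map_sum] at h0
    have h1 := congrArg (weightedHomogeneousComponent (twistWeight d) (δ j + n)) h0
    rw [map_sum, map_zero, Finset.sum_eq_single n] at h1
    · rwa [(hhom n).weightedHomogeneousComponent_same] at h1
    · intro c _ hc
      exact (hhom c).weightedHomogeneousComponent_ne _ fun h => hc (add_left_cancel h).symm
    · exact fun h => absurd hn h
  · have h1 : weightedHomogeneousComponent (twistWeight d) n h = 0 := by
      rw [hs, map_sum]
      refine Finset.sum_eq_zero fun c hc => ?_
      exact (weightedHomogeneousComponent_isWeightedHomogeneous c h).weightedHomogeneousComponent_ne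
        n fun h => hn (h ▸ hc)
    rw [h1, map_zero]

theorem isBigraded_shift_gradeSol {g : Fin d → PolyS k d} {δ : Fin d → ℤ × ℤ}
    (hg : ∀ j, IsWeightedHomogeneous (bidegWeight d) (g j) (δ j)) (a : ℤ × ℤ) :
    IsBigraded (k := k) (d := d) (shift (gradeSol g) a) where
  isInternal := by
    refine isInternal_of_forall_sum _ ?_ ?_
    · rintro ⟨h, hh⟩
      obtain ⟨s, hs⟩ := exists_sum_homogeneous (twistWeight d) (TwistS.toS k d h)
      refine ⟨s.map (Equiv.addLeft (-a)).toEmbedding,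
        fun n => ⟨_, component_mem_solF hg hh (a + n)⟩, fun n => ?_, ?_⟩
      · exact weightedHomogeneousComponent_isWeightedHomogeneous (a + n) (TwistS.toS k d h)
      · refine Subtype.ext ((TwistS.toS k d).injective ?_)
        rw [AddSubmonoidClass.coe_finsetSum, map_sum, Finset.sum_map]
        refine hs.trans (Finset.sum_congr rfl fun n _ => ?_)
        change _ = weightedHomogeneousComponent (twistWeight d) (a + (-a + n)) (TwistS.toS k d h)
        rw [add_neg_cancel_left]
    · intro s c hc hsum n hn
      have h1 := congrArg (fun x : solF g => weightedHomogeneousComponent (twistWeight d) (a + n)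
        (TwistS.toS k d x)) hsum
      beta_reduce at h1
      rw [AddSubmonoidClass.coe_finsetSum, map_sum, map_sum, Finset.sum_eq_single n] at h1
      · refine Subtype.ext ((TwistS.toS k d).injective (Eq.trans ?_ (h1.trans ?_)))
        · exact (IsWeightedHomogeneous.weightedHomogeneousComponent_same (hc n)).symm
        · exact map_zero _
      · intro m _ hm
        exact IsWeightedHomogeneous.weightedHomogeneousComponent_ne _ (hc m)
          fun h => hm (add_left_cancel h).symm
      · exact fun h => absurd hn h
  smul_mem := by
    intro b c s m hs hm
    have h1 : IsWeightedHomogeneous (twistWeight d)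
        (twistedAct k s (TwistS.toS k d m)) (b + (a + c)) :=
      twistedAct_isWeightedHomogeneous hs hm
    rw [add_left_comm] at h1
    exact h1

/-- An isomorphism of graded groups that preserves degrees in one direction does so in both. -/
theorem mem_iff_of_isInternal {M N : Type*} [AddCommGroup M] [AddCommGroup N] {ι : Type*}
    [DecidableEq ι] {𝓜 : ι → AddSubgroup M} {𝓝 : ι → AddSubgroup N}
    (hM : DirectSum.IsInternal 𝓜) (hN : DirectSum.IsInternal 𝓝) (e : M ≃+ N)
    (he : ∀ a m, m ∈ 𝓜 a → e m ∈ 𝓝 a) (a : ι) (m : M) : m ∈ 𝓜 a ↔ e m ∈ 𝓝 a := by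
  refine ⟨he a m, fun hm => ?_⟩
  let _ := hM.chooseDecomposition
  let _ := hN.chooseDecomposition
  have h : ∀ m i, (DirectSum.decompose 𝓝 (e m) i : N) = e (DirectSum.decompose 𝓜 m i) := by
    intro m i
    induction m using DirectSum.Decomposition.inductionOn 𝓜 with
    | zero => simp
    | @homogeneous j z =>
      rw [DirectSum.decompose_of_mem 𝓝 (he j z z.2), DirectSum.decompose_coe,
        DirectSum.coe_of_apply, DirectSum.coe_of_apply]
      split_ifs
      · rfl
      · simp
    | add x y hx hy =>
      rw [map_add, DirectSum.decompose_add, DirectSum.decompose_add, DirectSum.add_apply,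
        DirectSum.add_apply, AddSubgroup.coe_add, AddSubgroup.coe_add, hx, hy, map_add]
  have h1 := h m a
  rw [DirectSum.decompose_of_mem_same 𝓝 hm] at h1
  rw [e.injective h1]
  exact (DirectSum.decompose 𝓜 m a).2

end Bigraded

/-! ### Inverse polynomials -/

section Inverse

variable {k : Type u} [Field k] {d : ℕ}

/-- The rank of the variables: `x_i` has rank `i` and the `T_j` have rank `d`. -/
def varRank (d : ℕ) : Fin d ⊕ Fin (d + 1) → ℕ := Sum.elim (fun i => i) fun _ => d

theorem exists_varRank_eq (l : ℕ) (hl : l < d) : ∃ v₀, ∀ v, varRank d v = l ↔ v = v₀ := by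
  refine ⟨Sum.inl ⟨l, hl⟩, ?_⟩
  rintro (i | j)
  · simp [varRank, Fin.ext_iff]
  · simp [varRank]
    omega

/-- The exponent of `x^{-α-1} T^β`. -/
def invExp (α : Fin d ⊕ Fin (d + 1) →₀ ℕ) : Fin d ⊕ Fin (d + 1) → ℤ :=
  Sum.elim (fun i => -(α (Sum.inl i) : ℤ) - 1) fun j => α (Sum.inr j)

theorem invExp_injective : Function.Injective (invExp (d := d)) := by
  intro α β h
  ext v
  have h1 := congrFun h v
  rcases v with i | j
  · simp only [invExp, Sum.elim_inl] at h1
    omega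
  · simp only [invExp, Sum.elim_inr] at h1
    omega

theorem invExp_mem_localExp (α : Fin d ⊕ Fin (d + 1) →₀ ℕ) :
    invExp α ∈ localExp (varRank d) d := by
  rintro (i | j) h
  · exact i.2
  · simp only [invExp, Sum.elim_inr] at h
    omega

theorem invExp_notMem_partialExp (α : Fin d ⊕ Fin (d + 1) →₀ ℕ) (m : ℕ) :
    invExp α ∉ partialExp (varRank d) d m := by
  rintro ⟨-, i | j, h, h0⟩
  · simp only [invExp, Sum.elim_inl] at h0
    omega
  · simp [varRank] at h

theorem mem_partialExp_or_eq_invExp {e : Fin d ⊕ Fin (d + 1) → ℤ}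
    (he : e ∈ localExp (varRank d) d) : e ∈ partialExp (varRank d) d d ∨ ∃ α, e = invExp α := by
  by_cases h : ∃ i : Fin d, 0 ≤ e (Sum.inl i)
  · obtain ⟨i, hi⟩ := h
    exact Or.inl ⟨he, Sum.inl i, i.2, hi⟩
  · right
    push Not at h
    refine ⟨Finsupp.equivFunOnFinite.symm
      (Sum.elim (fun i => (-e (Sum.inl i) - 1).toNat) fun j => (e (Sum.inr j)).toNat), ?_⟩
    ext v
    rcases v with i | j
    · have := h i
      simp [invExp]
      omega
    · have : 0 ≤ e (Sum.inr j) := by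
        by_contra h1
        have h2 := he (Sum.inr j) (not_le.1 h1)
        simp [varRank] at h2
      simp [invExp]
      omega

theorem expDegree_invExp (α : Fin d ⊕ Fin (d + 1) →₀ ℕ) :
    expDegree (bidegWeight d) (invExp α) =
      Finsupp.weight (twistWeight d) α - ((0 : ℤ), (d : ℤ)) := by
  rw [Finsupp.weight_apply, Finsupp.sum_fintype _ _ (by simp)]
  change ∑ v, invExp α v • bidegWeight d v = _
  rw [Fintype.sum_sum_type, Fintype.sum_sum_type]
  ext
  · simp [invExp, bidegWeight, twistWeight, Prod.fst_sum]
  · simp [invExp, bidegWeight, twistWeight, Prod.snd_sum, Finset.sum_sub_distrib]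

/-- The product of the factorials of the `x`-exponents. -/
def xFactorial (α : Fin d ⊕ Fin (d + 1) →₀ ℕ) : ℕ := ∏ i, (α (Sum.inl i)).factorial

theorem xFactorial_add_single_inr (α : Fin d ⊕ Fin (d + 1) →₀ ℕ) (j : Fin (d + 1)) :
    xFactorial (α + Finsupp.single (Sum.inr j) 1) = xFactorial α := by
  simp [xFactorial]

theorem xFactorial_add_single_inl (α : Fin d ⊕ Fin (d + 1) →₀ ℕ) (i : Fin d) :
    xFactorial (α + Finsupp.single (Sum.inl i) 1) = (α (Sum.inl i) + 1) * xFactorial α := by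
  classical
  rw [xFactorial, xFactorial, ← Finset.mul_prod_erase _ _ (Finset.mem_univ i),
    ← Finset.mul_prod_erase _ (fun i => (α (Sum.inl i)).factorial) (Finset.mem_univ i),
    ← mul_assoc]
  congr 1
  · simp [Nat.factorial_succ]
  · refine Finset.prod_congr rfl fun a ha => ?_
    have : a ≠ i := Finset.ne_of_mem_erase ha
    simp [this.symm]

theorem xFactorial_ne_zero (α : Fin d ⊕ Fin (d + 1) →₀ ℕ) : xFactorial α ≠ 0 :=
  Finset.prod_ne_zero_iff.2 fun _ _ => Nat.factorial_ne_zero _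

theorem invExp_add_single_inr (α : Fin d ⊕ Fin (d + 1) →₀ ℕ) (j : Fin (d + 1)) :
    invExp (α + Finsupp.single (Sum.inr j) 1) =
      expHom _ (Finsupp.single (Sum.inr j) 1) + invExp α := by
  ext v
  change _ = ((Finsupp.single (Sum.inr j) 1 : _ →₀ ℕ) v : ℤ) + invExp α v
  rcases v with i | j'
  · simp [invExp]
  · simp [invExp, add_comm]

theorem expHom_single_add_invExp (α : Fin d ⊕ Fin (d + 1) →₀ ℕ) (i : Fin d) :
    expHom _ (Finsupp.single (Sum.inl i) 1) + invExp (α + Finsupp.single (Sum.inl i) 1) =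
      invExp α := by
  ext v
  change ((Finsupp.single (Sum.inl i) 1 : _ →₀ ℕ) v : ℤ) + invExp _ v = invExp α v
  rcases v with i' | j
  · simp [invExp]
    ring
  · simp [invExp]

/-- The linear map `x^α T^β ↦ α! x^{-α-1} T^β`. -/
def inversePoly (k : Type u) [Field k] (d : ℕ) :
    PolyS k d →ₗ[k] Laurent k (Fin d ⊕ Fin (d + 1)) :=
  (basisMonomials _ k).constr k fun α => AddMonoidAlgebra.single (invExp α) (xFactorial α : k)

theorem inversePoly_monomial (α : Fin d ⊕ Fin (d + 1) →₀ ℕ) (c : k) :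
    inversePoly k d (monomial α c) = AddMonoidAlgebra.single (invExp α) (c * xFactorial α) := by
  have h : (monomial α c : PolyS k d) = c • basisMonomials _ k α := by
    rw [coe_basisMonomials, smul_monomial, smul_eq_mul, mul_one]
  rw [h, map_smul, inversePoly, Module.Basis.constr_basis, AddMonoidAlgebra.smul_single,
    smul_eq_mul]

theorem coeff_inversePoly (h : PolyS k d) (α : Fin d ⊕ Fin (d + 1) →₀ ℕ) :
    (inversePoly k d h).coeff (invExp α) = coeff α h * xFactorial α := by
  classical
  induction h using MvPolynomial.induction_on' with
  | monomial β c =>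
    rw [inversePoly_monomial, AddMonoidAlgebra.coeff_single, Finsupp.single_apply, coeff_monomial]
    by_cases h : β = α
    · rw [if_pos h, if_pos (congrArg invExp h), h]
    · rw [if_neg h, if_neg (fun h' => h (invExp_injective h')), zero_mul]
  | add p q hp hq =>
    rw [map_add, AddMonoidAlgebra.coeff_add, Finsupp.add_apply, hp, hq, coeff_add, add_mul]

theorem inversePoly_mem_supportedOn {A : Set (Fin d ⊕ Fin (d + 1) → ℤ)} {h : PolyS k d}
    (hA : ∀ α, coeff α h ≠ 0 → invExp α ∈ A) : inversePoly k d h ∈ supportedOn k A := by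
  rw [h.as_sum, map_sum]
  refine Submodule.sum_mem _ fun α hα => ?_
  rw [inversePoly_monomial]
  exact single_mem_supportedOn (hA α (mem_support_iff.1 hα)) _

theorem inversePoly_mem_localExp (h : PolyS k d) :
    inversePoly k d h ∈ supportedOn k (localExp (varRank d) d) :=
  inversePoly_mem_supportedOn fun α _ => invExp_mem_localExp α

theorem inversePoly_mem_of_isWeightedHomogeneous {h : PolyS k d} {n : ℤ × ℤ}
    (hh : IsWeightedHomogeneous (twistWeight d) h n) : inversePoly k d h ∈
      supportedOn k {e | expDegree (bidegWeight d) e = n - ((0 : ℤ), (d : ℤ))} :=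
  inversePoly_mem_supportedOn fun α hα => by
    change expDegree _ _ = _
    rw [expDegree_invExp, hh hα]

/-- `V_d`: the Laurent polynomials that vanish in the top local cohomology. -/
abbrev vanishing (k : Type u) [Field k] (d : ℕ) : Submodule k (Laurent k (Fin d ⊕ Fin (d + 1))) :=
  supportedOn k (partialExp (varRank d) d d)

theorem toLaurent_mul_mem_vanishing (s : PolyS k d) {z : Laurent k (Fin d ⊕ Fin (d + 1))}
    (hz : z ∈ vanishing k d) : toLaurent s * z ∈ vanishing k d :=
  mul_mem_supportedOn (isUpperExp_partialExp (varRank d) d d)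
    (toLaurent_mem_supportedOn fun α _ v => Int.natCast_nonneg (α v)) hz

theorem inversePoly_X_sub_mem (v : Fin d ⊕ Fin (d + 1)) (h : PolyS k d) :
    inversePoly k d (twistedAct k (X v) h) - toLaurent (X v) * inversePoly k d h ∈
      vanishing k d := by
  induction h using MvPolynomial.induction_on' with
  | add p q hp hq =>
    rw [map_add, map_add, map_add, mul_add, add_sub_add_comm]
    exact add_mem hp hq
  | monomial α c =>
    rw [inversePoly_monomial, X, toLaurent_monomial, AddMonoidAlgebra.single_mul_single, one_mul]
    change inversePoly k d (twistedAct k (X v) (monomial α c)) - _ ∈ _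
    rcases v with i | j
    · rw [twistedAct_X_inl, pderiv_monomial]
      by_cases hα : α (Sum.inl i) = 0
      · rw [hα, Nat.cast_zero, mul_zero, monomial_zero, map_zero, zero_sub]
        refine neg_mem (single_mem_supportedOn (A := partialExp (varRank d) d d)
          ⟨?_, Sum.inl i, i.2, ?_⟩ _)
        · exact isUpperExp_localExp (varRank d) d _ (fun v => Int.natCast_nonneg _) _
            (invExp_mem_localExp α)
        · change (0 : ℤ) ≤ ((Finsupp.single (Sum.inl i) 1 : _ →₀ ℕ) (Sum.inl i) : ℤ) + invExp α _
          simp [invExp, hα]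
      · obtain ⟨β, rfl⟩ : ∃ β, α = β + Finsupp.single (Sum.inl i) 1 :=
          ⟨α - Finsupp.single (Sum.inl i) 1, (tsub_add_cancel_of_le (by
            rw [Finsupp.single_le_iff]; omega)).symm⟩
        rw [add_tsub_cancel_right, inversePoly_monomial, expHom_single_add_invExp,
          xFactorial_add_single_inl]
        have h1 : c * ((β + Finsupp.single (Sum.inl i) 1 : _ →₀ ℕ) (Sum.inl i) : ℕ) *
            (xFactorial β : k) = c * ((β (Sum.inl i) + 1) * xFactorial β : ℕ) := by
          rw [Finsupp.add_apply, Finsupp.single_eq_same]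
          push_cast
          ring
        rw [h1, sub_self]
        exact zero_mem _
    · rw [twistedAct_X_inr, X, monomial_mul, one_mul, inversePoly_monomial, add_comm _ α,
        invExp_add_single_inr, xFactorial_add_single_inr, sub_self]
      exact zero_mem _

theorem inversePoly_twistedAct_sub_mem (s h : PolyS k d) :
    inversePoly k d (twistedAct k s h) - toLaurent s * inversePoly k d h ∈ vanishing k d := by
  induction s using MvPolynomial.induction_on generalizing h with
  | C c =>
    have h1 : twistedAct k (C c) h = c • h := by
      rw [show (C c : PolyS k d) = algebraMap k _ c from rfl, AlgHom.commutes,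
        Module.algebraMap_end_apply]
    have h2 : toLaurent (C c : PolyS k d) * inversePoly k d h = c • inversePoly k d h := by
      rw [show (C c : PolyS k d) = monomial 0 c from rfl, toLaurent_monomial, map_zero]
      exact (Algebra.smul_def c (inversePoly k d h)).symm
    rw [h1, h2, map_smul, sub_self]
    exact zero_mem _
  | add p q hp hq =>
    rw [map_add, LinearMap.add_apply, map_add, map_add, add_mul, add_sub_add_comm]
    exact add_mem (hp h) (hq h)
  | mul_X p v hp =>
    have h1 := add_mem (hp (twistedAct k (X v) h))
      (toLaurent_mul_mem_vanishing p (inversePoly_X_sub_mem v h))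
    rw [mul_sub, sub_add_sub_cancel, ← mul_assoc, ← map_mul] at h1
    rw [map_mul, Module.End.mul_apply]
    exact h1

theorem eq_zero_of_inversePoly_mem [CharZero k] {h : PolyS k d}
    (hh : inversePoly k d h ∈ vanishing k d) : h = 0 := by
  ext α
  by_contra hα
  refine invExp_notMem_partialExp α d (hh (invExp α) ?_)
  rw [coeff_inversePoly]
  exact mul_ne_zero hα (Nat.cast_ne_zero.2 (xFactorial_ne_zero α))

theorem exists_sub_inversePoly_mem [CharZero k] {z : Laurent k (Fin d ⊕ Fin (d + 1))}
    (hz : z ∈ supportedOn k (localExp (varRank d) d)) :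
    ∃ h, z - inversePoly k d h ∈ vanishing k d := by
  have hterm : ∀ e : Fin d ⊕ Fin (d + 1) → ℤ, ∃ h : PolyS k d,
      AddMonoidAlgebra.single e (z.coeff e) - inversePoly k d h ∈ vanishing k d := by
    intro e
    by_cases he : z.coeff e = 0
    · refine ⟨0, ?_⟩
      rw [he, AddMonoidAlgebra.single_zero, map_zero, sub_zero]
      exact zero_mem _
    rcases mem_partialExp_or_eq_invExp (hz e he) with h | ⟨α, hα⟩
    · refine ⟨0, ?_⟩
      rw [map_zero, sub_zero]
      exact single_mem_supportedOn h _
    · refine ⟨monomial α (z.coeff e / xFactorial α), ?_⟩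
      rw [inversePoly_monomial, div_mul_cancel₀ _ (Nat.cast_ne_zero.2 (xFactorial_ne_zero α)), ← hα,
        sub_self]
      exact zero_mem _
  choose h hh using hterm
  refine ⟨∑ e ∈ z.coeff.support, h e, ?_⟩
  have h1 : z = ∑ e ∈ z.coeff.support, AddMonoidAlgebra.single e (z.coeff e) :=
    (AddMonoidAlgebra.sum_coeff_single z).symm
  have h2 := sum_mem fun e (_ : e ∈ z.coeff.support) => hh e
  rwa [Finset.sum_sub_distrib, ← h1, ← map_sum] at h2

end Inverse

/-! ### The duality between `𝒦` and the solutions -/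

theorem KoszulResolution.Connects.isCycle {k : Type u} [Field k] {σ : Type*} {G : Type*}
    [AddCommGroup G] {w : σ → G} {rs : List (MvPolynomial σ k)} {top : G}
    {K : KoszulResolution w rs top} {r : σ → ℕ} {d : ℕ}
    (hr : ∀ l < d, ∃ v₀, ∀ v, r v = l ↔ v = v₀) {l : ℕ} (hl : l ≤ d) {z : K.ι l → Laurent k σ}
    {s : MvPolynomial σ k} (h : K.Connects r l z s) : K.IsCycle r l l z := by
  cases l with
  | zero => trivial
  | succ l =>
    obtain ⟨v₀, hv₀⟩ := hr l hl
    obtain ⟨-, y, hy, hzy⟩ := h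
    have h1 := add_mem (chains_mono (partialExp_mono r (Nat.le_succ l) le_rfl) hzy)
      (chains_mono (localExp_subset_partialExp hv₀) hy.mem)
    rwa [sub_add_cancel] at h1

theorem KoszulResolution.nonempty_unique_of_length_eq {k : Type u} [Field k] {σ : Type*}
    {G : Type*} [AddCommGroup G] {w : σ → G} {rs : List (MvPolynomial σ k)} {top : G}
    (K : KoszulResolution w rs top) {n : ℕ} (hn : rs.length = n) : Nonempty (Unique (K.ι n)) := by
  subst hn
  exact ⟨K.uniqueTop⟩

theorem KoszulResolution.ε_eq_top {k : Type u} [Field k] {σ : Type*} {G : Type*}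
    [AddCommGroup G] {w : σ → G} {rs : List (MvPolynomial σ k)} {top : G}
    (K : KoszulResolution w rs top) {n : ℕ} (hn : rs.length = n) (a : K.ι n) : K.ε n a = top := by
  subst hn
  exact K.ε_top a

section Duality

variable {k : Type u} [Field k] {d : ℕ} {rs : List (PolyS k d)} {top : ℤ × ℤ}
  (K : KoszulResolution (bidegWeight d) rs top)

/-- `h` and `s` correspond to each other under the iterated connecting homomorphism. -/
def Corresponds (h s : PolyS k d) : Prop :=
  K.Connects (varRank d) d (fun _ => inversePoly k d h) s

variable {K}

theorem const_mem_chains {ι : Type} {A : Set (Fin d ⊕ Fin (d + 1) → ℤ)}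
    {z : Laurent k (Fin d ⊕ Fin (d + 1))} (hz : z ∈ supportedOn k A) :
    (fun _ => z) ∈ chains k ι A := fun _ => hz

theorem Corresponds.add {h h' s s' : PolyS k d} (H : Corresponds K h s)
    (H' : Corresponds K h' s') : Corresponds K (h + h') (s + s') := by
  have h1 := KoszulResolution.Connects.add H H'
  rw [Corresponds, map_add]
  exact h1

theorem connects_iff_of_sub_mem {y z : K.ι d → Laurent k (Fin d ⊕ Fin (d + 1))} {s : PolyS k d}
    (H : K.Connects (varRank d) d y s)
    (hyz : z - y ∈ chains k _ (partialExp (varRank d) d d)) : K.Connects (varRank d) d z s := by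
  have h1 := H.add
    (KoszulResolution.connects_zero_of_mem_partialExp (K := K) exists_varRank_eq le_rfl hyz)
  rwa [add_sub_cancel, add_zero] at h1

theorem Corresponds.smul {h s : PolyS k d} (t : PolyS k d) (H : Corresponds K h s) :
    Corresponds K (twistedAct k t h) (t * s) :=
  connects_iff_of_sub_mem (KoszulResolution.Connects.smul t H)
    fun _ => inversePoly_twistedAct_sub_mem t h

theorem Corresponds.eq_zero [CharZero k] (hlen : rs.length = d) {h s : PolyS k d}
    (H : Corresponds K h s) (hs : s ∈ Ideal.ofList rs) : h = 0 := by
  obtain ⟨y, -, v, hv, hyv⟩ := KoszulResolution.Connects.isBoundary exists_varRank_eq le_rfl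
    (KoszulResolution.Connects.congr H (t := 0) (by rw [zero_sub]; exact neg_mem hs))
  have := K.isEmpty (d + 1) (by omega)
  have hy : y = 0 := Subsingleton.elim _ _
  rw [hy, map_zero, zero_add] at hyv
  obtain ⟨hu⟩ := K.nonempty_unique_of_length_eq hlen
  have h1 := hv hu.default
  rw [← hyv] at h1
  exact eq_zero_of_inversePoly_mem h1

theorem Corresponds.mem_of_eq_zero {s : PolyS k d} (H : Corresponds K 0 s) :
    s ∈ Ideal.ofList rs := by
  refine KoszulResolution.Connects.mem_of_isBoundary exists_varRank_eq le_rfl H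
    ⟨0, zero_mem _, 0, zero_mem _, ?_⟩
  rw [map_zero, map_zero, add_zero]
  rfl

theorem Corresponds.sub_mem {h s s' : PolyS k d} (H : Corresponds K h s)
    (H' : Corresponds K h s') : s - s' ∈ Ideal.ofList rs := by
  have h1 := H.add (H'.smul (-1))
  rw [map_neg, map_one, LinearMap.neg_apply, Module.End.one_apply, add_neg_cancel, neg_one_mul,
    ← sub_eq_add_neg] at h1
  exact h1.mem_of_eq_zero

/-- The ideal of polynomials that annihilate `h` in `S_𝓕`. -/
def twistedAnnihilator (h : PolyS k d) : Ideal (PolyS k d) where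
  carrier := {s | twistedAct k s h = 0}
  zero_mem' := by simp
  add_mem' {a b} ha hb := by
    change twistedAct k (a + b) h = 0
    rw [map_add, LinearMap.add_apply, ha, hb, add_zero]
  smul_mem' c a ha := by
    change twistedAct k (c * a) h = 0
    rw [map_mul, Module.End.mul_apply, ha, map_zero]

theorem mem_twistedAnnihilator_iff [CharZero k] {h s : PolyS k d} :
    s ∈ twistedAnnihilator h ↔ toLaurent s * inversePoly k d h ∈ vanishing k d := by
  have h1 := inversePoly_twistedAct_sub_mem s h
  constructor
  · intro hs
    rw [show twistedAct k s h = 0 from hs, map_zero, zero_sub] at h1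
    exact neg_mem_iff.1 h1
  · intro hs
    have h2 := add_mem h1 hs
    rw [sub_add_cancel] at h2
    exact eq_zero_of_inversePoly_mem h2

theorem isCycle_inversePoly_iff [CharZero k] (hlen : rs.length = d) (hd : 0 < d) (h : PolyS k d) :
    K.IsCycle (varRank d) d d (fun _ => inversePoly k d h) ↔
      Ideal.ofList rs ≤ twistedAnnihilator h := by
  obtain ⟨n, rfl⟩ : ∃ n, d = n + 1 := ⟨d - 1, by omega⟩
  obtain ⟨hu⟩ := K.nonempty_unique_of_length_eq hlen
  rw [← K.span_top n hlen.symm hu.default, Ideal.span_le]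
  have h1 : ∀ a, K.bd n (fun _ => inversePoly k (n + 1) h) a =
      toLaurent (K.D n a hu.default) * inversePoly k (n + 1) h := by
    intro a
    change ∑ b, toLaurent (K.D n a b) * inversePoly k (n + 1) h = _
    rw [Fintype.sum_eq_single hu.default fun b hb => absurd (hu.eq_default b) hb]
  constructor
  · rintro hc _ ⟨a, rfl⟩
    refine mem_twistedAnnihilator_iff.2 ?_
    rw [← h1]
    exact hc a
  · intro hs a
    rw [h1]
    exact mem_twistedAnnihilator_iff.1 (hs ⟨a, rfl⟩)

theorem exists_corresponds [CharZero k] (hlen : rs.length = d) (hd : 0 < d) {h : PolyS k d}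
    (hh : Ideal.ofList rs ≤ twistedAnnihilator h) : ∃ s, Corresponds K h s ∧
      ∀ n, IsWeightedHomogeneous (twistWeight d) h n →
        IsWeightedHomogeneous (bidegWeight d) s (n - ((0 : ℤ), (d : ℤ)) + top) := by
  obtain ⟨s, hs, hsn⟩ := KoszulResolution.exists_connects (K := K) exists_varRank_eq le_rfl
    (const_mem_chains (inversePoly_mem_localExp h)) ((isCycle_inversePoly_iff hlen hd h).2 hh)
  refine ⟨s, hs, fun n hn => hsn _ fun a => ?_⟩
  beta_reduce
  rw [K.ε_eq_top hlen, add_sub_cancel_right]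
  exact inversePoly_mem_of_isWeightedHomogeneous hn

theorem Corresponds.exists_pow_mul_mem {h s : PolyS k d} (H : Corresponds K h s) (i : Fin d) :
    ∃ N : ℕ, X (Sum.inl i) ^ N * s ∈ Ideal.ofList rs :=
  KoszulResolution.Connects.exists_pow_mul_mem exists_varRank_eq le_rfl H (Sum.inl i) i.2

theorem Corresponds.le_twistedAnnihilator [CharZero k] (hlen : rs.length = d) (hd : 0 < d)
    {h s : PolyS k d} (H : Corresponds K h s) : Ideal.ofList rs ≤ twistedAnnihilator h :=
  (isCycle_inversePoly_iff hlen hd h).1 (KoszulResolution.Connects.isCycle exists_varRank_eq le_rfl H)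

theorem exists_corresponds_of_pow_mul_mem [CharZero k] (hlen : rs.length = d) {s : PolyS k d}
    (hs : ∀ i : Fin d, ∃ N : ℕ, X (Sum.inl i) ^ N * s ∈ Ideal.ofList rs) :
    ∃ h, Corresponds K h s := by
  obtain ⟨z, hz⟩ := KoszulResolution.exists_connects_of_pow_mul_mem (K := K) exists_varRank_eq
    (le_refl d) (s := s) (by
      rintro (i | j) h
      · exact hs i
      · simp [varRank] at h)
  obtain ⟨hu⟩ := K.nonempty_unique_of_length_eq hlen
  obtain ⟨h, hh⟩ := exists_sub_inversePoly_mem (hz.mem hu.default)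
  refine ⟨h, connects_iff_of_sub_mem hz fun a => ?_⟩
  rw [hu.eq_default a, ← neg_sub]
  exact neg_mem hh

end Duality

theorem nonempty_koszulResolution_symEq {k : Type u} [Field k] {d : ℕ}
    {f : Fin (d + 1) → PolyR k d} {φ : Matrix (Fin (d + 1)) (Fin d) (PolyR k d)} {δ : Fin d → ℕ}
    (hφ : IsResolutionMatrix f φ δ) (hf : idealOf f ≠ ⊥) (hG : SatisfiesG (idealOf f)) :
    Nonempty (KoszulResolution (bidegWeight d) (List.ofFn (symEq φ))
      ((d : ℤ), ((∑ j, δ j : ℕ) : ℤ))) := by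
  have h1 : (List.ofFn fun j => (symEq φ j, ((1 : ℤ), (δ j : ℤ)))).map Prod.fst =
      List.ofFn (symEq φ) := by
    rw [List.map_ofFn]
    rfl
  have h2 : ((List.ofFn fun j => (symEq φ j, ((1 : ℤ), (δ j : ℤ)))).map Prod.snd).sum =
      ((d : ℤ), ((∑ j, δ j : ℕ) : ℤ)) := by
    rw [List.map_ofFn, List.sum_ofFn]
    ext
    · simp [Prod.fst_sum]
    · simp [Prod.snd_sum]
  rw [← h1, ← h2]
  refine nonempty_koszulResolution _ _ ?_ ?_
  · intro p hp
    obtain ⟨j, rfl⟩ := List.mem_ofFn.1 hp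
    exact symEq_isWeightedHomogeneous hφ.homogeneous j
  · rw [h1]
    exact isWeaklyRegular_symEq hφ hf hG

theorem mem_solF_iff_le {k : Type u} [Field k] {d : ℕ} {g : Fin d → PolyS k d} {h : TwistS k d} :
    h ∈ solF g ↔ Ideal.ofList (List.ofFn g) ≤ twistedAnnihilator (TwistS.toS k d h) := by
  rw [ofList_ofFn, Ideal.span_le, Set.range_subset_iff]
  rfl

theorem bigradedIsomorphic_kernelK_solF {k : Type u} [Field k] [CharZero k] {d ν : ℕ} (hd : 0 < d)
    {f : Fin (d + 1) → PolyR k d} {φ : Matrix (Fin (d + 1)) (Fin d) (PolyR k d)} {δ : Fin d → ℕ}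
    (hφ : IsResolutionMatrix f φ δ) (hf : idealOf f ≠ ⊥) (hG : SatisfiesG (idealOf f))
    (hδ : ∑ j, δ j = ν) : BigradedIsomorphic (k := k) (d := d) (gradeK f)
      (shift (gradeSol (symEq φ)) (-(d : ℤ), -(ν : ℤ) + (d : ℤ))) := by
  obtain ⟨K⟩ := nonempty_koszulResolution_symEq hφ hf hG
  have hlen : (List.ofFn (symEq φ)).length = d := List.length_ofFn
  have hβ : ∀ s, symPresentation f s = 0 ↔ s ∈ Ideal.ofList (List.ofFn (symEq φ)) := fun s => by
    rw [ofList_ofFn, symPresentation_eq_zero_iff hφ]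
  have hK : ∀ s, symPresentation f s ∈ kernelK f ↔
      ∀ i : Fin d, ∃ N : ℕ, X (Sum.inl i) ^ N * s ∈ Ideal.ofList (List.ofFn (symEq φ)) :=
    fun s => by rw [ofList_ofFn, symPresentation_mem_kernelK_iff hφ hf hG hd]
  have hex : ∀ h : solF (symEq φ), ∃ s, Corresponds K (TwistS.toS k d h) s ∧
      ∀ n, IsWeightedHomogeneous (twistWeight d) (TwistS.toS k d h) n →
        IsWeightedHomogeneous (bidegWeight d) s
          (n - ((0 : ℤ), (d : ℤ)) + ((d : ℤ), ((∑ j, δ j : ℕ) : ℤ))) := fun h =>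
    exists_corresponds (K := K) hlen hd (mem_solF_iff_le.1 h.2)
  choose s hs hsn using hex
  have huniq : ∀ (h : solF (symEq φ)) t, Corresponds K (TwistS.toS k d h) t →
      symPresentation f (s h) = symPresentation f t := fun h t ht => by
    rw [← sub_eq_zero, ← map_sub, hβ]
    exact (hs h).sub_mem ht
  have hadd : ∀ h h' : solF (symEq φ), symPresentation f (s (h + h')) =
      symPresentation f (s h) + symPresentation f (s h') := fun h h' => by
    rw [← map_add]
    refine huniq _ _ ?_
    rw [Submodule.coe_add, map_add]
    exact (hs h).add (hs h')
  have hsmul : ∀ (t : PolyS k d) (h : solF (symEq φ)), symPresentation f (s (t • h)) =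
      symPresentation f t * symPresentation f (s h) := fun t h => by
    rw [← map_mul]
    refine huniq _ _ ?_
    rw [Submodule.coe_smul, TwistS.toS_smul]
    exact (hs h).smul t
  let E : solF (symEq φ) →ₗ[PolyS k d] kernelK f :=
    { toFun := fun h => ⟨symPresentation f (s h), (hK _).2 (hs h).exists_pow_mul_mem⟩
      map_add' := fun h h' => Subtype.ext (hadd h h')
      map_smul' := fun t h => Subtype.ext (hsmul t h) }
  have hE : Function.Bijective E := by
    constructor
    · rw [injective_iff_map_eq_zero]
      intro h hh
      have h1 : symPresentation f (s h) = 0 := congrArg Subtype.val hh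
      exact Subtype.ext ((TwistS.toS k d).injective ((hs h).eq_zero hlen ((hβ _).1 h1)))
    · rintro ⟨m, hm⟩
      obtain ⟨t, rfl⟩ := symPresentation_surjective f m
      obtain ⟨h, hh⟩ := exists_corresponds_of_pow_mul_mem (K := K) hlen ((hK t).1 hm)
      exact ⟨⟨(TwistS.toS k d).symm h, mem_solF_iff_le.2 (hh.le_twistedAnnihilator hlen hd)⟩,
        Subtype.ext (huniq _ _ hh)⟩
  have hbK := isBigraded_gradeK hφ hf hG hd
  have hbS := isBigraded_shift_gradeSol (symEq_isWeightedHomogeneous hφ.homogeneous)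
    (-(d : ℤ), -(ν : ℤ) + (d : ℤ))
  refine ⟨hbK, hbS, (LinearEquiv.ofBijective E hE).symm, fun a m => ?_⟩
  have h1 := mem_iff_of_isInternal hbS.isInternal hbK.isInternal
    (LinearEquiv.ofBijective E hE).toAddEquiv (fun a h hh => ?_) a
    ((LinearEquiv.ofBijective E hE).symm m)
  · rw [h1]
    change _ ↔ (LinearEquiv.ofBijective E hE) ((LinearEquiv.ofBijective E hE).symm m) ∈ _
    rw [LinearEquiv.apply_symm_apply]
  · refine ⟨s h, ?_, rfl⟩
    have h2 := hsn h _ hh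
    have h3 : (-(d : ℤ), -(ν : ℤ) + (d : ℤ)) + a - (0, (d : ℤ)) + ((d : ℤ), ((ν : ℕ) : ℤ)) = a := by
      ext
      · simp
      · simp
        ring
    rw [hδ, h3] at h2
    exact h2

end ReesDmod

end

theorem theoremA {k : Type*} [Field k] [CharZero k] (d : ℕ) (hd : 3 ≤ d) (ν : ℕ)
    (f : Fin (d + 1) → MvPolynomial (Fin d) k)
    (hdeg : ∀ i, (f i).IsHomogeneous ν)
    (hmin : Submodule.spanFinrank (Ideal.span (Set.range f)) = d + 1)
    (hht : (Ideal.span (Set.range f)).height = 2)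
    (hperf : ReesDmod.IsPerfectIdeal (Ideal.span (Set.range f)))
    (hG : ReesDmod.SatisfiesG (Ideal.span (Set.range f))) :
    (∃ (φ : Matrix (Fin (d + 1)) (Fin d) (MvPolynomial (Fin d) k)) (δ : Fin d → ℕ),
      ReesDmod.IsResolutionMatrix f φ δ) ∧
    ∀ (φ : Matrix (Fin (d + 1)) (Fin d) (MvPolynomial (Fin d) k)) (δ : Fin d → ℕ),
      ReesDmod.IsResolutionMatrix f φ δ →
      ReesDmod.BigradedIsomorphic (k := k) (d := d)
        (ReesDmod.gradeK f)
        (ReesDmod.shift (ReesDmod.gradeSol (ReesDmod.symEq φ)) (-(d : ℤ), -(ν : ℤ) + (d : ℤ))) := by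
  have hf : Ideal.span (Set.range f) ≠ ⊥ := by
    intro h
    rw [h, Ideal.height_bot] at hht
    simp at hht
  exact ⟨ReesDmod.exists_resolutionMatrix hdeg hht hperf, fun φ δ hφ =>
    ReesDmod.bigradedIsomorphic_kernelK_solF (by omega) hφ hf hG
      (ReesDmod.sum_degrees_eq hdeg hht hφ)⟩
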